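/- Let $d\ge 2$ be even and let $L,M,r>0$, $Q\in\mathbb R$. Let $\xi$ and $A_1,\dots,A_d$ be smooth real functions on the torus $(\mathbb R/L\mathbb Z)^d$, put $F_{\mu\nu}=\partial_\mu A_\nu-\partial_\nu A_\mu$, and let $\gamma_1,\dots,\gamma_d$ be anti-hermitian $2^{d/2}\times 2^{d/2}$ matrices with $\gamma_\mu\gamma_\nu+\gamma_\nu\gamma_\mu=-2\delta_{\mu\nu}I$; put $\gamma_{d+1}=i^{d/2}\gamma_1\gamma_2\cdots\gamma_d$. For $a=L/N$, $N=1,2,\dots$, let $\dot V_a$ be the space of complex functions on the lattice $(a\mathbb Z/L\mathbb Z)^d$ with the anti-periodic boundary condition, with the inner product $a^d\sum_x\overline{v(x)}u(x)$, and let $V_a=\mathbb C^{2^{d/2}}\otimes\dot V_a$. Functions on the torus act on $\dot V_a$ by multiplication. With $T_{\mu0}u(x)=u(x+ae_\mu)$, $U_\mu(x)=\exp\bigl(-iQ\int_0^aA_\mu(x+se_\mu)\,ds\bigr)$ and $T_\mu=U_\mu T_{\mu0}$ put $$D_\mu=\tfrac1{2a}(T_\mu-T_\mu^*),\quad W=-\sum_{\mu=1}^d(2-T_\mu-T_\mu^*),\quad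 L_{\rm op}=M-\tfrac r{2a}W,\quad C=L_{\rm op}-\sum_{\mu=1}^dD_\mu L_{\rm op}^{-1}D_\mu,$$ $$X_{\mu\nu}=D_\mu L_{\rm op}^{-1}D_\nu-D_\nu L_{\rm op}^{-1}D_\mu,\qquad B=\tfrac12\sum_{\mu,\nu=1}^d\gamma_\mu\gamma_\nu X_{\mu\nu}.$$ Let $D_{\mu0},W_0,L_0,C_0$ be the operators obtained from $D_\mu,W,L_{\rm op},C$ on replacing every $T_\mu$ by $T_{\mu0}$, and $E_{\mu0}=\frac12(T_{\mu0}+T_{\mu0}^*)$. Define $$z^{(d/2)}=-i\,{\rm Tr}_{V_a}\Bigl[\tfrac r{2a}(\xi W+W\xi)\,C^{-1}(-BC^{-1})^{d/2}\gamma_{d+1}\Bigr],$$ $$\bar X_{\mu\nu}=-iQ\Bigl(F_{\mu\nu}E_{\mu0}E_{\nu0}L_0^{-1}+2ar\sum_{\rho=1}^dF_{\rho\nu}L_0^{-2}D_{\rho0}D_{\mu0}E_{\nu0}\Bigr),$$ $$z_0=-i^{d/2+1}\sum_{\mu_1,\dots,\mu_{d/2}=1}^d\ \sum_{\nu_1,\dots,\nu_{d/2}=1}^d\epsilon_{\mu_1\nu_1\dots\mu_{d/2}\nu_{d/2}}{\rm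 Tr}_{\dot V_a}\Bigl[:\tfrac ra\,\xi W_0C_0^{-1}\bar X_{\mu_1\nu_1}C_0^{-1}\cdots\bar X_{\mu_{d/2}\nu_{d/2}}C_0^{-1}:\Bigr],$$ where $\epsilon$ is the totally antisymmetric tensor and $:\ :$ is the normal product, which expands the expression and in each term moves all multiplication operators (the functions $\xi$ and $F_{\mu\nu}$) to the front, keeping the order of the other factors. Then $$\lim_{a\to0}\bigl(z^{(d/2)}-z_0\bigr)=0,$$ the limit being taken along $a=L/N$, $N\to\infty$. -/

import Mathlib

open Matrix Filter Topology
open scoped Kronecker ContDiff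

noncomputable section

namespace WilsonFermion

/-- Sites of the discrete torus with `N` points in each of the `d` directions. -/
abbrev Site (d N : ℕ) : Type := Fin d → ZMod N

/-- Linear operators on the scalar lattice functions `Site d N → ℂ`, written as matrices
(row = output site). For the inner product `a ^ d * ∑ x, conj (v x) * u x` the adjoint of an
operator is its conjugate transpose. -/
abbrev Op (d N : ℕ) : Type := Matrix (Site d N) (Site d N) ℂ

/-- Lattice spacing of the torus of period `L` with `N` points in each direction. -/
def spacing (L : ℝ) (N : ℕ) : ℝ := L / N

/-- The representative in `[0, L) ^ d` of a site. -/
def position {d N : ℕ} (L : ℝ) (x : Site d N) : Fin d → ℝ :=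
  fun μ => spacing L N * ((x μ).val : ℝ)

/-- A function on `ℝ ^ d` that has period `L` in every coordinate, that is, a function on the
torus `(ℝ / L ℤ) ^ d`. -/
def IsPeriodic {d : ℕ} (L : ℝ) (f : (Fin d → ℝ) → ℝ) : Prop :=
  ∀ (x : Fin d → ℝ) (ν : Fin d), f (x + Pi.single ν L) = f x

/-- The field strength `F μ ν = ∂_μ A_ν - ∂_ν A_μ`. -/
def fieldStrength {d : ℕ} (A : Fin d → (Fin d → ℝ) → ℝ) (μ ν : Fin d) (x : Fin d → ℝ) : ℝ :=
  fderiv ℝ (A ν) x (Pi.single μ 1) - fderiv ℝ (A μ) x (Pi.single ν 1)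

/-- The gauge group element on the link from `x` to `x + a e_μ`,
`exp (- i Q ∫_0^a A_μ (x + s e_μ) ds)`. -/
def link {d : ℕ} (Q : ℝ) (A : Fin d → (Fin d → ℝ) → ℝ) (a : ℝ) (μ : Fin d)
    (x : Fin d → ℝ) : ℂ :=
  Complex.exp (-(Complex.I * (Q : ℂ) *
    ((∫ s in (0 : ℝ)..a, A μ (x + Pi.single μ s) : ℝ) : ℂ)))

section operators

variable {d N : ℕ} [NeZero N]

/-- Free translation `(T u)(x) = u (x + a e_μ)` with the anti-periodic boundary condition:
lattice functions are stored by their values at `0, a, …, (N - 1) a` in each coordinate, and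
a step from `(N - 1) a` to `N a`, identified with `0`, produces the sign `-1`. -/
def freeShift (μ : Fin d) : Op d N :=
  Matrix.of fun x y =>
    if y = x + Pi.single μ 1 then (if x μ = -1 then -1 else 1) else 0

/-- Multiplication operator given by a function on the continuum torus. -/
def mulOp (L : ℝ) (φ : (Fin d → ℝ) → ℂ) : Op d N :=
  Matrix.diagonal fun x => φ (position L x)

/-- Covariant translation `T_μ = U_μ T_{μ0}`. -/
def covShift (L Q : ℝ) (A : Fin d → (Fin d → ℝ) → ℝ) (μ : Fin d) : Op d N :=
  mulOp L (link Q A (spacing L N) μ) * freeShift μ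

/-! The following operators are built from a family `T` of translations. The full operators
are obtained with `T = covShift L Q A`, their free parts (the operators for a vanishing gauge
field) with `T = freeShift`. -/

/-- `D_μ = (T_μ - T_μ^*) / (2 a)`. -/
def opD (a : ℝ) (T : Fin d → Op d N) (μ : Fin d) : Op d N :=
  (1 / (2 * (a : ℂ))) • (T μ - (T μ)ᴴ)

/-- `E_μ = (T_μ + T_μ^*) / 2`. -/
def opE (T : Fin d → Op d N) (μ : Fin d) : Op d N :=
  (1 / 2 : ℂ) • (T μ + (T μ)ᴴ)

/-- The Wilson term `W = - ∑ μ, (2 - T_μ - T_μ^*)`. -/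
def opW (T : Fin d → Op d N) : Op d N :=
  -∑ μ, ((2 : ℂ) • (1 : Op d N) - T μ - (T μ)ᴴ)

/-- `L = M - (r / (2 a)) W`. -/
def opL (M r a : ℝ) (T : Fin d → Op d N) : Op d N :=
  (M : ℂ) • (1 : Op d N) - ((r : ℂ) / (2 * (a : ℂ))) • opW T

/-- `C = L - ∑ μ, D_μ L⁻¹ D_μ`. -/
def opC (M r a : ℝ) (T : Fin d → Op d N) : Op d N :=
  opL M r a T - ∑ μ, opD a T μ * (opL M r a T)⁻¹ * opD a T μ

/-- `X_{μν} = D_μ L⁻¹ D_ν - D_ν L⁻¹ D_μ`. -/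
def opX (M r a : ℝ) (T : Fin d → Op d N) (μ ν : Fin d) : Op d N :=
  opD a T μ * (opL M r a T)⁻¹ * opD a T ν - opD a T ν * (opL M r a T)⁻¹ * opD a T μ

end operators

/-! Spinor operators: matrices on `ℂ ^ n ⊗ (Site d N → ℂ)`, where `n` is the dimension of the
fibre. A scalar operator `K` acts as `1 ⊗ₖ K` and a matrix `γ` on the fibre as `γ ⊗ₖ 1`. -/

/-- Anti-hermitian Dirac matrices in `d` dimensions, acting on `ℂ ^ n`. -/
def IsDirac {d n : ℕ} (γ : Fin d → Matrix (Fin n) (Fin n) ℂ) : Prop :=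
  (∀ μ, (γ μ)ᴴ = -γ μ) ∧
    ∀ μ ν, γ μ * γ ν + γ ν * γ μ = if μ = ν then -((2 : ℂ) • 1) else 0

/-- The chirality `i ^ (d / 2) γ_1 γ_2 ⋯ γ_d` in `d = 2 m` dimensions. -/
def chirality {m n : ℕ} (γ : Fin (2 * m) → Matrix (Fin n) (Fin n) ℂ) :
    Matrix (Fin n) (Fin n) ℂ :=
  Complex.I ^ m • (List.ofFn γ).prod

/-- `B = (1 / 2) ∑ μ ν, γ_μ γ_ν X_{μν}`. -/
def opB {d N n : ℕ} [NeZero N] (γ : Fin d → Matrix (Fin n) (Fin n) ℂ) (M r a : ℝ)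
    (T : Fin d → Op d N) : Matrix (Fin n × Site d N) (Fin n × Site d N) ℂ :=
  (1 / 2 : ℂ) • ∑ μ, ∑ ν, (γ μ * γ ν) ⊗ₖ opX M r a T μ ν

/-- `z^{(j)} = - i Tr [ (r / (2 a)) (ξ W + W ξ) C⁻¹ (- B C⁻¹) ^ j γ_{d+1} ]`, the trace being
taken over spinor lattice functions, with `d = 2 m` and `a = L / N`. -/
def zTerm {m n : ℕ} (γ : Fin (2 * m) → Matrix (Fin n) (Fin n) ℂ) (L M r Q : ℝ)
    (A : Fin (2 * m) → (Fin (2 * m) → ℝ) → ℝ) (ξ : (Fin (2 * m) → ℝ) → ℝ)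
    (N : ℕ) [NeZero N] (j : ℕ) : ℂ :=
  let a : ℝ := spacing L N
  let T : Fin (2 * m) → Op (2 * m) N := covShift L Q A
  let Ξ : Op (2 * m) N := mulOp L fun x => (ξ x : ℂ)
  let W : Op (2 * m) N := opW T
  let Cinv : Matrix (Fin n × Site (2 * m) N) (Fin n × Site (2 * m) N) ℂ :=
    (1 : Matrix (Fin n) (Fin n) ℂ) ⊗ₖ (opC M r a T)⁻¹;
  -Complex.I * Matrix.trace
    ((((r : ℂ) / (2 * (a : ℂ))) • ((1 : Matrix (Fin n) (Fin n) ℂ) ⊗ₖ (Ξ * W + W * Ξ))) *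
      Cinv * (-(opB γ M r a T * Cinv)) ^ j * (chirality γ ⊗ₖ (1 : Op (2 * m) N)))

/-! Normal product. A formal expression in multiplication operators and free operators is
interpreted in the algebra of functions `x ↦ S x` from sites to operators, with the pointwise
operations: the multiplication operator by `φ` becomes `x ↦ φ x • 1`, a free operator `K`
becomes the constant function `K`. Functions and free operators commute there, free operators
keep their order, and `normalProduct` turns `φ K` into the operator "apply `K`, then multiply
by `φ`". -/

/-- Formal expressions in multiplication operators and free operators, modulo moving the
multiplication operators to the front. -/
abbrev Symb (d N : ℕ) : Type := Site d N → Op d N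

/-- The formal multiplication operator given by a function on the continuum torus. -/
def symbMul {d N : ℕ} (L : ℝ) (φ : (Fin d → ℝ) → ℂ) : Symb d N :=
  fun x => φ (position L x) • (1 : Op d N)

/-- The formal free operator `K`. -/
def symbFree {d N : ℕ} (K : Op d N) : Symb d N := fun _ => K

/-- The operator `:S:` of a formal expression `S`, with all multiplication operators in front. -/
def normalProduct {d N : ℕ} (S : Symb d N) : Op d N := Matrix.of fun x y => S x x y

/-- The normal product of a word moves the multiplication operators to the front. -/
theorem normalProduct_word {d N : ℕ} [NeZero N] (L : ℝ) (φ ψ : (Fin d → ℝ) → ℂ)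
    (K K' : Op d N) :
    normalProduct (symbMul L φ * symbFree K * (symbMul L ψ * symbFree K')) =
      mulOp L φ * mulOp L ψ * (K * K') := by
  ext x y
  simp [normalProduct, symbMul, symbFree, mulOp, Matrix.diagonal_mul, mul_assoc]
  ring

/-- `Xbar_{μν} = - i Q (F_{μν} E_{μ0} E_{ν0} L_0⁻¹
  + 2 a r ∑ ρ, F_{ρν} L_0^{-2} D_{ρ0} D_{μ0} E_{ν0})`, as a formal expression. -/
def Xbar {d : ℕ} (L M r Q : ℝ) (A : Fin d → (Fin d → ℝ) → ℝ) (N : ℕ) [NeZero N]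
    (μ ν : Fin d) : Symb d N :=
  let a : ℝ := spacing L N
  let T : Fin d → Op d N := freeShift
  let F : Fin d → Fin d → Symb d N :=
    fun α β => symbMul L fun x => (fieldStrength A α β x : ℂ)
  let L0inv : Op d N := (opL M r a T)⁻¹;
  (-(Complex.I * (Q : ℂ))) •
    (F μ ν * symbFree (opE T μ * opE T ν * L0inv) +
      (2 * (a : ℂ) * (r : ℂ)) •
        ∑ ρ, F ρ ν * symbFree (L0inv ^ 2 * opD a T ρ * opD a T μ * opE T ν))

/-- The totally antisymmetric tensor `ε_{f 0, f 1, …, f (d - 1)}`. -/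
def epsTensor {d : ℕ} (f : Fin d → Fin d) : ℤ :=
  open scoped Classical in
  if h : Function.Bijective f then (Equiv.Perm.sign (Equiv.ofBijective f h) : ℤ) else 0

/-- The sequence `μ_1, ν_1, μ_2, ν_2, …, μ_m, ν_m`. -/
def interleave {m : ℕ} {α : Type} (μ ν : Fin m → α) : Fin (2 * m) → α := fun i =>
  if (i : ℕ) % 2 = 0 then μ ⟨(i : ℕ) / 2, by omega⟩ else ν ⟨(i : ℕ) / 2, by omega⟩

/-- `z_0 = - i ^ (d / 2 + 1) ∑ μ ν, ε_{μ_1 ν_1 … μ_m ν_m}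
  Tr [ :(r / a) ξ W_0 C_0⁻¹ Xbar_{μ_1 ν_1} C_0⁻¹ ⋯ Xbar_{μ_m ν_m} C_0⁻¹: ]`, the trace being
taken over scalar lattice functions, with `d = 2 m` and `a = L / N`. -/
def zFree {m : ℕ} (L M r Q : ℝ) (A : Fin (2 * m) → (Fin (2 * m) → ℝ) → ℝ)
    (ξ : (Fin (2 * m) → ℝ) → ℝ) (N : ℕ) [NeZero N] : ℂ :=
  let a : ℝ := spacing L N
  let T : Fin (2 * m) → Op (2 * m) N := freeShift
  let W0 : Symb (2 * m) N := symbFree (opW T)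
  let C0inv : Symb (2 * m) N := symbFree (opC M r a T)⁻¹;
  -(Complex.I ^ (m + 1)) *
    ∑ μ : Fin m → Fin (2 * m), ∑ ν : Fin m → Fin (2 * m),
      (epsTensor (interleave μ ν) : ℂ) *
        Matrix.trace (normalProduct
          (((r : ℂ) / (a : ℂ)) • (symbMul L (fun x => (ξ x : ℂ)) * W0 * C0inv *
            (List.ofFn fun j : Fin m => Xbar L M r Q A N (μ j) (ν j) * C0inv).prod)))

end WilsonFermion

end

open WilsonFermion

/-! The theorem follows from a pseudo-differential calculus on the lattice torus, uniform in the
spacing `a`: normal ordering picks out a leading symbol, and every reordering gains a factor 1/(1 +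
|p|) in the momentum p.

In the basis of anti-periodic plane waves an operator becomes a matrix indexed by momenta p, q.
Write λ for `lam`, the size 1 + |p|, and ℓ = 1 + aλ² for `ell`. Entries are bounded by a weight at p
and decay faster than any power of the distance from p to q (`IsOfOrder`). Then D has order λ,
(r/2a)W has order aλ², L has order ℓ, and C has order λ²/ℓ. A smooth function has order 1
(`isOfOrder_mulF`), and its commutator with a free operator gains 1/λ (`IsMultiplier.commutator`).
`Quantizes` says that an operator is a normal product up to such a gain; it is stable under sums and
products. For inverses, the free symbols are bounded below (`le_symbL`, `le_symbC`; here the Wilson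
term removes the doublers), while L and C are at least M as quadratic forms; together these give
`isOfOrder_inv_sub_inv`.

The naive order λ²/ℓ of X drops to 1/ℓ, because X can be written with the commutators [D_μ, D_ν] and
[L, D_μ] (`famX_eq`), whose leading parts are given by the curvature (`exists_plaquette_expansion`).
So the operator in the trace has order aλ² · (ℓ/λ²) · (1/λ²)^(d/2) = aℓ/λ^d, and its difference from
the normal product has order aℓ/λ^(d+1), which is at most a constant times a/λ^d because ℓ ≤ cλ. Up
to a constant, λ^d dominates ∏(1 + |p_i|), so the trace of the difference is O(a (1 + log N)^d) and
tends to 0 (`IsOfOrder.tendsto_trace`).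

The rest is algebra, exact at each `a`. The trace over spinors against the chirality produces ε
(`trace_spin_expansion`), and the symbol of X is the antisymmetrization of `Xbar` (`symbX_eq`),
which makes no difference under contraction with ε (`sum_epsTensor_antisymmetrize`). -/

noncomputable section

/-! ### Functions jointly smooth in the lattice spacing and the position. -/

namespace WilsonFermion

/-- Differentiation under the integral replaces `F` by a partial derivative that takes values in
linear maps, so the induction on `n` has to quantify over the target space `G`. -/
theorem contDiff_nat_parametric_integral {E : Type} [NormedAddCommGroup E] [NormedSpace ℝ E]
    [FiniteDimensional ℝ E] (n : ℕ) :
    ∀ {G : Type} [NormedAddCommGroup G] [NormedSpace ℝ G] [CompleteSpace G]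
      {F : ℝ × E → G}, ContDiff ℝ ∞ F →
      ContDiff ℝ n (fun y => ∫ t in (0 : ℝ)..1, F (t, y)) := by
  have key : ∀ {G : Type} [NormedAddCommGroup G] [NormedSpace ℝ G] [CompleteSpace G]
      {F : ℝ × E → G}, ContDiff ℝ ∞ F → ∀ y : E,
      HasFDerivAt (fun y => ∫ t in (0 : ℝ)..1, F (t, y))
        (∫ t in (0 : ℝ)..1, (fderiv ℝ F (t, y)).comp (ContinuousLinearMap.inr ℝ ℝ E)) y := by
    intro G _ _ _ F hF y
    have hcont : Continuous fun z : ℝ × E =>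
        (fderiv ℝ F z).comp (ContinuousLinearMap.inr ℝ ℝ E) :=
      (hF.continuous_fderiv (by simp)).clm_comp continuous_const
    have hK : IsCompact (Set.Icc (0 : ℝ) 1 ×ˢ Metric.closedBall y 1) :=
      isCompact_Icc.prod (isCompact_closedBall y 1)
    obtain ⟨B, hB⟩ := hK.exists_bound_of_continuousOn hcont.continuousOn
    refine intervalIntegral.hasFDerivAt_integral_of_dominated_of_fderiv_le
      (F := fun y t => F (t, y))
      (F' := fun y t => (fderiv ℝ F (t, y)).comp (ContinuousLinearMap.inr ℝ ℝ E))
      (bound := fun _ => B) (s := Metric.ball y 1) (Metric.ball_mem_nhds y one_pos)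
      ?_ ?_ ?_ ?_ ?_ ?_
    · refine Eventually.of_forall fun z => ?_
      exact (hF.continuous.comp (by fun_prop : Continuous fun t : ℝ => (t, z))).aestronglyMeasurable
    · exact (hF.continuous.comp (by fun_prop : Continuous fun t : ℝ => (t, y))).intervalIntegrable _ _
    · exact (hcont.comp (by fun_prop : Continuous fun t : ℝ => (t, y))).aestronglyMeasurable
    · refine Eventually.of_forall fun t ht z hz => hB (t, z) ⟨?_, Metric.ball_subset_closedBall hz⟩
      rw [Set.uIoc_of_le zero_le_one] at ht
      exact ⟨ht.1.le, ht.2⟩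
    · exact intervalIntegrable_const
    · refine Eventually.of_forall fun t _ z _ => ?_
      have h1 : HasFDerivAt F (fderiv ℝ F (t, z)) (t, z) :=
        (hF.differentiable (by simp)).differentiableAt.hasFDerivAt
      exact h1.comp z (hasFDerivAt_prodMk_right t z)
  induction n with
  | zero =>
    intro G _ _ _ F hF
    exact contDiff_zero.2 (continuous_iff_continuousAt.2 fun y => (key hF y).continuousAt)
  | succ n ih =>
    intro G _ _ _ F hF
    have h : ContDiff ℝ ((n : WithTop ℕ∞) + 1) (fun y => ∫ t in (0 : ℝ)..1, F (t, y)) := by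
      refine contDiff_succ_iff_hasFDerivAt.2 ⟨fun y => ∫ t in (0 : ℝ)..1,
        (fderiv ℝ F (t, y)).comp (ContinuousLinearMap.inr ℝ ℝ E), ?_, key hF⟩
      refine ih (F := fun z => (fderiv ℝ F z).comp (ContinuousLinearMap.inr ℝ ℝ E)) ?_
      exact (hF.fderiv_right (m := ∞) (by simp)).clm_comp contDiff_const
    exact_mod_cast h

theorem contDiff_parametric_integral {E G : Type} [NormedAddCommGroup E] [NormedSpace ℝ E]
    [FiniteDimensional ℝ E] [NormedAddCommGroup G] [NormedSpace ℝ G] [CompleteSpace G]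
    {F : ℝ × E → G} (hF : ContDiff ℝ ∞ F) :
    ContDiff ℝ ∞ (fun y => ∫ t in (0 : ℝ)..1, F (t, y)) :=
  contDiff_infty.2 fun n => contDiff_nat_parametric_integral n hF

/-- Functions of the lattice spacing and of a point of the torus that are jointly smooth. -/
structure Good {d : ℕ} (L : ℝ) (f : ℝ × (Fin d → ℝ) → ℂ) : Prop where
  smooth : ContDiff ℝ ∞ f
  periodic : ∀ a x ν, f (a, x + Pi.single ν L) = f (a, x)

/-- Translation by one lattice spacing. -/
def shiftFun {d : ℕ} (μ : Fin d) (f : ℝ × (Fin d → ℝ) → ℂ) : ℝ × (Fin d → ℝ) → ℂ :=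
  fun z => f (z.1, z.2 + Pi.single μ z.1)

namespace Good

variable {d : ℕ} {L : ℝ} {f g : ℝ × (Fin d → ℝ) → ℂ}

theorem add (hf : Good L f) (hg : Good L g) : Good L (f + g) :=
  ⟨hf.smooth.add hg.smooth, fun a x ν => by simp [hf.periodic, hg.periodic]⟩

theorem mul (hf : Good L f) (hg : Good L g) : Good L (f * g) :=
  ⟨hf.smooth.mul hg.smooth, fun a x ν => by simp [hf.periodic, hg.periodic]⟩

theorem const (c : ℂ) : Good (d := d) L (fun _ => c) :=
  ⟨contDiff_const, fun _ _ _ => rfl⟩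

theorem sub (hf : Good L f) (hg : Good L g) : Good L (f - g) :=
  ⟨hf.smooth.sub hg.smooth, fun a x ν => by simp [hf.periodic, hg.periodic]⟩

theorem conj (hf : Good L f) : Good L (fun z => star (f z)) :=
  ⟨(Complex.conjCLE.contDiff (n := ∞)).comp hf.smooth, fun a x ν => by simp [hf.periodic]⟩

theorem shift (hf : Good L f) (μ : Fin d) : Good L (shiftFun μ f) := by
  refine ⟨hf.smooth.comp (contDiff_fst.prodMk (contDiff_snd.add ?_)), fun a x ν => ?_⟩
  · exact (ContinuousLinearMap.single ℝ (fun _ : Fin d => ℝ) μ).contDiff.comp contDiff_fst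
  · simp only [shiftFun]
    rw [add_right_comm, hf.periodic]

/-- The restriction to vanishing lattice spacing. -/
theorem atZero (hf : Good L f) : Good L (fun z => f (0, z.2)) :=
  ⟨hf.smooth.comp (contDiff_const.prodMk contDiff_snd), fun _ x ν => hf.periodic 0 x ν⟩

/-- The quotient is `∫₀¹ (∂_a f)(t a, x) dt`, which is smooth across `a = 0`. Powers of the spacing
are extracted in this way with coefficients that remain in the same class. -/
theorem hadamard (hf : Good L f) (h0 : ∀ x, f (0, x) = 0) :
    ∃ g, Good L g ∧ ∀ a x, f (a, x) = (a : ℂ) * g (a, x) := by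
  have hd : ContDiff ℝ ∞ (fun z : ℝ × (Fin d → ℝ) => fderiv ℝ f z (1, 0)) :=
    (hf.smooth.fderiv_right (m := ∞) (by simp)).clm_apply contDiff_const
  have hD : ∀ a x, HasDerivAt (fun a => f (a, x)) (fderiv ℝ f (a, x) (1, 0)) a := by
    intro a x
    have h1 : HasFDerivAt f (fderiv ℝ f (a, x)) (a, x) :=
      (hf.smooth.differentiable (by simp)).differentiableAt.hasFDerivAt
    have h2 : HasDerivAt (fun a : ℝ => (a, x)) ((1 : ℝ), (0 : Fin d → ℝ)) a :=
      (hasDerivAt_id a).prodMk (hasDerivAt_const a x)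
    exact h1.comp_hasDerivAt a h2
  refine ⟨fun z => ∫ t in (0 : ℝ)..1, fderiv ℝ f (t * z.1, z.2) (1, 0), ⟨?_, ?_⟩, ?_⟩
  · refine contDiff_parametric_integral
      (F := fun y : ℝ × (ℝ × (Fin d → ℝ)) => fderiv ℝ f (y.1 * y.2.1, y.2.2) (1, 0)) ?_
    exact hd.comp ((contDiff_fst.mul (contDiff_fst.comp contDiff_snd)).prodMk
      (contDiff_snd.comp contDiff_snd))
  · intro a x ν
    have : ∀ t : ℝ, fderiv ℝ f (t * a, x + Pi.single ν L) (1, 0) = fderiv ℝ f (t * a, x) (1, 0) := by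
      intro t
      refine HasDerivAt.unique (hD _ _) ?_
      simpa [hf.periodic] using hD (t * a) x
    simp [this]
  · intro a x
    have h1 : ∀ t ∈ Set.uIcc (0 : ℝ) 1, HasDerivAt (fun t : ℝ => f (t * a, x))
        ((a : ℂ) * fderiv ℝ f (t * a, x) (1, 0)) t := by
      intro t _
      have := (hD (t * a) x).scomp t ((hasDerivAt_id t).mul_const a)
      simpa [Function.comp_def] using this
    have h2 := intervalIntegral.integral_eq_sub_of_hasDerivAt h1
      (Continuous.intervalIntegrable (continuous_const.mul
        (hd.continuous.comp (by fun_prop : Continuous fun t : ℝ => (t * a, x)))) _ _)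
    rw [intervalIntegral.integral_const_mul] at h2
    simp only [one_mul, zero_mul, h0, sub_zero] at h2
    exact h2.symm

/-- Identifies the value at `a = 0` of a coefficient extracted by `hadamard`. -/
theorem eq_of_hasDerivAt (hf : Good L f) (x : Fin d → ℝ) {h : ℝ → ℂ} {c h' : ℂ}
    (hh : ∀ a, h a = c + (a : ℂ) * f (a, x)) (h1 : HasDerivAt h h' 0) : f (0, x) = h' := by
  have hfd : DifferentiableAt ℝ (fun a : ℝ => f (a, x)) 0 :=
    ((hf.smooth.comp (contDiff_id.prodMk contDiff_const)).differentiable (by simp)).differentiableAt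
  have h2 : HasDerivAt (fun a : ℝ => c + (a : ℂ) * f (a, x)) (f (0, x)) 0 := by
    have h3 := ((hasDerivAt_id (0 : ℝ)).ofReal_comp.mul hfd.hasDerivAt).const_add c
    simpa using h3
  have h4 : h = fun a : ℝ => c + (a : ℂ) * f (a, x) := funext hh
  rw [h4] at h1
  exact h2.unique h1

/-- The forward difference quotient. -/
theorem exists_diff (hf : Good L f) (μ : Fin d) :
    ∃ g, Good L g ∧ (∀ a x, shiftFun μ f (a, x) = f (a, x) + (a : ℂ) * g (a, x)) ∧
      ∀ x, g (0, x) = fderiv ℝ (fun y => f (0, y)) x (Pi.single μ 1) := by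
  obtain ⟨g, hg, h⟩ := ((hf.shift μ).sub hf).hadamard (fun x => by simp [shiftFun])
  -- `k` is the difference quotient of `f (0, ·)`, which tends to the directional derivative. The
  -- dependence of `f` on its first argument is carried by `l`, and contributes only `shiftFun μ l -
  -- l`, which vanishes at `a = 0`.
  obtain ⟨k, hk, hk'⟩ := ((hf.atZero.shift μ).sub hf.atZero).hadamard (fun x => by simp [shiftFun])
  obtain ⟨l, hl, hl'⟩ := (hf.sub hf.atZero).hadamard (fun x => by simp)
  refine ⟨g, hg, fun a x => by rw [← h]; simp, fun x => ?_⟩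
  have e0 : HasFDerivAt (fun y => f (0, y)) (fderiv ℝ (fun y => f (0, y)) x) x :=
    ((hf.smooth.comp (contDiff_const.prodMk contDiff_id)).differentiable
      (by simp)).differentiableAt.hasFDerivAt
  have e1 : HasDerivAt (fun a : ℝ => f (0, x + Pi.single μ a))
      (fderiv ℝ (fun y => f (0, y)) x (Pi.single μ 1)) 0 := by
    have h2 : HasDerivAt (fun a : ℝ => x + Pi.single μ a) (Pi.single μ (1 : ℝ)) 0 := by
      have h3 := (ContinuousLinearMap.single ℝ (fun _ : Fin d => ℝ) μ).hasFDerivAt.comp_hasDerivAt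
        (0 : ℝ) (hasDerivAt_id (0 : ℝ))
      exact h3.const_add x
    have e0' : HasFDerivAt (fun y => f (0, y)) (fderiv ℝ (fun y => f (0, y)) x)
        (x + Pi.single μ (0 : ℝ)) := by simpa using e0
    exact e0'.comp_hasDerivAt 0 h2
  have e2 : k (0, x) = fderiv ℝ (fun y => f (0, y)) x (Pi.single μ 1) :=
    hk.eq_of_hasDerivAt x (h := fun a => f (0, x + Pi.single μ a)) (c := f (0, x))
      (fun a => by rw [← hk']; simp [shiftFun]) e1
  have e3 : ∀ a : ℝ, g (a, x) * a = (k (a, x) + (shiftFun μ l (a, x) - l (a, x))) * a := by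
    intro a
    have i1 := h a x
    have i2 := hk' a x
    have i3 := hl' a x
    have i4 := hl' a (x + Pi.single μ a)
    simp only [Pi.sub_apply, shiftFun] at i1 i2 i3 i4 ⊢
    linear_combination -i1 + i2 + i4 - i3
  -- The factor `a` cancels only off `a = 0`; density and continuity give the value at `0`.
  have e4 : (fun a : ℝ => g (a, x)) = fun a => (k (a, x) + (shiftFun μ l (a, x) - l (a, x))) := by
    have c1 : Continuous fun a : ℝ => g (a, x) := hg.smooth.continuous.comp (by fun_prop)
    have c2 : Continuous fun a : ℝ => (k (a, x) + (shiftFun μ l (a, x) - l (a, x))) :=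
      ((hk.add ((hl.shift μ).sub hl)).smooth.continuous).comp
        (by fun_prop : Continuous fun a : ℝ => (a, x))
    refine Continuous.ext_on (dense_compl_singleton (0 : ℝ)) c1 c2 fun a ha => ?_
    have ha' : (a : ℂ) ≠ 0 := by exact_mod_cast ha
    exact mul_right_cancel₀ ha' (e3 a)
  have e5 := congrFun e4 0
  simp only [shiftFun, Pi.single_zero, add_zero, sub_self] at e5
  rw [e5, e2]

theorem bounded (hf : Good L f) :
    ∃ C, 0 ≤ C ∧ ∀ a ∈ Set.Icc 0 L, ∀ x : Fin d → ℝ, (∀ i, x i ∈ Set.Icc 0 L) → ‖f (a, x)‖ ≤ C := by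
  have hK : IsCompact (Set.Icc (0 : ℝ) L ×ˢ Set.pi Set.univ fun _ : Fin d => Set.Icc (0 : ℝ) L) :=
    isCompact_Icc.prod (isCompact_univ_pi fun _ => isCompact_Icc)
  obtain ⟨B, hB⟩ := hK.exists_bound_of_continuousOn hf.smooth.continuous.continuousOn
  exact ⟨|B|, abs_nonneg _, fun a ha x hx =>
    (hB (a, x) ⟨ha, fun i _ => hx i⟩).trans (le_abs_self B)⟩

end Good

/-- A smooth periodic function, seen as independent of the lattice spacing. -/
theorem good_ofReal {d : ℕ} {L : ℝ} {φ : (Fin d → ℝ) → ℝ} (h : ContDiff ℝ ∞ φ)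
    (hp : IsPeriodic L φ) : Good L (fun z => (φ z.2 : ℂ)) :=
  ⟨(Complex.ofRealCLM.contDiff (n := ∞)).comp (h.comp contDiff_snd), fun _ x ν => by simp [hp x ν]⟩

theorem isPeriodic_fieldStrength {d : ℕ} {L : ℝ} {A : Fin d → (Fin d → ℝ) → ℝ}
    (hp : ∀ μ, IsPeriodic L (A μ)) (μ ν : Fin d) : IsPeriodic L (fieldStrength A μ ν) := by
  intro x κ
  have : ∀ ρ, fderiv ℝ (A ρ) (x + Pi.single κ L) = fderiv ℝ (A ρ) x := by
    intro ρ
    rw [← fderiv_comp_add_right]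
    congr 1
    funext y
    exact hp ρ y κ
  simp [fieldStrength, this]

theorem contDiff_fieldStrength {d : ℕ} {A : Fin d → (Fin d → ℝ) → ℝ}
    (h : ∀ μ, ContDiff ℝ ∞ (A μ)) (μ ν : Fin d) : ContDiff ℝ ∞ (fieldStrength A μ ν) :=
  (((h ν).fderiv_right (m := ∞) (by simp)).clm_apply contDiff_const).sub
    (((h μ).fderiv_right (m := ∞) (by simp)).clm_apply contDiff_const)

/-- The link variables, as a function of the lattice spacing and of the position. -/
def linkFun {d : ℕ} (Q : ℝ) (A : Fin d → (Fin d → ℝ) → ℝ) (μ : Fin d) :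
    ℝ × (Fin d → ℝ) → ℂ := fun z => link Q A z.1 μ z.2

/-- The substitution `s = a t` turns the integral in the exponent into `a` times a smooth function
`J` with `J (0, x) = A μ x`. -/
theorem exists_link_expansion {d : ℕ} {L : ℝ} (Q : ℝ) {A : Fin d → (Fin d → ℝ) → ℝ}
    (hA : ∀ μ, ContDiff ℝ ∞ (A μ)) (hp : ∀ μ, IsPeriodic L (A μ)) (μ : Fin d) :
    ∃ u, Good L u ∧ (∀ a x, linkFun Q A μ (a, x) = 1 + (a : ℂ) * u (a, x)) ∧
      ∀ x, u (0, x) = -(Complex.I * Q) * A μ x := by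
  set J : ℝ × (Fin d → ℝ) → ℝ := fun z => ∫ t in (0 : ℝ)..1, A μ (z.2 + Pi.single μ (z.1 * t))
    with hJ
  have hJs : ContDiff ℝ ∞ J := by
    refine contDiff_parametric_integral
      (F := fun y : ℝ × (ℝ × (Fin d → ℝ)) => A μ (y.2.2 + Pi.single μ (y.2.1 * y.1))) ?_
    refine (hA μ).comp ((contDiff_snd.comp contDiff_snd).add ?_)
    exact (ContinuousLinearMap.single ℝ (fun _ : Fin d => ℝ) μ).contDiff.comp
      ((contDiff_fst.comp contDiff_snd).mul contDiff_fst)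
  have hlink : ∀ a x, linkFun Q A μ (a, x) =
      Complex.exp (-(Complex.I * Q) * ((a * J (a, x) : ℝ) : ℂ)) := by
    intro a x
    have h1 : ∫ s in (0 : ℝ)..a, A μ (x + Pi.single μ s) = a * J (a, x) := by
      have := intervalIntegral.smul_integral_comp_mul_left (a := 0) (b := 1)
        (fun s => A μ (x + Pi.single μ s)) a
      simpa using this.symm
    simp only [linkFun, link, h1]
    congr 1
    ring
  have hJp : ∀ a x ν, J (a, x + Pi.single ν L) = J (a, x) := by
    intro a x ν
    simp only [hJ]
    congr 1
    funext t
    rw [add_right_comm, hp μ]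
  have hgood : Good L (fun z => linkFun Q A μ z - 1) := by
    refine ⟨?_, fun a x ν => by simp only [hlink, hJp]⟩
    have h2 : linkFun Q A μ =
        fun z => Complex.exp (-(Complex.I * Q) * ((z.1 * J z : ℝ) : ℂ)) := by
      funext z
      exact hlink z.1 z.2
    rw [h2]
    refine ContDiff.sub (ContDiff.cexp (contDiff_const.mul ?_)) contDiff_const
    exact (Complex.ofRealCLM.contDiff (n := ∞)).comp (contDiff_fst.mul hJs)
  obtain ⟨u, hu, hu'⟩ := hgood.hadamard (fun x => by simp [hlink])
  refine ⟨u, hu, fun a x => by rw [← hu']; ring, fun x => ?_⟩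
  refine hu.eq_of_hasDerivAt x (h := fun a => linkFun Q A μ (a, x)) (c := 1)
    (fun a => by rw [← hu']; ring) ?_
  have hJd : HasDerivAt (fun a => J (a, x)) (deriv (fun a => J (a, x)) 0) 0 :=
    ((hJs.comp (contDiff_id.prodMk contDiff_const)).differentiable
      (by simp)).differentiableAt.hasDerivAt
  have hJ0 : J (0, x) = A μ x := by simp [hJ]
  have h3 := ((hasDerivAt_id (0 : ℝ)).mul hJd).ofReal_comp.const_mul (-(Complex.I * Q))
  have h4 := h3.cexp
  simp only [hlink]
  simpa [hJ0] using h4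

end WilsonFermion

namespace WilsonFermion

/-! ### Sizes of lattice momenta and their sums. -/

section bracket

variable {d N : ℕ}

/-- The size `∏ i, (1 + |k i|)` of a lattice momentum, where `|·|` is the distance to `0`
on the circle `ZMod N`. -/
def bracket (k : Site d N) : ℝ := ∏ i, (1 + ((k i).valMinAbs.natAbs : ℝ))

theorem one_le_bracket (k : Site d N) : 1 ≤ bracket k :=
  Finset.prod_induction _ (fun x : ℝ => 1 ≤ x) (fun _ _ ha hb => one_le_mul_of_one_le_of_one_le ha hb)
    le_rfl (fun i _ => by simp)

theorem bracket_pos (k : Site d N) : 0 < bracket k := zero_lt_one.trans_le (one_le_bracket k)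

theorem bracket_neg (k : Site d N) : bracket (-k) = bracket k := by
  simp [bracket, ZMod.natAbs_valMinAbs_neg]

theorem bracket_sub_comm (k l : Site d N) : bracket (k - l) = bracket (l - k) := by
  rw [← bracket_neg, neg_sub]

theorem bracket_add_le (k l : Site d N) : bracket (k + l) ≤ bracket k * bracket l := by
  rw [bracket, bracket, bracket, ← Finset.prod_mul_distrib]
  refine Finset.prod_le_prod (fun i _ => by positivity) fun i _ => ?_
  have h1 : ((k + l) i).valMinAbs.natAbs ≤ (k i).valMinAbs.natAbs + (l i).valMinAbs.natAbs :=
    (ZMod.natAbs_valMinAbs_add_le _ _).trans (Int.natAbs_add_le _ _)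
  have h2 : (((k + l) i).valMinAbs.natAbs : ℝ) ≤
      (k i).valMinAbs.natAbs + (l i).valMinAbs.natAbs := by exact_mod_cast h1
  nlinarith [mul_nonneg (Nat.cast_nonneg (α := ℝ) (k i).valMinAbs.natAbs)
    (Nat.cast_nonneg (α := ℝ) (l i).valMinAbs.natAbs)]

theorem bracket_sub_le (p q r : Site d N) :
    bracket (p - q) ≤ bracket (p - r) * bracket (r - q) := by
  have := bracket_add_le (p - r) (r - q)
  rwa [sub_add_sub_cancel] at this

theorem natAbs_le_bracket (k : Site d N) (i : Fin d) :
    1 + ((k i).valMinAbs.natAbs : ℝ) ≤ bracket k := by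
  have h : bracket k = (1 + ((k i).valMinAbs.natAbs : ℝ)) *
      ∏ j ∈ Finset.univ.erase i, (1 + ((k j).valMinAbs.natAbs : ℝ)) := by
    exact (Finset.mul_prod_erase _ (fun j => 1 + ((k j).valMinAbs.natAbs : ℝ))
      (Finset.mem_univ i)).symm
  rw [h]
  refine le_mul_of_one_le_right (by positivity) ?_
  exact Finset.prod_induction _ (fun x : ℝ => 1 ≤ x)
    (fun _ _ ha hb => one_le_mul_of_one_le_of_one_le ha hb) le_rfl (fun i _ => by simp)

/-- With `N = n + 1`, `|x|` is the smaller of `x.val` and `N - x.val`, so `g |x|` is at most `g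
x.val + g (n - x.val)`, and both arguments run over `range (n + 1)`. Replacing `N` by `n` in the
second argument uses that `g` decreases. -/
theorem sum_zmod_le (n : ℕ) {g : ℕ → ℝ} (h0 : ∀ i, 0 ≤ g i) (hg : Antitone g) :
    ∑ x : ZMod (n + 1), g x.valMinAbs.natAbs ≤ 2 * ∑ i ∈ Finset.range (n + 1), g i := by
  have h1 : ∀ x : ZMod (n + 1), g x.valMinAbs.natAbs ≤ g x.val + g (n + 1 - 1 - x.val) := by
    intro x
    rw [ZMod.valMinAbs_natAbs_eq_min]
    rcases min_cases x.val (n + 1 - x.val) with h | h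
    · rw [h.1]
      linarith [h0 (n + 1 - 1 - x.val)]
    · rw [h.1]
      have : g (n + 1 - x.val) ≤ g (n + 1 - 1 - x.val) := hg (by omega)
      linarith [h0 x.val]
  refine (Finset.sum_le_sum fun x _ => h1 x).trans ?_
  rw [Finset.sum_add_distrib]
  have h2 : ∀ f : ℕ → ℝ, ∑ x : ZMod (n + 1), f x.val = ∑ i ∈ Finset.range (n + 1), f i :=
    fun f => Fin.sum_univ_eq_sum_range f (n + 1)
  rw [h2 g, h2 (fun i => g (n + 1 - 1 - i)), Finset.sum_range_reflect g (n + 1), two_mul]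

theorem sum_bracket_eq (n : ℕ) (g : ℝ → ℝ) (hg : ∀ s : Finset (Fin d), ∀ f : Fin d → ℝ,
    g (∏ i ∈ s, f i) = ∏ i ∈ s, g (f i)) :
    ∑ k : Site d (n + 1), g (bracket k) =
      (∑ x : ZMod (n + 1), g (1 + (x.valMinAbs.natAbs : ℝ))) ^ d := by
  simp only [bracket, hg]
  have := Finset.sum_prod_piFinset (ι := Fin d) (Finset.univ : Finset (ZMod (n + 1)))
    (fun _ x => g (1 + (x.valMinAbs.natAbs : ℝ)))
  rw [Fintype.piFinset_univ] at this
  rw [this, Finset.prod_const, Finset.card_univ, Fintype.card_fin]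

/-- Two powers of `bracket` pay for one sum over intermediate momenta, uniformly in the lattice
size. -/
theorem exists_sum_bracket_le (d : ℕ) :
    ∃ C, 0 ≤ C ∧ ∀ n, ∑ k : Site d (n + 1), (bracket k ^ 2)⁻¹ ≤ C := by
  have hs : Summable fun i : ℕ => ((1 + (i : ℝ)) ^ 2)⁻¹ := by
    have := (summable_nat_add_iff 1).2 (Real.summable_nat_pow_inv (p := 2).2 (by norm_num))
    refine this.congr fun i => ?_
    push_cast
    rw [add_comm]
  refine ⟨(2 * ∑' i : ℕ, ((1 + (i : ℝ)) ^ 2)⁻¹) ^ d, by positivity, fun n => ?_⟩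
  rw [sum_bracket_eq n (fun x => (x ^ 2)⁻¹) (fun s f => by simp [Finset.prod_pow])]
  refine pow_le_pow_left₀ (by positivity) ?_ d
  refine (sum_zmod_le n (g := fun i : ℕ => ((1 + (i : ℝ)) ^ 2)⁻¹)
    (fun i => by positivity) ?_).trans ?_
  · intro i j hij
    have : (i : ℝ) ≤ j := by exact_mod_cast hij
    dsimp only
    gcongr
  · gcongr
    exact hs.sum_le_tsum _ fun i _ => by positivity

/-- One power of `bracket` costs logarithms, by the harmonic sum in each direction. In the final
trace they are beaten by a factor `a`. -/
theorem sum_bracket_inv_le (d n : ℕ) :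
    ∑ k : Site d (n + 1), (bracket k)⁻¹ ≤ (2 * (1 + Real.log (n + 1))) ^ d := by
  rw [sum_bracket_eq n (fun x => x⁻¹) (fun s f => by simp)]
  refine pow_le_pow_left₀ (by positivity) ?_ d
  refine (sum_zmod_le n (g := fun i : ℕ => (1 + (i : ℝ))⁻¹) (fun i => by positivity) ?_).trans ?_
  · intro i j hij
    have : (i : ℝ) ≤ j := by exact_mod_cast hij
    dsimp only
    gcongr
  · have := harmonic_le_one_add_log (n + 1)
    simp only [harmonic] at this
    push_cast at this
    simp only [add_comm (1 : ℝ)] at this ⊢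
    linarith

end bracket

/-! ### Anti-periodic plane waves and momentum space. -/

section fourier

variable {d N : ℕ} [NeZero N]

theorem norm_stdAddChar_sub_one (k : ZMod N) :
    ‖(ZMod.stdAddChar k : ℂ) - 1‖ = 2 * |Real.sin (Real.pi * (k.valMinAbs.natAbs : ℝ) / N)| := by
  have h1 : (ZMod.stdAddChar k : ℂ) =
      Complex.exp (Complex.I * ((2 * Real.pi * k.valMinAbs / N : ℝ) : ℂ)) := by
    conv_lhs => rw [← ZMod.coe_valMinAbs k]
    rw [ZMod.stdAddChar_coe]
    congr 1
    push_cast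
    ring
  rw [h1, Complex.norm_exp_I_mul_ofReal_sub_one, norm_mul, Real.norm_eq_abs, Real.norm_eq_abs,
    abs_two]
  congr 1
  rcases Int.natAbs_eq k.valMinAbs with h | h
  · rw [h]
    simp only [Int.natAbs_natCast, Int.cast_natCast]
    congr 2
    ring
  · rw [h]
    simp only [Int.natAbs_neg, Int.natAbs_natCast, Int.cast_neg, Int.cast_natCast]
    rw [← abs_neg, ← Real.sin_neg]
    congr 2
    ring

theorem norm_stdAddChar_sub_one_le (k : ZMod N) :
    ‖(ZMod.stdAddChar k : ℂ) - 1‖ ≤ 2 * Real.pi / N * (k.valMinAbs.natAbs : ℝ) := by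
  rw [norm_stdAddChar_sub_one]
  have h0 : 0 ≤ Real.pi * (k.valMinAbs.natAbs : ℝ) / N := by positivity
  have h1 := Real.abs_sin_le_abs (x := Real.pi * (k.valMinAbs.natAbs : ℝ) / N)
  rw [abs_of_nonneg h0] at h1
  calc _ ≤ 2 * (Real.pi * (k.valMinAbs.natAbs : ℝ) / N) := by gcongr
    _ = _ := by ring

/-- Jordan's inequality `sin t ≥ 2 t / π` on `[0, π / 2]`, applicable because `|k| ≤ N / 2`. -/
theorem le_norm_stdAddChar_sub_one (k : ZMod N) :
    4 / N * (k.valMinAbs.natAbs : ℝ) ≤ ‖(ZMod.stdAddChar k : ℂ) - 1‖ := by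
  rw [norm_stdAddChar_sub_one]
  have hN : (0 : ℝ) < N := by exact_mod_cast Nat.pos_of_ne_zero (NeZero.ne N)
  have h0 : 0 ≤ Real.pi * (k.valMinAbs.natAbs : ℝ) / N := by positivity
  have hk : ((k.valMinAbs.natAbs : ℕ) : ℝ) * 2 ≤ N := by
    have := ZMod.natAbs_valMinAbs_le k
    exact_mod_cast (by omega : k.valMinAbs.natAbs * 2 ≤ N)
  have h1 : Real.pi * (k.valMinAbs.natAbs : ℝ) / N ≤ Real.pi / 2 := by
    rw [div_le_div_iff₀ hN two_pos]
    nlinarith [Real.pi_pos]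
  have h2 := Real.mul_le_sin h0 h1
  calc 4 / N * (k.valMinAbs.natAbs : ℝ)
      = 2 * (2 / Real.pi * (Real.pi * (k.valMinAbs.natAbs : ℝ) / N)) := by
        field_simp
        ring
    _ ≤ _ := by
        gcongr
        exact h2.trans (le_abs_self _)

/-- The eigenvalue of a free translation at the anti-periodic momentum `k`. -/
def phase (k : ZMod N) : ℂ := Complex.exp (Complex.I * (Real.pi / N : ℝ)) * ZMod.stdAddChar k

theorem norm_phase (k : ZMod N) : ‖phase k‖ = 1 := by
  rw [phase, norm_mul, AddChar.norm_apply, mul_comm Complex.I, Complex.norm_exp_ofReal_mul_I,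
    one_mul]

theorem norm_phase_sub (k l : ZMod N) : ‖phase k - phase l‖ = ‖(ZMod.stdAddChar (k - l) : ℂ) - 1‖ := by
  have h : phase k - phase l = phase l * (ZMod.stdAddChar (k - l) - 1) := by
    have h1 : (ZMod.stdAddChar k : ℂ) = ZMod.stdAddChar l * ZMod.stdAddChar (k - l) := by
      rw [← AddChar.map_add_eq_mul, add_sub_cancel]
    rw [phase, phase, h1]
    ring
  rw [h, norm_mul, norm_phase, one_mul]

/-- Anti-periodicity shifts the momenta by half a unit, which costs at most `π / N`. -/
theorem le_norm_phase_sub_one (k : ZMod N) :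
    4 / N * (k.valMinAbs.natAbs : ℝ) - Real.pi / N ≤ ‖phase k - 1‖ := by
  have h1 : ‖phase (0 : ZMod N) - 1‖ ≤ Real.pi / N := by
    rw [phase, AddChar.map_zero_eq_one, mul_one, Complex.norm_exp_I_mul_ofReal_sub_one, norm_mul,
      Real.norm_eq_abs, Real.norm_eq_abs, abs_two]
    have h0 : 0 ≤ Real.pi / N / 2 := by positivity
    have := Real.abs_sin_le_abs (x := Real.pi / N / 2)
    rw [abs_of_nonneg h0] at this
    linarith
  have h2 := le_norm_stdAddChar_sub_one k
  have h3 := norm_phase_sub k 0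
  rw [sub_zero] at h3
  have h4 : ‖phase k - phase (0 : ZMod N)‖ ≤ ‖phase k - 1‖ + ‖phase (0 : ZMod N) - 1‖ := by
    have := norm_sub_le (phase k - 1) (phase (0 : ZMod N) - 1)
    simpa using this
  linarith

/-- The anti-periodic plane waves in one direction. -/
def wave (x k : ZMod N) : ℂ :=
  ((Real.sqrt N)⁻¹ : ℝ) * Complex.exp ((x.val : ℂ) * (Complex.I * (Real.pi / N : ℝ))) *
    ZMod.stdAddChar (x * k)

theorem norm_wave_mul (x k l : ZMod N) : ‖wave x k‖ * ‖wave x l‖ = (N : ℝ)⁻¹ := by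
  have h : ∀ k, ‖wave x k‖ = (Real.sqrt N)⁻¹ := by
    intro k
    have e : (x.val : ℂ) * (Complex.I * (Real.pi / N : ℝ)) =
        ((x.val * (Real.pi / N) : ℝ) : ℂ) * Complex.I := by
      push_cast
      ring
    rw [wave, norm_mul, norm_mul, AddChar.norm_apply, e, Complex.norm_exp_ofReal_mul_I,
      Complex.norm_real, Real.norm_of_nonneg (by positivity)]
    ring
  rw [h, h, ← mul_inv, Real.mul_self_sqrt (Nat.cast_nonneg _)]

theorem sum_wave (k l : ZMod N) :
    ∑ x, star (wave x k) * wave x l = if k = l then 1 else 0 := by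
  have hN : (N : ℂ) ≠ 0 := by exact_mod_cast NeZero.ne N
  have h1 : ∀ x : ZMod N, star (wave x k) * wave x l =
      (N : ℂ)⁻¹ * ZMod.stdAddChar (x * (l - k)) := by
    intro x
    have e1 : star (Complex.exp ((x.val : ℂ) * (Complex.I * (Real.pi / N : ℝ)))) *
        Complex.exp ((x.val : ℂ) * (Complex.I * (Real.pi / N : ℝ))) = 1 := by
      have e : (x.val : ℂ) * (Complex.I * (Real.pi / N : ℝ)) =
          ((x.val * (Real.pi / N) : ℝ) : ℂ) * Complex.I := by
        push_cast
        ring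
      rw [e, Complex.star_def, ← Complex.exp_conj, ← Complex.exp_add, map_mul, Complex.conj_ofReal,
        Complex.conj_I, mul_neg, neg_add_cancel, Complex.exp_zero]
    have e2 : star (ZMod.stdAddChar (x * k) : ℂ) * ZMod.stdAddChar (x * l) =
        ZMod.stdAddChar (x * (l - k)) := by
      have : star (ZMod.stdAddChar (x * k) : ℂ) = ZMod.stdAddChar (-(x * k)) := by
        rw [ZMod.stdAddChar_apply, ZMod.stdAddChar_apply, AddChar.map_neg_eq_inv, Circle.coe_inv_eq_conj]
        rfl
      rw [this, ← AddChar.map_add_eq_mul]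
      congr 1
      ring
    have e3 : (((Real.sqrt N)⁻¹ : ℝ) : ℂ) * (((Real.sqrt N)⁻¹ : ℝ) : ℂ) = (N : ℂ)⁻¹ := by
      rw [← Complex.ofReal_mul, ← mul_inv, Real.mul_self_sqrt (Nat.cast_nonneg _)]
      simp
    have e4 : star (((Real.sqrt N)⁻¹ : ℝ) : ℂ) = (((Real.sqrt N)⁻¹ : ℝ) : ℂ) :=
      Complex.conj_ofReal _
    rw [wave, wave, star_mul, star_mul, e4, ← e2, ← e3]
    linear_combination (((Real.sqrt N)⁻¹ : ℝ) : ℂ) * (((Real.sqrt N)⁻¹ : ℝ) : ℂ) *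
      (star (ZMod.stdAddChar (x * k) : ℂ) * ZMod.stdAddChar (x * l)) * e1
  rw [Finset.sum_congr rfl fun x _ => h1 x, ← Finset.mul_sum,
    AddChar.sum_mulShift _ (ZMod.isPrimitive_stdAddChar N)]
  by_cases h : k = l
  · simp [h, ZMod.card, hN]
  · simp [h, sub_eq_zero, Ne.symm h]

/-- The half-integral momentum makes the wave pick up `exp (i π) = -1` around the circle. This
cancels the sign attached to `x = -1`, the last site. -/
theorem wave_add_one (x k : ZMod N) :
    (if x = -1 then -1 else 1) * wave (x + 1) k = phase k * wave x k := by
  have hc : (ZMod.stdAddChar ((x + 1) * k) : ℂ) = ZMod.stdAddChar k * ZMod.stdAddChar (x * k) := by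
    rw [← AddChar.map_add_eq_mul]
    congr 1
    ring
  have hN : (N : ℂ) ≠ 0 := by exact_mod_cast NeZero.ne N
  have key : (if x = -1 then -1 else 1) *
      Complex.exp (((x + 1).val : ℂ) * (Complex.I * (Real.pi / N : ℝ))) =
      Complex.exp (Complex.I * (Real.pi / N : ℝ)) *
        Complex.exp ((x.val : ℂ) * (Complex.I * (Real.pi / N : ℝ))) := by
    rw [← Complex.exp_add]
    by_cases h : x = -1
    · subst h
      obtain ⟨n, rfl⟩ : ∃ n, N = n + 1 := ⟨N - 1, by have := NeZero.ne N; omega⟩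
      have e : Complex.I * (Real.pi / (n + 1 : ℕ) : ℝ) + (((-1 : ZMod (n + 1)).val : ℕ) : ℂ) *
          (Complex.I * (Real.pi / (n + 1 : ℕ) : ℝ)) = Real.pi * Complex.I := by
        rw [ZMod.val_neg_one]
        have : (n : ℂ) + 1 ≠ 0 := by exact_mod_cast hN
        push_cast
        field_simp
        ring
      rw [e, Complex.exp_pi_mul_I]
      simp
    · have hlt : x.val + 1 < N := by
        refine lt_of_le_of_ne (ZMod.val_lt x) fun h' => h ?_
        have h2 : ((x.val + 1 : ℕ) : ZMod N) = 0 := by rw [h']; simp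
        push_cast at h2
        rw [ZMod.natCast_zmod_val] at h2
        exact eq_neg_of_add_eq_zero_left h2
      have hv : (x + 1).val = x.val + 1 := by
        have h3 : ((x.val + 1 : ℕ) : ZMod N) = x + 1 := by simp
        rw [← h3, ZMod.val_natCast, Nat.mod_eq_of_lt hlt]
      rw [if_neg h, one_mul, hv]
      congr 1
      push_cast
      ring
  rw [wave, wave, phase, hc]
  linear_combination (((Real.sqrt N)⁻¹ : ℝ) : ℂ) * ZMod.stdAddChar k *
    ZMod.stdAddChar (x * k) * key

/-- The unitary matrix of the anti-periodic plane waves. -/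
def fourier (d N : ℕ) [NeZero N] : Op d N := Matrix.of fun x k => ∏ i, wave (x i) (k i)

theorem fourier_conjTranspose_mul : (fourier d N)ᴴ * fourier d N = 1 := by
  ext k l
  simp only [Matrix.mul_apply, Matrix.conjTranspose_apply, fourier, Matrix.of_apply, star_prod,
    ← Finset.prod_mul_distrib]
  have := Finset.sum_prod_piFinset (ι := Fin d) (Finset.univ : Finset (ZMod N))
    (fun i x => star (wave x (k i)) * wave x (l i))
  rw [Fintype.piFinset_univ] at this
  rw [this]
  simp only [sum_wave]
  rw [Matrix.one_apply, Fintype.prod_ite_zero]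
  simp [funext_iff]

theorem fourier_mul_conjTranspose : fourier d N * (fourier d N)ᴴ = 1 :=
  mul_eq_one_comm.1 fourier_conjTranspose_mul

/-- The matrix of an operator in momentum space. -/
def hat (K : Op d N) : Op d N := (fourier d N)ᴴ * K * fourier d N

theorem hat_mul (K K' : Op d N) : hat (K * K') = hat K * hat K' := by
  have : hat K * hat K' = (fourier d N)ᴴ * K * (fourier d N * (fourier d N)ᴴ) * K' *
      fourier d N := by
    simp only [hat, Matrix.mul_assoc]
  rw [this, fourier_mul_conjTranspose, Matrix.mul_one, hat, Matrix.mul_assoc _ K K']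

theorem hat_one : hat (1 : Op d N) = 1 := by
  rw [hat, Matrix.mul_one, fourier_conjTranspose_mul]

theorem hat_add (K K' : Op d N) : hat (K + K') = hat K + hat K' := by
  simp [hat, Matrix.mul_add, Matrix.add_mul]

theorem hat_sub (K K' : Op d N) : hat (K - K') = hat K - hat K' := by
  simp [hat, Matrix.mul_sub, Matrix.sub_mul]

theorem hat_smul (c : ℂ) (K : Op d N) : hat (c • K) = c • hat K := by
  simp [hat]

theorem hat_conjTranspose (K : Op d N) : hat Kᴴ = (hat K)ᴴ := by
  simp [hat, Matrix.mul_assoc]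

theorem hat_injective : Function.Injective (hat : Op d N → Op d N) := by
  intro K K' h
  have e : ∀ K : Op d N, fourier d N * hat K * (fourier d N)ᴴ = K := by
    intro K
    have : fourier d N * hat K * (fourier d N)ᴴ =
        (fourier d N * (fourier d N)ᴴ) * K * (fourier d N * (fourier d N)ᴴ) := by
      simp only [hat, Matrix.mul_assoc]
    rw [this, fourier_mul_conjTranspose, Matrix.one_mul, Matrix.mul_one]
  rw [← e K, h, e]

theorem hat_inv (K : Op d N) : hat K⁻¹ = (hat K)⁻¹ := by
  have h1 : (fourier d N)⁻¹ = (fourier d N)ᴴ := Matrix.inv_eq_left_inv fourier_conjTranspose_mul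
  have h2 : ((fourier d N)ᴴ)⁻¹ = fourier d N := Matrix.inv_eq_left_inv fourier_mul_conjTranspose
  rw [hat, hat, Matrix.mul_inv_rev, Matrix.mul_inv_rev, h1, h2, Matrix.mul_assoc]

theorem trace_hat (K : Op d N) : (hat K).trace = K.trace := by
  rw [hat, Matrix.trace_mul_comm, ← Matrix.mul_assoc, fourier_mul_conjTranspose, Matrix.one_mul]

theorem hat_freeShift (μ : Fin d) :
    hat (freeShift μ : Op d N) = Matrix.diagonal fun k => phase (k μ) := by
  have h : freeShift μ * fourier d N = fourier d N * Matrix.diagonal fun k => phase (k μ) := by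
    ext x k
    obtain ⟨y, hy⟩ : ∃ y : Site d N, y = x + Pi.single μ 1 := ⟨_, rfl⟩
    have h1 : y μ = x μ + 1 := by rw [hy, Pi.add_apply, Pi.single_eq_same]
    have h2 : ∏ i ∈ Finset.univ.erase μ, wave (y i) (k i) =
        ∏ i ∈ Finset.univ.erase μ, wave (x i) (k i) := by
      refine Finset.prod_congr rfl fun i hi => ?_
      rw [hy, Pi.add_apply, Pi.single_eq_of_ne (Finset.ne_of_mem_erase hi), add_zero]
    rw [Matrix.mul_diagonal, Matrix.mul_apply, Finset.sum_eq_single y]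
    · simp only [freeShift, Matrix.of_apply, ← hy, if_true, fourier]
      rw [← Finset.mul_prod_erase _ (fun i => wave (y i) (k i)) (Finset.mem_univ μ),
        ← Finset.mul_prod_erase _ (fun i => wave (x i) (k i)) (Finset.mem_univ μ),
        ← mul_assoc, h1, wave_add_one, h2]
      ring
    · intro z _ hz
      rw [hy] at hz
      simp [freeShift, hz]
    · simp
  rw [hat, Matrix.mul_assoc, h, ← Matrix.mul_assoc, fourier_conjTranspose_mul, Matrix.one_mul]

/-- A product of two plane waves has modulus `N ^ (-d)` at each of the `N ^ d` sites. -/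
theorem norm_hat_mulOp_le {L : ℝ} {φ : (Fin d → ℝ) → ℂ} {C : ℝ}
    (h : ∀ x : Site d N, ‖φ (position L x)‖ ≤ C) (k l : Site d N) :
    ‖hat (mulOp L φ : Op d N) k l‖ ≤ C := by
  have hN : (N : ℝ) ≠ 0 := by exact_mod_cast NeZero.ne N
  rw [hat, mulOp, Matrix.mul_apply]
  refine (norm_sum_le _ _).trans ?_
  have h1 : ∀ x : Site d N, ‖((fourier d N)ᴴ * Matrix.diagonal fun x => φ (position L x) : Op d N) k x *
      fourier d N x l‖ ≤ ((N : ℝ) ^ d)⁻¹ * C := by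
    intro x
    have h2 : ‖fourier d N x k‖ * ‖fourier d N x l‖ = ((N : ℝ) ^ d)⁻¹ := by
      simp only [fourier, Matrix.of_apply, norm_prod, ← Finset.prod_mul_distrib, norm_wave_mul]
      simp
    rw [Matrix.mul_diagonal, Matrix.conjTranspose_apply, norm_mul, norm_mul, norm_star, mul_right_comm,
      h2]
    exact mul_le_mul_of_nonneg_left (h x) (by positivity)
  refine (Finset.sum_le_sum fun x _ => h1 x).trans ?_
  rw [Finset.sum_const, Finset.card_univ, Fintype.card_pi]
  simp only [ZMod.card, Finset.prod_const, Finset.card_univ, Fintype.card_fin, nsmul_eq_mul]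
  push_cast
  rw [← mul_assoc, mul_inv_cancel₀ (pow_ne_zero _ hN), one_mul]

end fourier

end WilsonFermion

/-! ### Weights and orders of families of operators. -/

namespace WilsonFermion

/-- A family of operators, one for each lattice with `N = n + 1` points in each direction. -/
abbrev Fam (d : ℕ) : Type := ∀ n : ℕ, Op d (n + 1)

/-- A family of weights on momentum space. -/
abbrev Weight (d : ℕ) : Type := ∀ n : ℕ, Site d (n + 1) → ℝ

variable {d : ℕ} {L : ℝ} {w w₁ w₂ w₃ v : Weight d} {K K₁ K₂ : Fam d}

/-- Positive weights of moderate growth, uniformly in the lattice. -/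
structure Tempered (w : Weight d) : Prop where
  pos : ∀ n p, 0 < w n p
  bound : ∃ (C : ℝ) (j : ℕ), 0 ≤ C ∧ ∀ n p q, w n q ≤ C * bracket (p - q) ^ j * w n p

namespace Tempered

theorem one : Tempered (1 : Weight d) :=
  ⟨fun _ _ => one_pos, 1, 0, zero_le_one, fun _ _ _ => by simp⟩

theorem mul (h₁ : Tempered w₁) (h₂ : Tempered w₂) : Tempered (w₁ * w₂) := by
  obtain ⟨C₁, j₁, hC₁, b₁⟩ := h₁.bound
  obtain ⟨C₂, j₂, hC₂, b₂⟩ := h₂.bound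
  refine ⟨fun n p => mul_pos (h₁.pos n p) (h₂.pos n p), C₁ * C₂, j₁ + j₂, by positivity,
    fun n p q => ?_⟩
  calc w₁ n q * w₂ n q ≤ (C₁ * bracket (p - q) ^ j₁ * w₁ n p) *
        (C₂ * bracket (p - q) ^ j₂ * w₂ n p) :=
        mul_le_mul (b₁ n p q) (b₂ n p q) (h₂.pos n q).le ((h₁.pos n q).le.trans (b₁ n p q))
    _ = _ := by
        simp only [Pi.mul_apply, pow_add]
        ring

theorem inv (h : Tempered w) : Tempered w⁻¹ := by
  obtain ⟨C, j, hC, b⟩ := h.bound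
  refine ⟨fun n p => inv_pos.2 (h.pos n p), C, j, hC, fun n p q => ?_⟩
  have h1 := b n q p
  rw [bracket_sub_comm] at h1
  have hp := h.pos n p
  have hq := h.pos n q
  simp only [Pi.inv_apply]
  rw [← div_eq_mul_inv, le_div_iff₀ hp, inv_mul_le_iff₀ hq]
  linarith

theorem div (h₁ : Tempered w₁) (h₂ : Tempered w₂) : Tempered (w₁ / w₂) := by
  rw [div_eq_mul_inv]
  exact h₁.mul h₂.inv

theorem pow (h : Tempered w) (k : ℕ) : Tempered (w ^ k) := by
  induction k with
  | zero => rw [pow_zero]; exact one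
  | succ k ih => rw [pow_succ]; exact ih.mul h

theorem add (h₁ : Tempered w₁) (h₂ : Tempered w₂) : Tempered (w₁ + w₂) := by
  obtain ⟨C₁, j₁, hC₁, b₁⟩ := h₁.bound
  obtain ⟨C₂, j₂, hC₂, b₂⟩ := h₂.bound
  refine ⟨fun n p => add_pos (h₁.pos n p) (h₂.pos n p), C₁ + C₂, max j₁ j₂, by positivity,
    fun n p q => ?_⟩
  have e₁ : bracket (p - q) ^ j₁ ≤ bracket (p - q) ^ max j₁ j₂ :=
    pow_le_pow_right₀ (one_le_bracket _) (le_max_left _ _)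
  have e₂ : bracket (p - q) ^ j₂ ≤ bracket (p - q) ^ max j₁ j₂ :=
    pow_le_pow_right₀ (one_le_bracket _) (le_max_right _ _)
  have hp₁ := h₁.pos n p
  have hp₂ := h₂.pos n p
  have hb := bracket_pos (p - q)
  calc w₁ n q + w₂ n q ≤ C₁ * bracket (p - q) ^ j₁ * w₁ n p + C₂ * bracket (p - q) ^ j₂ * w₂ n p :=
        add_le_add (b₁ n p q) (b₂ n p q)
    _ ≤ C₁ * bracket (p - q) ^ max j₁ j₂ * w₁ n p + C₂ * bracket (p - q) ^ max j₁ j₂ * w₂ n p := by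
        gcongr
    _ ≤ C₁ * bracket (p - q) ^ max j₁ j₂ * w₁ n p + C₂ * bracket (p - q) ^ max j₁ j₂ * w₂ n p +
        (C₂ * bracket (p - q) ^ max j₁ j₂ * w₁ n p +
          C₁ * bracket (p - q) ^ max j₁ j₂ * w₂ n p) :=
        le_add_of_nonneg_right (by positivity)
    _ = _ := by
        simp only [Pi.add_apply]
        ring

end Tempered

/-- Domination of weights, up to a constant. -/
def Dominated (w v : Weight d) : Prop := ∃ C, 0 ≤ C ∧ ∀ n p, w n p ≤ C * v n p

namespace Dominated

theorem refl (w : Weight d) : Dominated w w := ⟨1, zero_le_one, fun _ _ => by rw [one_mul]⟩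

theorem mul_right (h : Dominated w₁ w₂) (hv : ∀ n p, 0 ≤ v n p) : Dominated (w₁ * v) (w₂ * v) := by
  obtain ⟨C, hC, b⟩ := h
  refine ⟨C, hC, fun n p => ?_⟩
  have := mul_le_mul_of_nonneg_right (b n p) (hv n p)
  simpa [mul_assoc] using this

theorem inv (h : Dominated w₁ w₂) (h₁ : ∀ n p, 0 < w₁ n p) (h₂ : ∀ n p, 0 < w₂ n p) :
    Dominated w₂⁻¹ w₁⁻¹ := by
  obtain ⟨C, hC, b⟩ := h
  refine ⟨C, hC, fun n p => ?_⟩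
  have i1 := h₁ n p
  have i2 := h₂ n p
  simp only [Pi.inv_apply]
  rw [← div_eq_mul_inv, le_div_iff₀ i1, inv_mul_le_iff₀ i2, mul_comm]
  exact b n p

end Dominated

/-- Families of operators whose momentum space matrix is bounded by `w` and decays rapidly off
the diagonal. -/
def IsOfOrder (w : Weight d) (K : Fam d) : Prop :=
  ∀ J : ℕ, ∃ C, 0 ≤ C ∧ ∀ n p q, ‖hat (K n) p q‖ * bracket (p - q) ^ J ≤ C * w n p

namespace IsOfOrder

theorem mono (h : IsOfOrder w K) (hw : Dominated w v) : IsOfOrder v K := by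
  intro J
  obtain ⟨C, hC, b⟩ := h J
  obtain ⟨C', hC', b'⟩ := hw
  refine ⟨C * C', by positivity, fun n p q => (b n p q).trans ?_⟩
  rw [mul_assoc]
  exact mul_le_mul_of_nonneg_left (b' n p) hC

theorem add (h₁ : IsOfOrder w K₁) (h₂ : IsOfOrder w K₂) : IsOfOrder w (K₁ + K₂) := by
  intro J
  obtain ⟨C₁, hC₁, b₁⟩ := h₁ J
  obtain ⟨C₂, hC₂, b₂⟩ := h₂ J
  refine ⟨C₁ + C₂, by positivity, fun n p q => ?_⟩
  have hb := (pow_pos (bracket_pos (p - q)) J).le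
  simp only [Pi.add_apply, hat_add, Matrix.add_apply]
  calc _ ≤ (‖hat (K₁ n) p q‖ + ‖hat (K₂ n) p q‖) * bracket (p - q) ^ J :=
        mul_le_mul_of_nonneg_right (norm_add_le _ _) hb
    _ ≤ _ := by
        rw [add_mul, add_mul]
        exact add_le_add (b₁ n p q) (b₂ n p q)

theorem smul {c : ℕ → ℂ} {C : ℝ} (h : IsOfOrder w K) (hC : 0 ≤ C)
    (hc : ∀ n p, ‖c n‖ * w n p ≤ C * v n p) : IsOfOrder v (fun n => c n • K n) := by
  intro J
  obtain ⟨B, hB, b⟩ := h J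
  refine ⟨B * C, by positivity, fun n p q => ?_⟩
  rw [hat_smul, Matrix.smul_apply, norm_smul, mul_assoc]
  calc _ ≤ ‖c n‖ * (B * w n p) := mul_le_mul_of_nonneg_left (b n p q) (norm_nonneg _)
    _ = B * (‖c n‖ * w n p) := by ring
    _ ≤ B * (C * v n p) := mul_le_mul_of_nonneg_left (hc n p) hB
    _ = _ := by ring

theorem const_smul (h : IsOfOrder w K) (c : ℂ) : IsOfOrder w (fun n => c • K n) :=
  h.smul (norm_nonneg c) fun _ _ => le_rfl

theorem neg (h : IsOfOrder w K) : IsOfOrder w (-K) := by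
  have : -K = fun n => (-1 : ℂ) • K n := by
    funext n
    simp
  rw [this]
  exact h.const_smul _

theorem sub (h₁ : IsOfOrder w K₁) (h₂ : IsOfOrder w K₂) : IsOfOrder w (K₁ - K₂) := by
  rw [sub_eq_add_neg]
  exact h₁.add h₂.neg

theorem zero (hw : ∀ n p, 0 ≤ w n p) : IsOfOrder w (0 : Fam d) := fun J =>
  ⟨1, zero_le_one, fun n p q => by simp [hat, hw n p]⟩

theorem sum {ι : Type*} (s : Finset ι) {K : ι → Fam d} (hw : ∀ n p, 0 ≤ w n p)
    (h : ∀ i ∈ s, IsOfOrder w (K i)) : IsOfOrder w (∑ i ∈ s, K i) :=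
  Finset.sum_induction _ _ (fun _ _ => add) (zero hw) h

theorem congr_mul (h : IsOfOrder w K) (hw : w = v) : IsOfOrder v K := hw ▸ h

/-- `bracket (p - q)` is split over the intermediate momentum `r`. Moving the weight `w₂` from `r`
to `p` costs `bracket (p - r) ^ j`, and two more powers pay for the sum over `r`; hence the decay
exponent `J + (j + 2)` taken from `K₁`. -/
theorem mul (h₁ : IsOfOrder w₁ K₁) (h₂ : IsOfOrder w₂ K₂) (hw₁ : ∀ n p, 0 ≤ w₁ n p)
    (hw₂ : Tempered w₂) : IsOfOrder (w₁ * w₂) (K₁ * K₂) := by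
  intro J
  obtain ⟨C, j, hC, b⟩ := hw₂.bound
  obtain ⟨C₁, hC₁, b₁⟩ := h₁ (J + (j + 2))
  obtain ⟨C₂, hC₂, b₂⟩ := h₂ J
  obtain ⟨S, hS, hsum⟩ := exists_sum_bracket_le d
  refine ⟨C₁ * C₂ * C * S, by positivity, fun n p q => ?_⟩
  have hp₁ := hw₁ n p
  have hp₂ := (hw₂.pos n p).le
  rw [Pi.mul_apply, hat_mul, Matrix.mul_apply]
  have hterm : ∀ r, ‖hat (K₁ n) p r * hat (K₂ n) r q‖ * bracket (p - q) ^ J ≤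
      C₁ * C₂ * C * (w₁ n p * w₂ n p) * (bracket (p - r) ^ 2)⁻¹ := by
    intro r
    have hb := bracket_pos (p - r)
    rw [norm_mul, ← div_eq_mul_inv, le_div_iff₀ (by positivity)]
    calc ‖hat (K₁ n) p r‖ * ‖hat (K₂ n) r q‖ * bracket (p - q) ^ J * bracket (p - r) ^ 2
        ≤ ‖hat (K₁ n) p r‖ * ‖hat (K₂ n) r q‖ * (bracket (p - r) * bracket (r - q)) ^ J *
            bracket (p - r) ^ 2 := by
          have := (bracket_pos (p - q)).le
          gcongr
          exact bracket_sub_le p q r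
      _ = (‖hat (K₁ n) p r‖ * bracket (p - r) ^ (J + 2)) *
            (‖hat (K₂ n) r q‖ * bracket (r - q) ^ J) := by
          rw [mul_pow, pow_add]
          ring
      _ ≤ (‖hat (K₁ n) p r‖ * bracket (p - r) ^ (J + 2)) *
            (C₂ * (C * bracket (p - r) ^ j * w₂ n p)) := by
          refine mul_le_mul_of_nonneg_left ?_ (by positivity)
          exact (b₂ n r q).trans (mul_le_mul_of_nonneg_left (b n p r) hC₂)
      _ = (‖hat (K₁ n) p r‖ * bracket (p - r) ^ (J + (j + 2))) * (C₂ * C * w₂ n p) := by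
          simp only [pow_add]
          ring
      _ ≤ (C₁ * w₁ n p) * (C₂ * C * w₂ n p) := by
          refine mul_le_mul_of_nonneg_right (b₁ n p r) (by positivity)
      _ = _ := by ring
  calc ‖∑ r, hat (K₁ n) p r * hat (K₂ n) r q‖ * bracket (p - q) ^ J
      ≤ ∑ r, ‖hat (K₁ n) p r * hat (K₂ n) r q‖ * bracket (p - q) ^ J := by
        rw [← Finset.sum_mul]
        exact mul_le_mul_of_nonneg_right (norm_sum_le _ _) (pow_pos (bracket_pos _) J).le
    _ ≤ ∑ r, C₁ * C₂ * C * (w₁ n p * w₂ n p) * (bracket (p - r) ^ 2)⁻¹ :=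
        Finset.sum_le_sum fun r _ => hterm r
    _ = C₁ * C₂ * C * (w₁ n p * w₂ n p) * ∑ k : Site d (n + 1), (bracket k ^ 2)⁻¹ := by
        rw [← Finset.mul_sum]
        congr 1
        exact Fintype.sum_equiv (Equiv.subLeft p) _ _ fun r => rfl
    _ ≤ C₁ * C₂ * C * (w₁ n p * w₂ n p) * S := by
        refine mul_le_mul_of_nonneg_left (hsum n) (by positivity)
    _ = _ := by
        simp only [Pi.mul_apply]
        ring

/-- The adjoint puts the weight at the column momentum; temperedness brings it back to the row at
the price of `j` powers of decay. -/
theorem conjTranspose (h : IsOfOrder w K) (hw : Tempered w) :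
    IsOfOrder w (fun n => (K n)ᴴ) := by
  intro J
  obtain ⟨C, j, hC, b⟩ := hw.bound
  obtain ⟨C₁, hC₁, b₁⟩ := h (J + j)
  refine ⟨C₁ * C, by positivity, fun n p q => ?_⟩
  have hb := bracket_pos (p - q)
  rw [hat_conjTranspose, Matrix.conjTranspose_apply, norm_star]
  refine le_of_mul_le_mul_right ?_ (pow_pos hb j)
  calc ‖hat (K n) q p‖ * bracket (p - q) ^ J * bracket (p - q) ^ j
      = ‖hat (K n) q p‖ * bracket (q - p) ^ (J + j) := by
        rw [bracket_sub_comm p q, pow_add]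
        ring
    _ ≤ C₁ * w n q := b₁ n q p
    _ ≤ C₁ * (C * bracket (p - q) ^ j * w n p) := mul_le_mul_of_nonneg_left (b n p q) hC₁
    _ = _ := by ring

theorem norm_trace_le (h : IsOfOrder w K) :
    ∃ C, 0 ≤ C ∧ ∀ n, ‖(K n).trace‖ ≤ C * ∑ p, w n p := by
  obtain ⟨C, hC, b⟩ := h 0
  refine ⟨C, hC, fun n => ?_⟩
  rw [← trace_hat, Matrix.trace, Finset.mul_sum]
  refine (norm_sum_le _ _).trans (Finset.sum_le_sum fun p _ => ?_)
  simpa using b n p p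

end IsOfOrder

/-- The lattice spacing, as a weight. -/
def spacingWeight (d : ℕ) (L : ℝ) : Weight d := fun n _ => spacing L (n + 1)

/-- The weight `1 + |p|`. -/
def lam (d : ℕ) (L : ℝ) : Weight d := fun n p => 1 + ∑ μ, ‖phase (p μ) - 1‖ / spacing L (n + 1)

/-- The weight `1 + a (1 + |p|) ^ 2`, of the size of the Wilson mass. -/
def ell (d : ℕ) (L : ℝ) : Weight d := 1 + spacingWeight d L * lam d L ^ 2

theorem spacing_pos (hL : 0 < L) (n : ℕ) : 0 < spacing L (n + 1) := by
  unfold spacing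
  positivity

theorem spacing_le (hL : 0 < L) (n : ℕ) : spacing L (n + 1) ≤ L := by
  rw [spacing]
  exact div_le_self hL.le (by push_cast; linarith [Nat.cast_nonneg (α := ℝ) n])

theorem one_le_lam (hL : 0 < L) (n : ℕ) (p : Site d (n + 1)) : 1 ≤ lam d L n p := by
  have := spacing_pos hL n
  unfold lam
  have : 0 ≤ ∑ μ, ‖phase (p μ) - 1‖ / spacing L (n + 1) :=
    Finset.sum_nonneg fun μ _ => by positivity
  linarith

theorem norm_phase_sub_one_le_lam (hL : 0 < L) (n : ℕ) (p : Site d (n + 1)) (μ : Fin d) :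
    ‖phase (p μ) - 1‖ ≤ spacing L (n + 1) * lam d L n p := by
  have ha := spacing_pos hL n
  have h : ‖phase (p μ) - 1‖ / spacing L (n + 1) ≤ ∑ μ, ‖phase (p μ) - 1‖ / spacing L (n + 1) :=
    Finset.single_le_sum (f := fun μ => ‖phase (p μ) - 1‖ / spacing L (n + 1))
      (fun μ _ => by positivity) (Finset.mem_univ μ)
  rw [mul_comm, ← div_le_iff₀ ha, lam]
  linarith

theorem norm_phase_sub_le (hL : 0 < L) (n : ℕ) (p q : Site d (n + 1)) (μ : Fin d) :
    ‖phase (p μ) - phase (q μ)‖ ≤ 2 * Real.pi / L * spacing L (n + 1) * bracket (p - q) := by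
  rw [norm_phase_sub]
  refine (norm_stdAddChar_sub_one_le _).trans ?_
  have h1 := natAbs_le_bracket (p - q) μ
  rw [Pi.sub_apply] at h1
  have h2 : 2 * Real.pi / L * spacing L (n + 1) = 2 * Real.pi / ((n + 1 : ℕ) : ℝ) := by
    rw [spacing]
    field_simp
  rw [h2]
  refine mul_le_mul_of_nonneg_left (by linarith) (by positivity)

theorem le_norm_phase_sub (hL : 0 < L) (n : ℕ) (p q : Site d (n + 1)) (μ : Fin d) :
    4 / L * spacing L (n + 1) * (((p - q) μ).valMinAbs.natAbs : ℝ) ≤ ‖phase (p μ) - phase (q μ)‖ := by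
  rw [norm_phase_sub]
  refine le_trans (le_of_eq ?_) (le_norm_stdAddChar_sub_one _)
  rw [spacing, Pi.sub_apply]
  field_simp

theorem tempered_spacingWeight (hL : 0 < L) : Tempered (spacingWeight d L) :=
  ⟨fun n _ => spacing_pos hL n, 1, 0, zero_le_one, fun n p q => by simp [spacingWeight]⟩

theorem tempered_lam (hL : 0 < L) : Tempered (lam d L) := by
  refine ⟨fun n p => zero_lt_one.trans_le (one_le_lam hL n p), 1 + d * (2 * Real.pi / L), 1,
    by positivity, fun n p q => ?_⟩
  have ha := spacing_pos hL n
  have h1 : ∀ μ, ‖phase (q μ) - 1‖ / spacing L (n + 1) ≤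
      ‖phase (p μ) - 1‖ / spacing L (n + 1) + 2 * Real.pi / L * bracket (p - q) := by
    intro μ
    have h2 : ‖phase (q μ) - 1‖ ≤ ‖phase (p μ) - 1‖ + ‖phase (p μ) - phase (q μ)‖ := by
      have := norm_sub_le (phase (p μ) - 1) (phase (p μ) - phase (q μ))
      simpa using this
    have h3 := norm_phase_sub_le hL n p q μ
    rw [div_le_iff₀ ha, add_mul, div_mul_cancel₀ _ ha.ne']
    linarith
  have h4 : lam d L n q ≤ lam d L n p + d * (2 * Real.pi / L * bracket (p - q)) := by
    have := Finset.sum_le_sum (s := Finset.univ) fun μ _ => h1 μ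
    rw [Finset.sum_add_distrib, Finset.sum_const, Finset.card_univ, Fintype.card_fin,
      nsmul_eq_mul] at this
    simp only [lam]
    linarith
  have hl := one_le_lam hL n p
  have hb := one_le_bracket (p - q)
  have hc : 0 ≤ (d : ℝ) * (2 * Real.pi / L) := by positivity
  rw [pow_one]
  nlinarith [mul_nonneg hc (mul_nonneg (zero_le_one.trans hb) (sub_nonneg.2 hl)),
    mul_nonneg (sub_nonneg.2 hb) (zero_le_one.trans hl)]

theorem tempered_ell (hL : 0 < L) : Tempered (ell d L) :=
  Tempered.one.add ((tempered_spacingWeight hL).mul ((tempered_lam hL).pow 2))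

theorem natAbs_le_lam (hL : 0 < L) (n : ℕ) (p : Site d (n + 1)) (μ : Fin d) :
    1 + ((p μ).valMinAbs.natAbs : ℝ) ≤ (L / 4 + Real.pi / 4 + 1) * lam d L n p := by
  have ha := spacing_pos hL n
  have h1 := le_norm_phase_sub_one (p μ)
  have h2 := norm_phase_sub_one_le_lam hL n p μ
  have hl := one_le_lam hL n p
  have h3 : 4 / ((n + 1 : ℕ) : ℝ) * ((p μ).valMinAbs.natAbs : ℝ) - Real.pi / ((n + 1 : ℕ) : ℝ) =
      (4 * ((p μ).valMinAbs.natAbs : ℝ) - Real.pi) / L * spacing L (n + 1) := by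
    rw [spacing]
    field_simp
  rw [h3] at h1
  have h4 : (4 * ((p μ).valMinAbs.natAbs : ℝ) - Real.pi) / L ≤ lam d L n p := by
    refine le_of_mul_le_mul_right (a := spacing L (n + 1)) ?_ ha
    linarith
  rw [div_le_iff₀ hL] at h4
  nlinarith [Real.pi_pos]

/-- Each factor of `bracket` is at most a constant times `lam`. This converts powers of `lam` into
decay in the integer momenta, both in the inversion of operators and in the final trace. -/
theorem bracket_le_lam_pow (hL : 0 < L) (n : ℕ) (p : Site d (n + 1)) :
    bracket p ≤ ((L / 4 + Real.pi / 4 + 1) * lam d L n p) ^ d := by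
  have := Finset.prod_le_prod (s := Finset.univ)
    (fun μ _ => by positivity : ∀ μ ∈ Finset.univ, (0 : ℝ) ≤ 1 + ((p μ).valMinAbs.natAbs : ℝ))
    (fun μ _ => natAbs_le_lam hL n p μ)
  rw [Finset.prod_const, Finset.card_univ, Fintype.card_fin] at this
  exact this

theorem one_le_ell (hL : 0 < L) (n : ℕ) (p : Site d (n + 1)) : 1 ≤ ell d L n p := by
  have h1 := spacing_pos hL n
  have h2 : 0 ≤ spacing L (n + 1) * lam d L n p ^ 2 := by positivity
  simp only [ell, Pi.add_apply, Pi.one_apply, Pi.mul_apply, Pi.pow_apply, spacingWeight]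
  linarith

/-- The lattice cuts momenta off at order `1 / a`, since a phase differs from `1` by at most `2`. -/
theorem spacing_mul_lam_le (hL : 0 < L) (n : ℕ) (p : Site d (n + 1)) :
    spacing L (n + 1) * lam d L n p ≤ L + 2 * d := by
  have ha := spacing_pos hL n
  have h1 : ∑ μ, ‖phase (p μ) - 1‖ / spacing L (n + 1) ≤ ∑ _μ : Fin d, 2 / spacing L (n + 1) := by
    refine Finset.sum_le_sum fun μ _ => ?_
    gcongr
    refine (norm_sub_le _ _).trans ?_
    rw [norm_phase, norm_one]
    norm_num
  rw [Finset.sum_const, Finset.card_univ, Fintype.card_fin, nsmul_eq_mul] at h1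
  have h2 : lam d L n p ≤ 1 + d * (2 / spacing L (n + 1)) := by
    simp only [lam]
    linarith
  calc _ ≤ spacing L (n + 1) * (1 + d * (2 / spacing L (n + 1))) :=
        mul_le_mul_of_nonneg_left h2 ha.le
    _ = spacing L (n + 1) + 2 * d := by
        field_simp
    _ ≤ _ := by linarith [spacing_le hL n]

theorem ell_le_lam (hL : 0 < L) (n : ℕ) (p : Site d (n + 1)) :
    ell d L n p ≤ (1 + L + 2 * d) * lam d L n p := by
  have h1 := spacing_mul_lam_le hL n p
  have h2 := one_le_lam hL n p
  simp only [ell, Pi.add_apply, Pi.one_apply, Pi.mul_apply, Pi.pow_apply, spacingWeight]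
  nlinarith [mul_le_mul_of_nonneg_right h1 (zero_le_one.trans h2)]

end WilsonFermion

/-! ### Translation invariant operators. -/

namespace WilsonFermion

variable {d : ℕ} {L : ℝ} {w w₁ w₂ w₃ v : Weight d} {K K₁ K₂ : Fam d}

/-- The symbol of a translation invariant operator. -/
def multiplierSymbol (K : Fam d) (n : ℕ) (p : Site d (n + 1)) : ℂ := hat (K n) p p

theorem multiplierSymbol_eq {g : ∀ n, Site d (n + 1) → ℂ}
    (h : ∀ n, hat (K n) = Matrix.diagonal (g n)) (n : ℕ) (p : Site d (n + 1)) :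
    multiplierSymbol K n p = g n p := by
  rw [multiplierSymbol, h, Matrix.diagonal_apply_eq]

/-- Translation invariant operators whose symbol is bounded by `w` and whose differences
gain a power of the momentum. -/
structure IsMultiplier (L : ℝ) (w : Weight d) (K : Fam d) : Prop where
  diag : ∀ n, hat (K n) = Matrix.diagonal (multiplierSymbol K n)
  bound : ∃ C, 0 ≤ C ∧ ∀ n p, ‖multiplierSymbol K n p‖ ≤ C * w n p
  slow : ∃ (C : ℝ) (j : ℕ), 0 ≤ C ∧ ∀ n p q,
    ‖multiplierSymbol K n p - multiplierSymbol K n q‖ ≤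
      C * bracket (p - q) ^ j * (w n p / lam d L n p)

theorem Dominated.div_lam (hL : 0 < L) (h : Dominated w v) :
    Dominated (w / lam d L) (v / lam d L) := by
  rw [div_eq_mul_inv, div_eq_mul_inv]
  exact h.mul_right fun n p => (inv_pos.2 ((tempered_lam hL).pos n p)).le

theorem dominated_div_lam (hL : 0 < L) (hw : Tempered w) : Dominated (w / lam d L) w :=
  ⟨1, zero_le_one, fun n p => by
    rw [one_mul]
    exact div_le_self (hw.pos n p).le (one_le_lam hL n p)⟩

namespace IsMultiplier

theorem of_symbol {g : ∀ n, Site d (n + 1) → ℂ}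
    (h : ∀ n, hat (K n) = Matrix.diagonal (g n))
    (hb : ∃ C, 0 ≤ C ∧ ∀ n p, ‖g n p‖ ≤ C * w n p)
    (hs : ∃ (C : ℝ) (j : ℕ), 0 ≤ C ∧ ∀ n p q, ‖g n p - g n q‖ ≤
      C * bracket (p - q) ^ j * (w n p / lam d L n p)) : IsMultiplier L w K := by
  have e : multiplierSymbol K = g := by
    funext n p
    exact multiplierSymbol_eq h n p
  refine ⟨?_, ?_, ?_⟩ <;> rwa [e]

theorem isOfOrder (h : IsMultiplier L w K) : IsOfOrder w K := by
  obtain ⟨C, hC, b⟩ := h.bound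
  refine fun J => ⟨C, hC, fun n p q => ?_⟩
  rw [h.diag]
  by_cases hpq : p = q
  · subst hpq
    simpa [bracket] using b n p
  · rw [Matrix.diagonal_apply_ne _ hpq, norm_zero, zero_mul]
    exact (norm_nonneg _).trans (b n p)

theorem mono (hL : 0 < L) (h : IsMultiplier L w K) (hw : Dominated w v) : IsMultiplier L v K := by
  obtain ⟨C, hC, b⟩ := h.bound
  obtain ⟨C', j, hC', b'⟩ := h.slow
  obtain ⟨D, hD, hd⟩ := hw
  refine ⟨h.diag, ⟨C * D, by positivity, fun n p => (b n p).trans ?_⟩,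
    ⟨C' * D, j, by positivity, fun n p q => (b' n p q).trans ?_⟩⟩
  · rw [mul_assoc]
    exact mul_le_mul_of_nonneg_left (hd n p) hC
  · have h1 := (bracket_pos (p - q)).le
    have h2 := zero_le_one.trans (one_le_lam hL n p)
    calc _ ≤ C' * bracket (p - q) ^ j * (D * v n p / lam d L n p) := by
          gcongr
          exact hd n p
      _ = _ := by ring

theorem add (h₁ : IsMultiplier L w K₁) (h₂ : IsMultiplier L w K₂) (hL : 0 < L) (hw : Tempered w) :
    IsMultiplier L w (K₁ + K₂) := by
  obtain ⟨C₁, hC₁, b₁⟩ := h₁.bound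
  obtain ⟨C₂, hC₂, b₂⟩ := h₂.bound
  obtain ⟨D₁, j₁, hD₁, s₁⟩ := h₁.slow
  obtain ⟨D₂, j₂, hD₂, s₂⟩ := h₂.slow
  refine of_symbol (g := fun n p => multiplierSymbol K₁ n p + multiplierSymbol K₂ n p) ?_
    ⟨C₁ + C₂, by positivity, fun n p => ?_⟩ ⟨D₁ + D₂, j₁ + j₂, by positivity, fun n p q => ?_⟩
  · intro n
    rw [Pi.add_apply, hat_add, h₁.diag, h₂.diag, Matrix.diagonal_add]
  · rw [add_mul]
    exact (norm_add_le _ _).trans (add_le_add (b₁ n p) (b₂ n p))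
  · have h0 : 0 ≤ w n p / lam d L n p :=
      div_nonneg (hw.pos n p).le (zero_le_one.trans (one_le_lam hL n p))
    have e₁ : bracket (p - q) ^ j₁ ≤ bracket (p - q) ^ (j₁ + j₂) :=
      pow_le_pow_right₀ (one_le_bracket _) (by omega)
    have e₂ : bracket (p - q) ^ j₂ ≤ bracket (p - q) ^ (j₁ + j₂) :=
      pow_le_pow_right₀ (one_le_bracket _) (by omega)
    rw [add_sub_add_comm]
    refine (norm_add_le _ _).trans ((add_le_add (s₁ n p q) (s₂ n p q)).trans ?_)
    calc _ ≤ D₁ * bracket (p - q) ^ (j₁ + j₂) * (w n p / lam d L n p) +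
          D₂ * bracket (p - q) ^ (j₁ + j₂) * (w n p / lam d L n p) := by gcongr
      _ = _ := by ring

theorem smul {c : ℕ → ℂ} {C : ℝ} (h : IsMultiplier L w K) (hL : 0 < L) (hC : 0 ≤ C)
    (hc : ∀ n p, ‖c n‖ * w n p ≤ C * v n p) : IsMultiplier L v (fun n => c n • K n) := by
  obtain ⟨C₁, hC₁, b₁⟩ := h.bound
  obtain ⟨D₁, j, hD₁, s₁⟩ := h.slow
  refine of_symbol (g := fun n p => c n * multiplierSymbol K n p) ?_
    ⟨C₁ * C, by positivity, fun n p => ?_⟩ ⟨D₁ * C, j, by positivity, fun n p q => ?_⟩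
  · intro n
    rw [hat_smul, h.diag, ← Matrix.diagonal_smul]
    rfl
  · rw [norm_mul]
    calc _ ≤ ‖c n‖ * (C₁ * w n p) := mul_le_mul_of_nonneg_left (b₁ n p) (norm_nonneg _)
      _ = C₁ * (‖c n‖ * w n p) := by ring
      _ ≤ C₁ * (C * v n p) := mul_le_mul_of_nonneg_left (hc n p) hC₁
      _ = _ := by ring
  · have hb := (bracket_pos (p - q)).le
    have hl := zero_le_one.trans (one_le_lam hL n p)
    rw [← mul_sub, norm_mul]
    calc _ ≤ ‖c n‖ * (D₁ * bracket (p - q) ^ j * (w n p / lam d L n p)) :=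
          mul_le_mul_of_nonneg_left (s₁ n p q) (norm_nonneg _)
      _ = D₁ * bracket (p - q) ^ j * (‖c n‖ * w n p / lam d L n p) := by ring
      _ ≤ D₁ * bracket (p - q) ^ j * (C * v n p / lam d L n p) := by
          gcongr D₁ * bracket (p - q) ^ j * (?_ / _)
          exact hc n p
      _ = _ := by ring

theorem const_smul (h : IsMultiplier L w K) (hL : 0 < L) (c : ℂ) :
    IsMultiplier L w (fun n => c • K n) :=
  h.smul hL (norm_nonneg c) fun _ _ => le_rfl

theorem neg (h : IsMultiplier L w K) (hL : 0 < L) : IsMultiplier L w (-K) := by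
  have : -K = fun n => (-1 : ℂ) • K n := by
    funext n
    simp
  rw [this]
  exact h.const_smul hL _

theorem sub (h₁ : IsMultiplier L w K₁) (h₂ : IsMultiplier L w K₂) (hL : 0 < L) (hw : Tempered w) :
    IsMultiplier L w (K₁ - K₂) := by
  rw [sub_eq_add_neg]
  exact h₁.add (h₂.neg hL) hL hw

theorem one : IsMultiplier L (1 : Weight d) (1 : Fam d) :=
  of_symbol (g := fun _ _ => 1) (fun n => by rw [Pi.one_apply, hat_one]; exact Matrix.diagonal_one.symm)
    ⟨1, zero_le_one, fun n p => by simp⟩ ⟨0, 0, le_rfl, fun n p q => by simp⟩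

theorem zero : IsMultiplier L w (0 : Fam d) :=
  of_symbol (g := fun _ _ => 0) (fun n => by simp [hat])
    ⟨0, le_rfl, fun n p => by simp⟩ ⟨0, 0, le_rfl, fun n p q => by simp⟩

theorem sum {ι : Type*} (s : Finset ι) {K : ι → Fam d} (hL : 0 < L) (hw : Tempered w)
    (h : ∀ i ∈ s, IsMultiplier L w (K i)) : IsMultiplier L w (∑ i ∈ s, K i) :=
  Finset.sum_induction _ _ (fun _ _ h₁ h₂ => h₁.add h₂ hL hw) zero h

theorem mul (h₁ : IsMultiplier L w₁ K₁) (h₂ : IsMultiplier L w₂ K₂) (hL : 0 < L)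
    (hw₁ : Tempered w₁) (hw₂ : Tempered w₂) : IsMultiplier L (w₁ * w₂) (K₁ * K₂) := by
  obtain ⟨C₁, hC₁, b₁⟩ := h₁.bound
  obtain ⟨C₂, hC₂, b₂⟩ := h₂.bound
  obtain ⟨D₁, j₁, hD₁, s₁⟩ := h₁.slow
  obtain ⟨D₂, j₂, hD₂, s₂⟩ := h₂.slow
  obtain ⟨T, t, hT, ht⟩ := hw₂.bound
  refine of_symbol (g := fun n p => multiplierSymbol K₁ n p * multiplierSymbol K₂ n p) ?_
    ⟨C₁ * C₂, by positivity, fun n p => ?_⟩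
    ⟨C₁ * D₂ + D₁ * C₂ * T, j₁ + j₂ + t, by positivity, fun n p q => ?_⟩
  · intro n
    rw [Pi.mul_apply, hat_mul, h₁.diag, h₂.diag, Matrix.diagonal_mul_diagonal]
  · have hp := (hw₁.pos n p).le
    rw [norm_mul, Pi.mul_apply]
    calc _ ≤ (C₁ * w₁ n p) * (C₂ * w₂ n p) :=
          mul_le_mul (b₁ n p) (b₂ n p) (norm_nonneg _) (by positivity)
      _ = _ := by
          simp only [Pi.mul_apply]
          ring
  · have hp₁ := (hw₁.pos n p).le
    have hp₂ := (hw₂.pos n p).le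
    have hb := (bracket_pos (p - q)).le
    have hl := zero_le_one.trans (one_le_lam hL n p)
    have e₁ : bracket (p - q) ^ j₂ ≤ bracket (p - q) ^ (j₁ + j₂ + t) :=
      pow_le_pow_right₀ (one_le_bracket _) (by omega)
    have e₂ : bracket (p - q) ^ (j₁ + t) ≤ bracket (p - q) ^ (j₁ + j₂ + t) :=
      pow_le_pow_right₀ (one_le_bracket _) (by omega)
    have e : multiplierSymbol K₁ n p * multiplierSymbol K₂ n p -
        multiplierSymbol K₁ n q * multiplierSymbol K₂ n q =
        multiplierSymbol K₁ n p * (multiplierSymbol K₂ n p - multiplierSymbol K₂ n q) +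
        (multiplierSymbol K₁ n p - multiplierSymbol K₁ n q) * multiplierSymbol K₂ n q := by ring
    rw [e]
    refine (norm_add_le _ _).trans ?_
    rw [norm_mul, norm_mul, Pi.mul_apply]
    calc _ ≤ (C₁ * w₁ n p) * (D₂ * bracket (p - q) ^ j₂ * (w₂ n p / lam d L n p)) +
          (D₁ * bracket (p - q) ^ j₁ * (w₁ n p / lam d L n p)) *
            (C₂ * (T * bracket (p - q) ^ t * w₂ n p)) := by
          refine add_le_add (mul_le_mul (b₁ n p) (s₂ n p q) (norm_nonneg _) (by positivity))
            (mul_le_mul (s₁ n p q) ((b₂ n q).trans ?_) (norm_nonneg _) (by positivity))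
          exact mul_le_mul_of_nonneg_left (ht n p q) hC₂
      _ = C₁ * D₂ * bracket (p - q) ^ j₂ * (w₁ n p * w₂ n p / lam d L n p) +
          D₁ * C₂ * T * bracket (p - q) ^ (j₁ + t) * (w₁ n p * w₂ n p / lam d L n p) := by
          rw [pow_add]
          ring
      _ ≤ C₁ * D₂ * bracket (p - q) ^ (j₁ + j₂ + t) * (w₁ n p * w₂ n p / lam d L n p) +
          D₁ * C₂ * T * bracket (p - q) ^ (j₁ + j₂ + t) * (w₁ n p * w₂ n p / lam d L n p) := by
          gcongr
      _ = _ := by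
          simp only [Pi.mul_apply]
          ring

theorem commute (h₁ : IsMultiplier L w₁ K₁) (h₂ : IsMultiplier L w₂ K₂) : Commute K₁ K₂ := by
  funext n
  apply hat_injective
  rw [Pi.mul_apply, Pi.mul_apply, hat_mul, hat_mul, h₁.diag, h₂.diag, Matrix.diagonal_mul_diagonal,
    Matrix.diagonal_mul_diagonal]
  congr 1
  funext p
  ring

theorem conjTranspose (h : IsMultiplier L w K) : IsMultiplier L w (fun n => (K n)ᴴ) := by
  refine of_symbol (g := fun n p => star (multiplierSymbol K n p)) ?_ ?_ ?_
  · intro n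
    rw [hat_conjTranspose, h.diag, Matrix.diagonal_conjTranspose]
    rfl
  · simpa using h.bound
  · simpa only [← star_sub, norm_star] using h.slow

theorem mul_inv_cancel (h : IsMultiplier L w K) (hw : Tempered w) {c : ℝ} (hc : 0 < c)
    (hlow : ∀ n p, c * w n p ≤ ‖multiplierSymbol K n p‖) : K * K⁻¹ = 1 := by
  funext n
  apply hat_injective
  have hne : ∀ p, multiplierSymbol K n p ≠ 0 := fun p =>
    norm_pos_iff.1 ((mul_pos hc (hw.pos n p)).trans_le (hlow n p))
  rw [Pi.mul_apply, Pi.inv_apply, hat_mul, hat_inv, Pi.one_apply, hat_one, Matrix.mul_nonsing_inv]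
  rw [h.diag, Matrix.det_diagonal]
  exact (Finset.prod_ne_zero_iff.2 fun p _ => hne p).isUnit

/-- Slow variation passes to the reciprocal through `1/x - 1/y = -(x - y)/(x y)`; the lower bound
controls the denominators, and temperedness moves the weight from `q` to `p`. -/
theorem inv (h : IsMultiplier L w K) (hL : 0 < L) (hw : Tempered w) {c : ℝ} (hc : 0 < c)
    (hlow : ∀ n p, c * w n p ≤ ‖multiplierSymbol K n p‖) : IsMultiplier L w⁻¹ K⁻¹ := by
  have hne : ∀ n p, multiplierSymbol K n p ≠ 0 := fun n p =>
    norm_pos_iff.1 ((mul_pos hc (hw.pos n p)).trans_le (hlow n p))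
  have hinv : ∀ n p, ‖(multiplierSymbol K n p)⁻¹‖ ≤ c⁻¹ * (w n p)⁻¹ := by
    intro n p
    rw [norm_inv, ← mul_inv]
    exact inv_anti₀ (mul_pos hc (hw.pos n p)) (hlow n p)
  obtain ⟨D, j, hD, s⟩ := h.slow
  obtain ⟨T, t, hT, ht⟩ := hw.inv.bound
  refine of_symbol (g := fun n p => (multiplierSymbol K n p)⁻¹) ?_
    ⟨c⁻¹, by positivity, hinv⟩ ⟨D * c⁻¹ * c⁻¹ * T, j + t, by positivity, fun n p q => ?_⟩
  · intro n
    rw [Pi.inv_apply, hat_inv]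
    refine Matrix.inv_eq_left_inv ?_
    rw [h.diag, Matrix.diagonal_mul_diagonal]
    refine (congrArg Matrix.diagonal (funext fun p => ?_)).trans Matrix.diagonal_one
    exact inv_mul_cancel₀ (hne n p)
  · have hp := hw.pos n p
    have hq := hw.pos n q
    have hb := bracket_pos (p - q)
    have hl := zero_lt_one.trans_le (one_le_lam hL n p)
    have e : (multiplierSymbol K n p)⁻¹ - (multiplierSymbol K n q)⁻¹ =
        -((multiplierSymbol K n p - multiplierSymbol K n q) *
          ((multiplierSymbol K n p)⁻¹ * (multiplierSymbol K n q)⁻¹)) := by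
      have := hne n p
      have := hne n q
      field_simp
      ring
    rw [e, norm_neg, norm_mul, norm_mul]
    have htq := ht n p q
    simp only [Pi.inv_apply] at htq
    calc _ ≤ (D * bracket (p - q) ^ j * (w n p / lam d L n p)) *
          ((c⁻¹ * (w n p)⁻¹) * (c⁻¹ * (T * bracket (p - q) ^ t * (w n p)⁻¹))) := by
          refine mul_le_mul (s n p q) (mul_le_mul (hinv n p) ((hinv n q).trans ?_)
            (norm_nonneg _) (by positivity)) (by positivity) (by positivity)
          exact mul_le_mul_of_nonneg_left htq (by positivity)
      _ = D * c⁻¹ * c⁻¹ * T * bracket (p - q) ^ (j + t) * ((w n p * (w n p)⁻¹) * (w n p)⁻¹ /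
            lam d L n p) := by
          rw [pow_add]
          ring
      _ = _ := by
          rw [_root_.mul_inv_cancel₀ hp.ne', one_mul]
          rfl

end IsMultiplier

/-- The free translations. -/
def shiftF (d : ℕ) (μ : Fin d) : Fam d := fun _ => freeShift μ

/-- Multiplication by a function of the lattice spacing and of the position. -/
def mulF (L : ℝ) (f : ℝ × (Fin d → ℝ) → ℂ) : Fam d :=
  fun n => mulOp L fun x => f (spacing L (n + 1), x)

/-- Two phases differ by at most a constant times `a * bracket (p - q)`, and `a` is bounded by a
constant over `lam` because of the momentum cutoff. -/
theorem isMultiplier_shiftF (hL : 0 < L) (μ : Fin d) : IsMultiplier L 1 (shiftF d μ) := by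
  refine IsMultiplier.of_symbol (g := fun n p => phase (p μ)) (fun n => hat_freeShift μ)
    ⟨1, zero_le_one, fun n p => by simp [norm_phase]⟩
    ⟨2 * Real.pi / L * (L + 2 * d), 1, by positivity, fun n p q => ?_⟩
  refine (norm_phase_sub_le hL n p q μ).trans ?_
  have h1 := spacing_mul_lam_le hL n p
  have hl := zero_lt_one.trans_le (one_le_lam hL n p)
  have hb := bracket_pos (p - q)
  rw [pow_one, Pi.one_apply, Pi.one_apply]
  calc _ = 2 * Real.pi / L * (spacing L (n + 1) * lam d L n p) * bracket (p - q) *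
        (1 / lam d L n p) := by
        field_simp
    _ ≤ 2 * Real.pi / L * (L + 2 * d) * bracket (p - q) * (1 / lam d L n p) := by gcongr

/-! ### Multiplication by smooth functions. -/

section mulF

variable {f g : ℝ × (Fin d → ℝ) → ℂ}

theorem mulF_add : mulF L (f + g) = mulF L f + mulF L g := by
  funext n
  ext x y
  by_cases h : x = y <;> simp [mulF, mulOp, h]

theorem mulF_mul : mulF L (f * g) = mulF L f * mulF L g := by
  funext n
  simp [mulF, mulOp]

theorem mulF_conj : mulF L (fun z => star (f z)) = fun n => (mulF L f n)ᴴ := by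
  funext n
  simp only [mulF, mulOp, Matrix.diagonal_conjTranspose]
  rfl

theorem mulF_spacing {k : ℝ × (Fin d → ℝ) → ℂ} (h : ∀ a x, f (a, x) = g (a, x) + (a : ℂ) * k (a, x)) :
    mulF L f = mulF L g + fun n => (spacing L (n + 1) : ℂ) • mulF L k n := by
  funext n
  ext x y
  by_cases hxy : x = y <;> simp [mulF, mulOp, hxy, h]

/-- After the last site the representative jumps back by `L`, which periodicity absorbs. -/
theorem position_add_single (hf : Good L f) (a : ℝ) {N : ℕ} [NeZero N] (x : Site d N) (μ : Fin d) :
    f (a, position L (x + Pi.single μ 1)) = f (a, position L x + Pi.single μ (spacing L N)) := by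
  have hN : (N : ℝ) ≠ 0 := by exact_mod_cast NeZero.ne N
  by_cases h : (x μ).val + 1 = N
  · have hx : x μ + 1 = 0 := by
      have h2 : (((x μ).val + 1 : ℕ) : ZMod N) = 0 := by rw [h]; simp
      push_cast at h2
      rwa [ZMod.natCast_zmod_val] at h2
    have e : position L x + Pi.single μ (spacing L N) =
        position L (x + Pi.single μ 1) + Pi.single μ L := by
      funext ν
      by_cases hν : ν = μ
      · subst hν
        have h3 : (((x ν).val : ℕ) : ℝ) + 1 = N := by exact_mod_cast h
        simp only [position, Pi.add_apply, Pi.single_eq_same, hx, ZMod.val_zero, Nat.cast_zero,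
          mul_zero, zero_add]
        rw [← mul_add_one, h3, spacing, div_mul_cancel₀ _ hN]
      · simp [position, Pi.single_eq_of_ne hν]
    rw [e, hf.periodic]
  · have hv : (x μ + 1).val = (x μ).val + 1 := by
      have h3 : (((x μ).val + 1 : ℕ) : ZMod N) = x μ + 1 := by simp
      have h4 := ZMod.val_lt (x μ)
      rw [← h3, ZMod.val_natCast, Nat.mod_eq_of_lt (by omega)]
    have e : position L x + Pi.single μ (spacing L N) = position L (x + Pi.single μ 1) := by
      funext ν
      by_cases hν : ν = μ
      · subst hν
        simp only [position, Pi.add_apply, Pi.single_eq_same, hv]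
        push_cast
        ring
      · simp [position, Pi.single_eq_of_ne hν]
    rw [e]

theorem shiftF_mul_mulF (hf : Good L f) (μ : Fin d) :
    shiftF d μ * mulF L f = mulF L (shiftFun μ f) * shiftF d μ := by
  funext n
  ext x y
  simp only [Pi.mul_apply, shiftF, mulF, mulOp, Matrix.mul_diagonal, Matrix.diagonal_mul, freeShift,
    Matrix.of_apply, shiftFun]
  by_cases h : y = x + Pi.single μ 1
  · rw [if_pos h, h, position_add_single hf, mul_comm]
  · rw [if_neg h, zero_mul, mul_zero]

theorem position_mem (hL : 0 < L) (n : ℕ) (x : Site d (n + 1)) (i : Fin d) :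
    position L x i ∈ Set.Icc 0 L := by
  have h0 : ((x i).val : ℝ) ≤ ((n + 1 : ℕ) : ℝ) := by exact_mod_cast (ZMod.val_lt (x i)).le
  refine ⟨mul_nonneg (spacing_pos hL n).le (Nat.cast_nonneg _), ?_⟩
  calc spacing L (n + 1) * ((x i).val : ℝ) ≤ spacing L (n + 1) * ((n + 1 : ℕ) : ℝ) :=
        mul_le_mul_of_nonneg_left h0 (spacing_pos hL n).le
    _ = L := by
        rw [spacing, div_mul_cancel₀]
        positivity

/-- Summation by parts. Commuting with a translation multiplies the entry at `(p, q)` by a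
difference of phases, at least `(4 a / L) |p μ - q μ|`, and replaces `f` by `a` times its difference
quotient. Every direction in the list thus buys one factor of decay, uniformly in `a`. -/
theorem exists_mulF_decay (hL : 0 < L) (s : List (Fin d)) : ∀ {f : ℝ × (Fin d → ℝ) → ℂ}, Good L f →
    ∃ C, 0 ≤ C ∧ ∀ n p q, ‖hat (mulF L f n) p q‖ *
      (s.map fun μ => 1 + (((p - q) μ).valMinAbs.natAbs : ℝ)).prod ≤ C := by
  induction s with
  | nil =>
    intro f hf
    obtain ⟨C, hC, b⟩ := hf.bounded
    refine ⟨C, hC, fun n p q => ?_⟩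
    rw [List.map_nil, List.prod_nil, mul_one]
    exact norm_hat_mulOp_le (fun x => b _ ⟨(spacing_pos hL n).le, spacing_le hL n⟩ _
      (position_mem hL n x)) p q
  | cons μ s ih =>
    intro f hf
    obtain ⟨g, hg, hfg, -⟩ := hf.exists_diff μ
    obtain ⟨C₁, hC₁, b₁⟩ := ih hf
    obtain ⟨C₂, hC₂, b₂⟩ := ih hg
    refine ⟨C₁ + L / 4 * C₂, by positivity, fun n p q => ?_⟩
    have ha := spacing_pos hL n
    have h1 : (phase (p μ) - phase (q μ)) * hat (mulF L f n) p q =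
        (spacing L (n + 1) : ℂ) * hat (mulF L g n) p q * phase (q μ) := by
      have h2 := congrFun (shiftF_mul_mulF hf μ) n
      rw [mulF_spacing hfg] at h2
      have h3 := congrFun (congrFun (congrArg hat h2) p) q
      simp only [Pi.mul_apply, Pi.add_apply, shiftF, hat_mul, hat_add, hat_smul, hat_freeShift,
        Matrix.diagonal_mul, Matrix.mul_diagonal, Matrix.add_apply, Matrix.smul_apply,
        smul_eq_mul] at h3
      linear_combination h3
    have h4 : ‖phase (p μ) - phase (q μ)‖ * ‖hat (mulF L f n) p q‖ =
        spacing L (n + 1) * ‖hat (mulF L g n) p q‖ := by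
      rw [← norm_mul, h1, norm_mul, norm_mul, norm_phase, mul_one, Complex.norm_real,
        Real.norm_of_nonneg ha.le]
    have h5 : (((p - q) μ).valMinAbs.natAbs : ℝ) * ‖hat (mulF L f n) p q‖ ≤
        L / 4 * ‖hat (mulF L g n) p q‖ := by
      have h6 := mul_le_mul_of_nonneg_right (le_norm_phase_sub hL n p q μ)
        (norm_nonneg (hat (mulF L f n) p q))
      rw [h4] at h6
      refine le_of_mul_le_mul_left ?_ (by positivity : 0 < 4 / L * spacing L (n + 1))
      calc _ = 4 / L * spacing L (n + 1) * (((p - q) μ).valMinAbs.natAbs : ℝ) *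
            ‖hat (mulF L f n) p q‖ := by ring
        _ ≤ _ := h6
        _ = _ := by field_simp
    rw [List.map_cons, List.prod_cons]
    set R := (s.map fun μ => 1 + (((p - q) μ).valMinAbs.natAbs : ℝ)).prod with hR
    have hR0 : 0 ≤ R := List.prod_nonneg (by
      intro x hx
      obtain ⟨ν, -, rfl⟩ := List.mem_map.1 hx
      positivity)
    calc _ = ‖hat (mulF L f n) p q‖ * R +
          ((((p - q) μ).valMinAbs.natAbs : ℝ) * ‖hat (mulF L f n) p q‖) * R := by ring
      _ ≤ ‖hat (mulF L f n) p q‖ * R + (L / 4 * ‖hat (mulF L g n) p q‖) * R := by gcongr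
      _ = ‖hat (mulF L f n) p q‖ * R + L / 4 * (‖hat (mulF L g n) p q‖ * R) := by ring
      _ ≤ C₁ + L / 4 * C₂ := by
          gcongr
          · exact b₁ n p q
          · exact b₂ n p q

theorem isOfOrder_mulF (hL : 0 < L) (hf : Good L f) : IsOfOrder 1 (mulF L f) := by
  intro J
  obtain ⟨C, hC, b⟩ := exists_mulF_decay hL ((List.replicate J (List.finRange d)).flatten) hf
  refine ⟨C, hC, fun n p q => ?_⟩
  have h := b n p q
  rw [List.map_flatten, List.prod_flatten, List.map_replicate, List.map_replicate,
    List.prod_replicate, ← List.ofFn_eq_map, List.prod_ofFn] at h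
  simpa [bracket] using h

/-- The entry at `(p, q)` is the difference of the symbol at `p` and `q` times the Fourier
coefficient of `f`. Slow variation supplies `1 / lam`, and the rapid decay of the coefficient
absorbs `bracket (p - q) ^ j`. All gains of order in the proof that come from reordering rest on
this. -/
theorem IsMultiplier.commutator (h : IsMultiplier L w K) (hL : 0 < L) (hw : Tempered w)
    (hf : Good L f) : IsOfOrder (w / lam d L) (K * mulF L f - mulF L f * K) := by
  intro J
  obtain ⟨D, j, hD, s⟩ := h.slow
  obtain ⟨C, hC, b⟩ := isOfOrder_mulF hL hf (J + j)
  refine ⟨D * C, by positivity, fun n p q => ?_⟩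
  have hp := hw.pos n p
  have hl := zero_lt_one.trans_le (one_le_lam hL n p)
  have hb := bracket_pos (p - q)
  have e : hat ((K * mulF L f - mulF L f * K) n) p q =
      (multiplierSymbol K n p - multiplierSymbol K n q) * hat (mulF L f n) p q := by
    simp only [Pi.sub_apply, Pi.mul_apply, hat_sub, hat_mul, h.diag, Matrix.sub_apply,
      Matrix.diagonal_mul, Matrix.mul_diagonal]
    ring
  have hbn := b n p q
  rw [Pi.one_apply, Pi.one_apply, mul_one] at hbn
  rw [e, norm_mul]
  calc _ ≤ (D * bracket (p - q) ^ j * (w n p / lam d L n p)) * ‖hat (mulF L f n) p q‖ *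
        bracket (p - q) ^ J := by
        gcongr
        exact s n p q
    _ = D * (w n p / lam d L n p) * (‖hat (mulF L f n) p q‖ * bracket (p - q) ^ (J + j)) := by
        rw [pow_add]
        ring
    _ ≤ D * (w n p / lam d L n p) * C := by gcongr
    _ = _ := by
        simp only [Pi.div_apply]
        ring

end mulF

end WilsonFermion

/-! ### Inverses of elliptic operators. -/

namespace WilsonFermion

open scoped ComplexOrder

variable {d : ℕ} {L : ℝ} {w w₁ w₂ w₃ v : Weight d} {K K₁ K₂ : Fam d}

theorem isUnit_det_of_posSemidef_sub {ι : Type*} [Fintype ι] [DecidableEq ι] {M : ℝ} (hM : 0 < M)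
    {K : Matrix ι ι ℂ} (h : (K - (M : ℂ) • 1).PosSemidef) : IsUnit K.det := by
  have h1 : ((M : ℂ) • (1 : Matrix ι ι ℂ)).PosDef :=
    Matrix.PosDef.one.smul (by exact_mod_cast hM)
  have h2 := h1.add_posSemidef h
  rw [add_sub_cancel] at h2
  exact (Matrix.isUnit_iff_isUnit_det K).1 h2.isUnit

/-- Positivity of `(K⁻¹)ᴴ * (K - M) * K⁻¹` on the diagonal gives `M ∑ t, ‖K⁻¹ t s‖ ^ 2 ≤ Re (K⁻¹ s
s)`. This first bounds the diagonal entry by `1 / M`, and then every entry of the column. -/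
theorem norm_inv_apply_le {ι : Type*} [Fintype ι] [DecidableEq ι] {M : ℝ} (hM : 0 < M)
    {K : Matrix ι ι ℂ} (h : (K - (M : ℂ) • 1).PosSemidef) (r s : ι) : ‖K⁻¹ r s‖ ≤ M⁻¹ := by
  have hu := isUnit_det_of_posSemidef_sub hM h
  have h1 := (h.conjTranspose_mul_mul_same K⁻¹).diag_nonneg (i := s)
  have e : (K⁻¹)ᴴ * (K - (M : ℂ) • 1) * K⁻¹ = (K⁻¹)ᴴ - (M : ℂ) • ((K⁻¹)ᴴ * K⁻¹) := by
    rw [Matrix.mul_sub, Matrix.sub_mul, Matrix.mul_assoc, Matrix.mul_nonsing_inv _ hu]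
    simp
  rw [e] at h1
  have h2 := (Complex.nonneg_iff.1 h1).1
  have h3 : ∀ t, (star (K⁻¹ t s) * K⁻¹ t s).re = ‖K⁻¹ t s‖ ^ 2 := by
    intro t
    rw [Complex.star_def, ← Complex.normSq_eq_conj_mul_self, Complex.ofReal_re,
      Complex.normSq_eq_norm_sq]
  simp only [Matrix.sub_apply, Matrix.smul_apply, Matrix.conjTranspose_apply, Matrix.mul_apply,
    Complex.sub_re, smul_eq_mul, Complex.re_ofReal_mul, Complex.re_sum, h3] at h2
  have h4 : ∀ t, ‖K⁻¹ t s‖ ^ 2 ≤ ∑ t, ‖K⁻¹ t s‖ ^ 2 := fun t =>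
    Finset.single_le_sum (f := fun t => ‖K⁻¹ t s‖ ^ 2) (fun _ _ => by positivity) (Finset.mem_univ t)
  have h5 : (star (K⁻¹ s s)).re ≤ ‖K⁻¹ s s‖ := by
    rw [← norm_star]
    exact Complex.re_le_norm _
  have h6 : ‖K⁻¹ s s‖ ≤ M⁻¹ := by
    have : M * ‖K⁻¹ s s‖ ^ 2 ≤ ‖K⁻¹ s s‖ := by nlinarith [mul_le_mul_of_nonneg_left (h4 s) hM.le]
    rcases (norm_nonneg (K⁻¹ s s)).eq_or_lt with h0 | h0
    · rw [← h0]
      positivity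
    · rw [← one_div M, le_div_iff₀ hM]
      nlinarith
  have h7 : M * ‖K⁻¹ r s‖ ^ 2 ≤ M⁻¹ := by nlinarith [mul_le_mul_of_nonneg_left (h4 r) hM.le]
  refine (pow_le_pow_iff_left₀ (norm_nonneg _) (by positivity) two_ne_zero).1 ?_
  calc ‖K⁻¹ r s‖ ^ 2 = M⁻¹ * (M * ‖K⁻¹ r s‖ ^ 2) := by field_simp
    _ ≤ M⁻¹ * M⁻¹ := by gcongr
    _ = _ := by ring

theorem IsOfOrder.sum_norm_le (h : IsOfOrder w K) (hw : ∀ n p, 0 ≤ w n p) :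
    ∃ C, 0 ≤ C ∧ ∀ n p, ∑ q, ‖hat (K n) p q‖ ≤ C * w n p := by
  obtain ⟨C, hC, b⟩ := h 2
  obtain ⟨S, hS, hsum⟩ := exists_sum_bracket_le d
  refine ⟨C * S, by positivity, fun n p => ?_⟩
  have h1 : ∀ q, ‖hat (K n) p q‖ ≤ C * w n p * (bracket (p - q) ^ 2)⁻¹ := by
    intro q
    have hb := bracket_pos (p - q)
    rw [← div_eq_mul_inv, le_div_iff₀ (by positivity)]
    exact b n p q
  have hp := hw n p
  calc _ ≤ ∑ q, C * w n p * (bracket (p - q) ^ 2)⁻¹ := Finset.sum_le_sum fun q _ => h1 q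
    _ = C * w n p * ∑ k : Site d (n + 1), (bracket k ^ 2)⁻¹ := by
        rw [← Finset.mul_sum]
        congr 1
        exact Fintype.sum_equiv (Equiv.subLeft p) _ _ fun r => rfl
    _ ≤ C * w n p * S := mul_le_mul_of_nonneg_left (hsum n) (by positivity)
    _ = _ := by ring

theorem IsOfOrder.pow (h : IsOfOrder w K) (hw : Tempered w) (J : ℕ) : IsOfOrder (w ^ J) (K ^ J) := by
  induction J with
  | zero =>
    rw [pow_zero, pow_zero]
    intro J
    refine ⟨1, zero_le_one, fun n p q => ?_⟩
    rw [Pi.one_apply, hat_one]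
    by_cases hpq : p = q
    · subst hpq
      simp [bracket]
    · simp [Matrix.one_apply_ne hpq]
  | succ J ih =>
    rw [pow_succ, pow_succ]
    exact ih.mul h (fun n p => ((hw.pow J).pos n p).le) hw

/-- A product with an operator of bounded entries in the middle, and two regularizing factors. -/
theorem exists_sandwich_bound (hL : 0 < L) {G B B' : Fam d} {b : ℝ} (hb0 : 0 ≤ b)
    (hG : ∀ n p q, ‖hat (G n) p q‖ ≤ b) (hB : IsOfOrder (lam d L)⁻¹ B)
    (hB' : IsOfOrder (lam d L)⁻¹ B') (s J : ℕ) :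
    ∃ C, 0 ≤ C ∧ ∀ n p q, ‖hat ((B ^ (d * J + s) * G * B' ^ (d * J + s)) n) p q‖ *
      bracket (p - q) ^ J ≤ C * ((lam d L)⁻¹ ^ s) n p := by
  have hl := (tempered_lam (d := d) hL)
  have hlj := hl.inv.pow (d * J + s)
  obtain ⟨C₁, hC₁, b₁⟩ := (hB.pow hl.inv (d * J + s)).sum_norm_le fun n p => (hlj.pos n p).le
  obtain ⟨C₂, hC₂, b₂⟩ := ((hB'.pow hl.inv (d * J + s)).conjTranspose hlj).sum_norm_le
    fun n p => (hlj.pos n p).le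
  set c := L / 4 + Real.pi / 4 + 1 with hc
  have hcpos : 0 < c := by
    have := Real.pi_pos
    positivity
  refine ⟨C₁ * b * C₂ * (c ^ d) ^ J * (c ^ d) ^ J, by positivity, fun n p q => ?_⟩
  have hp := one_le_lam hL n p
  have hq := one_le_lam hL n q
  have hp0 := zero_lt_one.trans_le hp
  have hq0 := zero_lt_one.trans_le hq
  have e1 : ‖hat ((B ^ (d * J + s) * G * B' ^ (d * J + s)) n) p q‖ ≤
      (∑ r, ‖hat ((B ^ (d * J + s)) n) p r‖) * b * ∑ t, ‖hat ((B' ^ (d * J + s)) n) t q‖ := by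
    rw [Pi.mul_apply, Pi.mul_apply, hat_mul, hat_mul, Matrix.mul_apply, Finset.mul_sum]
    refine (norm_sum_le _ _).trans (Finset.sum_le_sum fun t _ => ?_)
    rw [norm_mul]
    refine mul_le_mul_of_nonneg_right ?_ (norm_nonneg _)
    rw [Matrix.mul_apply, Finset.sum_mul]
    refine (norm_sum_le _ _).trans (Finset.sum_le_sum fun r _ => ?_)
    rw [norm_mul]
    exact mul_le_mul_of_nonneg_left (hG n r t) (norm_nonneg _)
  have e2 : ∑ t, ‖hat ((B' ^ (d * J + s)) n) t q‖ ≤ C₂ * ((lam d L)⁻¹ ^ (d * J + s)) n q := by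
    refine le_trans (le_of_eq ?_) (b₂ n q)
    refine Finset.sum_congr rfl fun t _ => ?_
    rw [hat_conjTranspose, Matrix.conjTranspose_apply, norm_star]
  -- Splitting through momentum `0` lets the regularizing factors at `p` and at `q` absorb the
  -- distance. One power of `bracket` needs `d` powers of `lam` on each side, whence the exponent `d
  -- * J + s`.
  have e3 : bracket (p - q) ≤ c ^ d * lam d L n p ^ d * (c ^ d * lam d L n q ^ d) := by
    have h1 := bracket_sub_le p q 0
    rw [sub_zero, zero_sub, bracket_neg] at h1
    refine h1.trans ?_
    rw [← mul_pow, ← mul_pow]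
    exact mul_le_mul (bracket_le_lam_pow hL n p) (bracket_le_lam_pow hL n q) (bracket_pos q).le
      (by positivity)
  have e4 : (lam d L n q)⁻¹ ^ (d * J + s) * (lam d L n q ^ d) ^ J ≤ 1 := by
    have h0 := inv_le_one_of_one_le₀ hq
    have h1 : (lam d L n q)⁻¹ ^ (d * J + s) * (lam d L n q ^ d) ^ J = (lam d L n q)⁻¹ ^ s := by
      rw [pow_add, ← pow_mul, inv_pow, inv_pow]
      field_simp
    rw [h1]
    exact pow_le_one₀ (by positivity) h0
  calc _ ≤ ((C₁ * ((lam d L)⁻¹ ^ (d * J + s)) n p) * b * (C₂ * ((lam d L)⁻¹ ^ (d * J + s)) n q)) *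
        (c ^ d * lam d L n p ^ d * (c ^ d * lam d L n q ^ d)) ^ J := by
        have hbr := (bracket_pos (p - q)).le
        have hw1 := (hlj.pos n p).le
        have hw2 := (hlj.pos n q).le
        refine mul_le_mul (e1.trans (mul_le_mul (mul_le_mul_of_nonneg_right (b₁ n p) hb0) e2
          (Finset.sum_nonneg fun _ _ => norm_nonneg _) (by positivity))) ?_ (by positivity)
          (by positivity)
        exact pow_le_pow_left₀ hbr e3 J
    _ = C₁ * b * C₂ * (c ^ d) ^ J * (c ^ d) ^ J *
          ((lam d L n p)⁻¹ ^ (d * J + s) * (lam d L n p ^ d) ^ J) *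
          ((lam d L n q)⁻¹ ^ (d * J + s) * (lam d L n q ^ d) ^ J) := by
        simp only [Pi.pow_apply, Pi.inv_apply, mul_pow]
        ring
    _ ≤ C₁ * b * C₂ * (c ^ d) ^ J * (c ^ d) ^ J *
          ((lam d L n p)⁻¹ ^ (d * J + s) * (lam d L n p ^ d) ^ J) * 1 := by gcongr
    _ = _ := by
        simp only [mul_one, pow_add, ← pow_mul, inv_pow, Pi.inv_apply, Pi.pow_apply]
        field_simp

/-- The inverse of an operator that is bounded below, close to an elliptic translation invariant
operator. -/
theorem isOfOrder_inv_sub_inv (hL : 0 < L) {M : ℝ} (hM : 0 < M) (hw : Tempered w) {K₀ : Fam d}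
    (hK₀ : IsMultiplier L w K₀) {c : ℝ} (hc : 0 < c)
    (hlow : ∀ n p, c * w n p ≤ ‖multiplierSymbol K₀ n p‖)
    (hK : ∀ n, (K n - (M : ℂ) • 1).PosSemidef) (hsub : IsOfOrder (w / lam d L) (K - K₀))
    {s : ℕ} (hs : Dominated ((lam d L)⁻¹ ^ s) (w⁻¹ / lam d L)) :
    IsOfOrder (w⁻¹ / lam d L) (K⁻¹ - K₀⁻¹) := by
  have hl := (tempered_lam (d := d) hL)
  have hG₀ := (hK₀.inv hL hw hc hlow).isOfOrder
  have hK₀G₀ : K₀ * K₀⁻¹ = 1 := hK₀.mul_inv_cancel hw hc hlow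
  have hG₀K₀ : K₀⁻¹ * K₀ = 1 := ((hK₀.inv hL hw hc hlow).commute hK₀).eq.trans hK₀G₀
  have hKG : K * K⁻¹ = 1 := by
    funext n
    exact Matrix.mul_nonsing_inv _ (isUnit_det_of_posSemidef_sub hM (hK n))
  have hGK : K⁻¹ * K = 1 := by
    funext n
    exact Matrix.nonsing_inv_mul _ (isUnit_det_of_posSemidef_sub hM (hK n))
  have hGb : ∀ n p q, ‖hat (K⁻¹ n) p q‖ ≤ M⁻¹ := by
    intro n p q
    rw [Pi.inv_apply, hat_inv]
    refine norm_inv_apply_le hM ?_ p q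
    have := (hK n).conjTranspose_mul_mul_same (fourier d (n + 1))
    have e : (fourier d (n + 1))ᴴ * (K n - (M : ℂ) • 1) * fourier d (n + 1) =
        hat (K n) - (M : ℂ) • 1 := by
      have h0 := hat_sub (K n) ((M : ℂ) • 1)
      rwa [hat_smul, hat_one] at h0
    rwa [e] at this
  -- Both corrections have order `1 / lam`, and they satisfy the resolvent identities `K⁻¹ = K₀⁻¹ +
  -- B K⁻¹ = K₀⁻¹ + K⁻¹ B'`.
  obtain ⟨B, hB⟩ : ∃ B, B = -(K₀⁻¹ * (K - K₀)) := ⟨_, rfl⟩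
  obtain ⟨B', hB'⟩ : ∃ B', B' = -((K - K₀) * K₀⁻¹) := ⟨_, rfl⟩
  have hBo : IsOfOrder (lam d L)⁻¹ B := by
    rw [hB]
    refine ((hG₀.mul hsub (fun n p => (hw.inv.pos n p).le) (hw.div hl)).congr_mul ?_).neg
    funext n p
    have := (hw.pos n p).ne'
    simp only [Pi.mul_apply, Pi.inv_apply, Pi.div_apply]
    field_simp
  have hBo' : IsOfOrder (lam d L)⁻¹ B' := by
    rw [hB']
    refine ((hsub.mul hG₀ (fun n p => ((hw.div hl).pos n p).le) hw.inv).congr_mul ?_).neg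
    funext n p
    have := (hw.pos n p).ne'
    simp only [Pi.mul_apply, Pi.inv_apply, Pi.div_apply]
    field_simp
  have r1 : K⁻¹ = K₀⁻¹ + B * K⁻¹ := by
    have : B * K⁻¹ = -(K₀⁻¹ * (K * K⁻¹)) + K₀⁻¹ * K₀ * K⁻¹ := by
      rw [hB]
      noncomm_ring
    rw [this, hKG, hG₀K₀]
    noncomm_ring
  have r2 : K⁻¹ = K₀⁻¹ + K⁻¹ * B' := by
    have : K⁻¹ * B' = -(K⁻¹ * K * K₀⁻¹) + K⁻¹ * (K₀ * K₀⁻¹) := by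
      rw [hB']
      noncomm_ring
    rw [this, hGK, hK₀G₀]
    noncomm_ring
  have hwl := hw.inv.div hl
  -- The resolvent identities are iterated on the left and on the right. Every term but the last
  -- contains only free inverses and at least one correction, so it has the claimed order.
  have expand : ∀ J, 1 ≤ J → (∃ E, IsOfOrder (w⁻¹ / lam d L) E ∧ K⁻¹ - K₀⁻¹ = E + B ^ J * K⁻¹) ∧
      (∃ E, IsOfOrder (w⁻¹ / lam d L) E ∧ K⁻¹ - K₀⁻¹ = E + K⁻¹ * B' ^ J) := by
    intro J hJ
    have hone : Dominated ((lam d L)⁻¹ ^ J) (lam d L)⁻¹ := by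
      refine ⟨1, zero_le_one, fun n p => ?_⟩
      rw [one_mul]
      exact pow_le_of_le_one (inv_nonneg.2 (zero_le_one.trans (one_le_lam hL n p)))
        (inv_le_one_of_one_le₀ (one_le_lam hL n p)) (by omega)
    induction J, hJ using Nat.le_induction with
    | base =>
      refine ⟨⟨0, IsOfOrder.zero fun n p => (hwl.pos n p).le, ?_⟩,
        ⟨0, IsOfOrder.zero fun n p => (hwl.pos n p).le, ?_⟩⟩
      · rw [pow_one, zero_add]
        exact sub_eq_of_eq_add' r1
      · rw [pow_one, zero_add]
        exact sub_eq_of_eq_add' r2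
    | succ J hJ ih =>
      have hone' : Dominated ((lam d L)⁻¹ ^ J) (lam d L)⁻¹ := by
        refine ⟨1, zero_le_one, fun n p => ?_⟩
        rw [one_mul]
        exact pow_le_of_le_one (inv_nonneg.2 (zero_le_one.trans (one_le_lam hL n p)))
          (inv_le_one_of_one_le₀ (one_le_lam hL n p)) (by omega)
      obtain ⟨⟨E, hE, h1⟩, ⟨E', hE', h2⟩⟩ := ih hone'
      refine ⟨⟨E + B ^ J * K₀⁻¹, hE.add ?_, ?_⟩, ⟨E' + K₀⁻¹ * B' ^ J, hE'.add ?_, ?_⟩⟩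
      · refine (((hBo.pow hl.inv J).mono hone').mul hG₀ (fun n p => (hl.inv.pos n p).le)
          hw.inv).congr_mul ?_
        rw [div_eq_mul_inv, mul_comm]
      · rw [h1, pow_succ, add_assoc]
        congr 1
        calc B ^ J * K⁻¹ = B ^ J * (K₀⁻¹ + B * K⁻¹) := by rw [← r1]
          _ = _ := by noncomm_ring
      · refine (hG₀.mul ((hBo'.pow hl.inv J).mono hone') (fun n p => (hw.inv.pos n p).le)
          hl.inv).congr_mul ?_
        rw [div_eq_mul_inv]
      · rw [h2, pow_succ', add_assoc]
        congr 1
        calc K⁻¹ * B' ^ J = (K₀⁻¹ + K⁻¹ * B') * B' ^ J := by rw [← r2]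
          _ = _ := by noncomm_ring
  intro J
  -- Taking `s + 1` instead of `s` keeps the number of iterations positive even if `d * J + s = 0`.
  obtain ⟨C, hC, hb⟩ := exists_sandwich_bound hL (inv_nonneg.2 hM.le) hGb hBo hBo' (s + 1) J
  obtain ⟨⟨E, hE, h1⟩, ⟨E', hE', h2⟩⟩ := expand (d * J + (s + 1)) (by omega)
  set j := d * J + (s + 1) with hj
  have hBj : IsOfOrder (lam d L)⁻¹ (B ^ j) := by
    refine (hBo.pow hl.inv j).mono ⟨1, zero_le_one, fun n p => ?_⟩
    rw [one_mul]
    exact pow_le_of_le_one (inv_nonneg.2 (zero_le_one.trans (one_le_lam hL n p)))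
      (inv_le_one_of_one_le₀ (one_le_lam hL n p)) (by omega)
  -- The right expansion is inserted into the left one. The full inverse survives only in `B ^ j *
  -- K⁻¹ * B' ^ j`, where a bound on its entries is enough: the outer factors supply both the order
  -- and the off-diagonal decay.
  have e : K⁻¹ - K₀⁻¹ = (E + B ^ j * K₀⁻¹ + B ^ j * E') + B ^ j * K⁻¹ * B' ^ j := by
    rw [h1, add_assoc, add_assoc]
    congr 1
    have h3 : K⁻¹ = K₀⁻¹ + (E' + K⁻¹ * B' ^ j) := by rw [← h2, add_sub_cancel]
    calc B ^ j * K⁻¹ = B ^ j * (K₀⁻¹ + (E' + K⁻¹ * B' ^ j)) := by rw [← h3]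
      _ = _ := by noncomm_ring
  have hrest : IsOfOrder (w⁻¹ / lam d L) (E + B ^ j * K₀⁻¹ + B ^ j * E') := by
    refine (hE.add ?_).add ?_
    · refine (hBj.mul hG₀ (fun n p => (hl.inv.pos n p).le) hw.inv).congr_mul ?_
      rw [div_eq_mul_inv, mul_comm]
    · refine (hBj.mul hE' (fun n p => (hl.inv.pos n p).le) hwl).mono ⟨1, zero_le_one, fun n p => ?_⟩
      rw [one_mul]
      exact mul_le_of_le_one_left (hwl.pos n p).le (inv_le_one_of_one_le₀ (one_le_lam hL n p))
  obtain ⟨C', hC', hb'⟩ := hrest J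
  obtain ⟨D, hD, hd⟩ := hs
  refine ⟨C' + C * D, by positivity, fun n p q => ?_⟩
  have hbr := (pow_pos (bracket_pos (p - q)) J).le
  rw [e, Pi.add_apply, hat_add, Matrix.add_apply]
  have hsp : ((lam d L)⁻¹ ^ (s + 1)) n p ≤ D * (w⁻¹ / lam d L) n p := by
    refine le_trans ?_ (hd n p)
    rw [pow_succ]
    exact mul_le_of_le_one_right ((hl.inv.pow s).pos n p).le
      (inv_le_one_of_one_le₀ (one_le_lam hL n p))
  calc _ ≤ (‖hat ((E + B ^ j * K₀⁻¹ + B ^ j * E') n) p q‖ +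
        ‖hat ((B ^ j * K⁻¹ * B' ^ j) n) p q‖) * bracket (p - q) ^ J :=
        mul_le_mul_of_nonneg_right (norm_add_le _ _) hbr
    _ ≤ C' * (w⁻¹ / lam d L) n p + C * (D * (w⁻¹ / lam d L) n p) := by
        rw [add_mul]
        exact add_le_add (hb' n p q) ((hb n p q).trans (mul_le_mul_of_nonneg_left hsp hC))
    _ = _ := by ring

end WilsonFermion

/-! ### Normal products as leading symbols. -/

namespace WilsonFermion

variable {d : ℕ} {L : ℝ} {w w₁ w₂ w₃ v : Weight d} {K K₁ K₂ : Fam d}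

/-- Families of formal expressions. -/
abbrev SymbFam (d : ℕ) : Type := ∀ n : ℕ, Symb d (n + 1)

/-- The formal multiplication operator given by a function of the lattice spacing and of the
position. -/
def symbF (L : ℝ) (f : ℝ × (Fin d → ℝ) → ℂ) : SymbFam d :=
  fun n => symbMul L fun x => f (spacing L (n + 1), x)

/-- The formal expression of a family of free operators. -/
def freeF (K : Fam d) : SymbFam d := fun n => symbFree (K n)

/-- The normal product of a family of formal expressions. -/
def quant (S : SymbFam d) : Fam d := fun n => normalProduct (S n)

theorem quant_add (S S' : SymbFam d) : quant (S + S') = quant S + quant S' := by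
  funext n
  ext x y
  rfl

theorem quant_symbF_mul (f : ℝ × (Fin d → ℝ) → ℂ) (K : Fam d) :
    quant (symbF L f * freeF K) = mulF L f * K := by
  funext n
  ext x y
  simp [quant, normalProduct, symbF, freeF, symbMul, symbFree, mulF, mulOp, Matrix.diagonal_mul]

theorem symbF_commute (f : ℝ × (Fin d → ℝ) → ℂ) (S : SymbFam d) : Commute (symbF L f) S := by
  funext n x
  simp [symbF, symbMul]

theorem symbF_mul (f g : ℝ × (Fin d → ℝ) → ℂ) : symbF L (f * g) = symbF L f * symbF L g := by
  funext n x
  simp [symbF, symbMul, smul_smul, mul_comm]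

theorem freeF_mul (K K' : Fam d) : freeF (K * K') = freeF K * freeF K' := rfl

/-- Formal expressions whose free operators are bounded by `w`. -/
inductive IsSymbol (L : ℝ) (w : Weight d) : SymbFam d → Prop
  | term {f : ℝ × (Fin d → ℝ) → ℂ} {K : Fam d} (hf : Good L f) (hK : IsMultiplier L w K) :
      IsSymbol L w (symbF L f * freeF K)
  | add {S S' : SymbFam d} (h : IsSymbol L w S) (h' : IsSymbol L w S') : IsSymbol L w (S + S')

namespace IsSymbol

variable {S S₁ S₂ : SymbFam d}

theorem mono (h : IsSymbol L w S) (hL : 0 < L) (hw : Dominated w v) : IsSymbol L v S := by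
  induction h with
  | term hf hK => exact term hf (hK.mono hL hw)
  | add _ _ h h' => exact h.add h'

theorem smul {c : ℕ → ℂ} {C : ℝ} (h : IsSymbol L w S) (hL : 0 < L) (hC : 0 ≤ C)
    (hc : ∀ n p, ‖c n‖ * w n p ≤ C * v n p) : IsSymbol L v (fun n => c n • S n) := by
  induction h with
  | @term f K hf hK =>
    have e : (fun n => c n • (symbF L f * freeF K) n) =
        symbF L f * freeF (fun n => c n • K n) := by
      funext n x
      simp [freeF, symbFree]
    rw [e]
    exact term hf (hK.smul hL hC hc)
  | @add S S' _ _ h h' =>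
    have e : (fun n => c n • (S + S') n) = (fun n => c n • S n) + fun n => c n • S' n := by
      funext n
      simp
    rw [e]
    exact h.add h'

theorem isOfOrder (h : IsSymbol L w S) (hL : 0 < L) (hw : Tempered w) : IsOfOrder w (quant S) := by
  induction h with
  | term hf hK =>
    rw [quant_symbF_mul]
    exact ((isOfOrder_mulF hL hf).mul hK.isOfOrder (fun _ _ => zero_le_one) hw).congr_mul
      (one_mul w)
  | add _ _ h h' =>
    rw [quant_add]
    exact h.add h'

theorem mul (h₁ : IsSymbol L w₁ S₁) (h₂ : IsSymbol L w₂ S₂) (hL : 0 < L) (hw₁ : Tempered w₁)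
    (hw₂ : Tempered w₂) : IsSymbol L (w₁ * w₂) (S₁ * S₂) := by
  induction h₁ with
  | @term f K hf hK =>
    induction h₂ with
    | @term f' K' hf' hK' =>
      have e : symbF L f * freeF K * (symbF L f' * freeF K') =
          symbF L (f * f') * freeF (K * K') := by
        rw [symbF_mul, freeF_mul, mul_assoc, mul_assoc, ← mul_assoc (freeF K),
          ← (symbF_commute f' (freeF K)).eq, mul_assoc]
      rw [e]
      exact term (hf.mul hf') (hK.mul hK' hL hw₁ hw₂)
    | add _ _ h h' =>
      rw [mul_add]
      exact h.add h'
  | add _ _ h h' =>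
    rw [add_mul]
    exact h.add h'

/-- For single terms the defect of normal ordering is `f [K, f'] K'`, so the commutator provides the
gain. -/
theorem quant_mul_sub (h₁ : IsSymbol L w₁ S₁) (h₂ : IsSymbol L w₂ S₂) (hL : 0 < L)
    (hw₁ : Tempered w₁) (hw₂ : Tempered w₂) :
    IsOfOrder (w₁ * w₂ / lam d L) (quant S₁ * quant S₂ - quant (S₁ * S₂)) := by
  have hl := tempered_lam (d := d) hL
  induction h₁ with
  | @term f K hf hK =>
    induction h₂ with
    | @term f' K' hf' hK' =>
      have e : symbF L f * freeF K * (symbF L f' * freeF K') =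
          symbF L (f * f') * freeF (K * K') := by
        rw [symbF_mul, freeF_mul, mul_assoc, mul_assoc, ← mul_assoc (freeF K),
          ← (symbF_commute f' (freeF K)).eq, mul_assoc]
      have e' : mulF L f * K * (mulF L f' * K') - mulF L f * mulF L f' * (K * K') =
          mulF L f * (K * mulF L f' - mulF L f' * K) * K' := by noncomm_ring
      rw [e, quant_symbF_mul, quant_symbF_mul, quant_symbF_mul, mulF_mul, e']
      refine (((isOfOrder_mulF hL hf).mul (hK.commutator hL hw₁ hf') (fun _ _ => zero_le_one)
        (hw₁.div hl)).mul hK'.isOfOrder (fun n p => ?_) hw₂).congr_mul ?_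
      · exact ((Tempered.one.mul (hw₁.div hl)).pos n p).le
      · rw [one_mul, div_mul_eq_mul_div]
    | @add S S' h h' ih ih' =>
      rw [mul_add, quant_add, quant_add, mul_add, add_sub_add_comm]
      exact ih.add ih'
  | @add S S' h h' ih ih' =>
    rw [add_mul, quant_add, quant_add, add_mul, add_sub_add_comm]
    exact ih.add ih'

end IsSymbol

/-- `K` agrees with the normal product of `S`, up to terms that gain a power of the momentum. -/
structure Quantizes (L : ℝ) (w : Weight d) (K : Fam d) (S : SymbFam d) : Prop where
  tempered : Tempered w
  symbol : IsSymbol L w S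
  remainder : IsOfOrder (w / lam d L) (K - quant S)

namespace Quantizes

variable {S S₁ S₂ : SymbFam d}

theorem isOfOrder (h : Quantizes L w K S) (hL : 0 < L) : IsOfOrder w K := by
  have := (h.remainder.mono (dominated_div_lam hL h.tempered)).add
    (h.symbol.isOfOrder hL h.tempered)
  rwa [sub_add_cancel] at this

theorem mono (h : Quantizes L w K S) (hL : 0 < L) (hv : Tempered v) (hw : Dominated w v) :
    Quantizes L v K S :=
  ⟨hv, h.symbol.mono hL hw, h.remainder.mono (hw.div_lam hL)⟩

theorem perturb {K' : Fam d} (h : Quantizes L w K S) (hK : IsOfOrder (w / lam d L) (K' - K)) :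
    Quantizes L w K' S := by
  refine ⟨h.tempered, h.symbol, ?_⟩
  have := hK.add h.remainder
  rwa [sub_add_sub_cancel] at this

theorem add (h₁ : Quantizes L w K₁ S₁) (h₂ : Quantizes L w K₂ S₂) :
    Quantizes L w (K₁ + K₂) (S₁ + S₂) := by
  refine ⟨h₁.tempered, h₁.symbol.add h₂.symbol, ?_⟩
  rw [quant_add, add_sub_add_comm]
  exact h₁.remainder.add h₂.remainder

theorem smul {c : ℕ → ℂ} {C : ℝ} (h : Quantizes L w K S) (hL : 0 < L) (hv : Tempered v)
    (hC : 0 ≤ C) (hc : ∀ n p, ‖c n‖ * w n p ≤ C * v n p) :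
    Quantizes L v (fun n => c n • K n) (fun n => c n • S n) := by
  refine ⟨hv, h.symbol.smul hL hC hc, ?_⟩
  have e : (fun n => c n • K n) - quant (fun n => c n • S n) = fun n => c n • (K - quant S) n := by
    funext n
    ext x y
    simp [quant, normalProduct, mul_sub]
  rw [e]
  refine h.remainder.smul hC fun n p => ?_
  have hl := zero_le_one.trans (one_le_lam hL n p)
  simp only [Pi.div_apply]
  rw [← mul_div_assoc, ← mul_div_assoc]
  exact div_le_div_of_nonneg_right (hc n p) hl

theorem const_smul (h : Quantizes L w K S) (hL : 0 < L) (c : ℂ) :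
    Quantizes L w (fun n => c • K n) (fun n => c • S n) :=
  h.smul hL h.tempered (norm_nonneg c) fun _ _ => le_rfl

theorem neg (h : Quantizes L w K S) (hL : 0 < L) : Quantizes L w (-K) (-S) := by
  have h1 : -K = fun n => (-1 : ℂ) • K n := by
    funext n
    simp
  have h2 : -S = fun n => (-1 : ℂ) • S n := by
    funext n
    simp
  rw [h1, h2]
  exact h.const_smul hL _

theorem sub (h₁ : Quantizes L w K₁ S₁) (h₂ : Quantizes L w K₂ S₂) (hL : 0 < L) :
    Quantizes L w (K₁ - K₂) (S₁ - S₂) := by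
  rw [sub_eq_add_neg, sub_eq_add_neg]
  exact h₁.add (h₂.neg hL)

/-- The difference telescopes into one remainder times `K₂`, the leading part of `K₁` times the
other remainder, and the defect of normal ordering; each gains one power of `lam`. -/
theorem mul (h₁ : Quantizes L w₁ K₁ S₁) (h₂ : Quantizes L w₂ K₂ S₂) (hL : 0 < L) :
    Quantizes L (w₁ * w₂) (K₁ * K₂) (S₁ * S₂) := by
  have hl := tempered_lam (d := d) hL
  have t₁ := h₁.tempered
  have t₂ := h₂.tempered
  refine ⟨t₁.mul t₂, h₁.symbol.mul h₂.symbol hL t₁ t₂, ?_⟩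
  have e : K₁ * K₂ - quant (S₁ * S₂) = (K₁ - quant S₁) * K₂ + quant S₁ * (K₂ - quant S₂) +
      (quant S₁ * quant S₂ - quant (S₁ * S₂)) := by noncomm_ring
  rw [e]
  refine (IsOfOrder.add ?_ ?_).add (h₁.symbol.quant_mul_sub h₂.symbol hL t₁ t₂)
  · refine (h₁.remainder.mul (h₂.isOfOrder hL) (fun n p => ((t₁.div hl).pos n p).le)
      t₂).congr_mul ?_
    rw [div_mul_eq_mul_div]
  · refine ((h₁.symbol.isOfOrder hL t₁).mul h₂.remainder (fun n p => (t₁.pos n p).le)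
      (t₂.div hl)).congr_mul ?_
    rw [mul_div_assoc]

theorem of_isMultiplier (hK : IsMultiplier L w K) (hL : 0 < L) (hw : Tempered w) :
    Quantizes L w K (freeF K) := by
  have e : freeF K = symbF L (fun _ => 1) * freeF K := by
    funext n x
    simp [freeF, symbF, symbMul, symbFree]
  have e' : mulF L (fun _ : ℝ × (Fin d → ℝ) => (1 : ℂ)) = 1 := by
    funext n
    simp [mulF, mulOp]
  refine ⟨hw, ?_, ?_⟩
  · rw [e]
    exact IsSymbol.term (Good.const 1) hK
  · rw [e, quant_symbF_mul, e', one_mul, sub_self]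
    exact IsOfOrder.zero fun n p => ((hw.div (tempered_lam hL)).pos n p).le

theorem mulF_mul {f : ℝ × (Fin d → ℝ) → ℂ} (hf : Good L f) (hK : IsMultiplier L w K) (hL : 0 < L)
    (hw : Tempered w) : Quantizes L w (mulF L f * K) (symbF L f * freeF K) := by
  refine ⟨hw, IsSymbol.term hf hK, ?_⟩
  rw [quant_symbF_mul, sub_self]
  exact IsOfOrder.zero fun n p => ((hw.div (tempered_lam hL)).pos n p).le

theorem sum {ι : Type*} (s : Finset ι) {K : ι → Fam d} {S : ι → SymbFam d} (hL : 0 < L)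
    (hw : Tempered w) (h : ∀ i ∈ s, Quantizes L w (K i) (S i)) :
    Quantizes L w (∑ i ∈ s, K i) (∑ i ∈ s, S i) := by
  classical
  induction s using Finset.induction_on with
  | empty =>
    rw [Finset.sum_empty, Finset.sum_empty]
    exact of_isMultiplier IsMultiplier.zero hL hw
  | insert i s hi ih =>
    rw [Finset.sum_insert hi, Finset.sum_insert hi]
    exact (h i (Finset.mem_insert_self i s)).add
      (ih fun j hj => h j (Finset.mem_insert_of_mem hj))

theorem list_prod {m : ℕ} {K : Fin m → Fam d} {S : Fin m → SymbFam d} (hL : 0 < L)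
    (h : ∀ j, Quantizes L w (K j) (S j)) :
    Quantizes L (w ^ m) (List.ofFn K).prod (List.ofFn S).prod := by
  induction m with
  | zero =>
    rw [List.ofFn_zero, List.ofFn_zero, List.prod_nil, List.prod_nil, pow_zero]
    have := of_isMultiplier (IsMultiplier.one (d := d) (L := L)) hL Tempered.one
    exact this
  | succ m ih =>
    rw [List.ofFn_succ, List.ofFn_succ, List.prod_cons, List.prod_cons, pow_succ']
    exact (h 0).mul (ih fun j => h j.succ) hL

end Quantizes

end WilsonFermion

/-! ### Wilson operators: positivity and orders. -/

namespace WilsonFermion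

open scoped ComplexOrder

variable {d : ℕ} {L : ℝ} {w w₁ w₂ w₃ v : Weight d} {K K₁ K₂ : Fam d}

theorem opD_conjTranspose {N : ℕ} (a : ℝ) (T : Fin d → Op d N) (μ : Fin d) :
    (opD a T μ)ᴴ = -opD a T μ := by
  have h : star (1 / (2 * (a : ℂ))) = 1 / (2 * (a : ℂ)) := by simp
  rw [opD, Matrix.conjTranspose_smul, h, Matrix.conjTranspose_sub,
    Matrix.conjTranspose_conjTranspose, ← smul_neg, neg_sub]

section positivity

variable {N : ℕ} [NeZero N]

/-- For unitary translations `2 - T - Tᴴ = (1 - T)ᴴ (1 - T)`, so the Wilson term adds a nonnegative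
operator to `M`. -/
theorem posSemidef_opL_sub {M r a : ℝ} (hr : 0 < r) (ha : 0 < a) {T : Fin d → Op d N}
    (hT : ∀ μ, (T μ)ᴴ * T μ = 1) : (opL M r a T - (M : ℂ) • 1).PosSemidef := by
  have e : opL M r a T - (M : ℂ) • 1 =
      ((r / (2 * a) : ℝ) : ℂ) • ∑ μ, (1 - T μ)ᴴ * (1 - T μ) := by
    have h1 : ∀ μ, (1 - T μ)ᴴ * (1 - T μ) = (2 : ℂ) • (1 : Op d N) - T μ - (T μ)ᴴ := by
      intro μ
      rw [Matrix.conjTranspose_sub, Matrix.conjTranspose_one, Matrix.sub_mul, Matrix.mul_sub,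
        Matrix.mul_sub, hT]
      simp only [Matrix.one_mul, Matrix.mul_one]
      module
    simp only [h1, opL, opW]
    push_cast
    rw [smul_neg, sub_neg_eq_add, add_sub_cancel_left]
  rw [e]
  refine Matrix.PosSemidef.smul (Matrix.posSemidef_sum _ fun μ _ =>
    Matrix.posSemidef_conjTranspose_mul_self _) ?_
  exact_mod_cast (by positivity : 0 ≤ r / (2 * a))

/-- Since `D` is anti-hermitian, `-D L⁻¹ D = Dᴴ L⁻¹ D` is nonnegative. -/
theorem posSemidef_opC_sub {M r a : ℝ} (hM : 0 < M) (hr : 0 < r) (ha : 0 < a)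
    {T : Fin d → Op d N} (hT : ∀ μ, (T μ)ᴴ * T μ = 1) :
    (opC M r a T - (M : ℂ) • 1).PosSemidef := by
  have hL := posSemidef_opL_sub (M := M) hr ha hT
  have hLp : (opL M r a T).PosSemidef := by
    have h1 : ((M : ℂ) • (1 : Op d N)).PosSemidef :=
      Matrix.PosSemidef.one.smul (by exact_mod_cast hM.le)
    have h2 := h1.add hL
    rwa [add_sub_cancel] at h2
  have e : opC M r a T - (M : ℂ) • 1 = (opL M r a T - (M : ℂ) • 1) +
      ∑ μ, (opD a T μ)ᴴ * (opL M r a T)⁻¹ * opD a T μ := by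
    simp only [opD_conjTranspose, opC, Matrix.neg_mul, Finset.sum_neg_distrib]
    abel
  rw [e]
  exact hL.add (Matrix.posSemidef_sum _ fun μ _ => hLp.inv.conjTranspose_mul_mul_same _)

end positivity

/-- The covariant translations. -/
def covF (L Q : ℝ) (A : Fin d → (Fin d → ℝ) → ℝ) (μ : Fin d) : Fam d := fun _ => covShift L Q A μ

/-- The operators `D μ` built from a family of translations. -/
def famD (L : ℝ) (T : Fin d → Fam d) (μ : Fin d) : Fam d :=
  fun n => opD (spacing L (n + 1)) (fun ν => T ν n) μ

/-- The operators `E μ` built from a family of translations. -/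
def famE (T : Fin d → Fam d) (μ : Fin d) : Fam d := fun n => opE (fun ν => T ν n) μ

/-- The rescaled Wilson term `(r / (2 a)) W` built from a family of translations. -/
def famW (L r : ℝ) (T : Fin d → Fam d) : Fam d :=
  fun n => ((r : ℂ) / (2 * (spacing L (n + 1) : ℂ))) • opW fun ν => T ν n

/-- The operator `M - (r / (2 a)) W` built from a family of translations. -/
def famL (L M r : ℝ) (T : Fin d → Fam d) : Fam d :=
  fun n => opL M r (spacing L (n + 1)) fun ν => T ν n

/-- The operator `C` built from a family of translations. -/
def famC (L M r : ℝ) (T : Fin d → Fam d) : Fam d :=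
  fun n => opC M r (spacing L (n + 1)) fun ν => T ν n

/-- The operators `X μ ν` built from a family of translations. -/
def famX (L M r : ℝ) (T : Fin d → Fam d) (μ ν : Fin d) : Fam d :=
  fun n => opX M r (spacing L (n + 1)) (fun ν => T ν n) μ ν

/-- Multiplication by the lattice spacing. -/
def spacingMul (L : ℝ) (K : Fam d) : Fam d := fun n => (spacing L (n + 1) : ℂ) • K n

theorem IsOfOrder.spacingMul (hL : 0 < L) (h : IsOfOrder 1 K) :
    IsOfOrder (spacingWeight d L) (spacingMul L K) :=
  h.smul zero_le_one fun n p => by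
    rw [Complex.norm_real, Real.norm_of_nonneg (spacing_pos hL n).le]
    simp [spacingWeight]

theorem star_isOfOrder (h : IsOfOrder w K) (hw : Tempered w) : IsOfOrder w (star K) :=
  h.conjTranspose hw

theorem spacing_dominated_one (hL : 0 < L) : Dominated (spacingWeight d L) 1 :=
  ⟨L, hL.le, fun n p => by simpa [spacingWeight] using spacing_le hL n⟩

theorem freeShift_conjTranspose_mul {N : ℕ} [NeZero N] (μ : Fin d) :
    (freeShift μ)ᴴ * freeShift μ = (1 : Op d N) := by
  apply hat_injective
  rw [hat_mul, hat_conjTranspose, hat_freeShift, hat_one, Matrix.diagonal_conjTranspose,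
    Matrix.diagonal_mul_diagonal]
  refine (congrArg Matrix.diagonal (funext fun k => ?_)).trans Matrix.diagonal_one
  rw [Pi.star_apply, Complex.star_def, ← Complex.normSq_eq_conj_mul_self, Complex.normSq_eq_norm_sq,
    norm_phase]
  simp

theorem star_shiftF_mul (μ : Fin d) : star (shiftF d μ) * shiftF d μ = 1 :=
  funext fun _ => freeShift_conjTranspose_mul μ

theorem shiftF_mul_star (μ : Fin d) : shiftF d μ * star (shiftF d μ) = 1 := by
  funext n
  exact mul_eq_one_comm.1 (congrFun (star_shiftF_mul μ) n)

theorem isMultiplier_star_shiftF (hL : 0 < L) (μ : Fin d) :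
    IsMultiplier L 1 (star (shiftF d μ)) :=
  (isMultiplier_shiftF hL μ).conjTranspose

theorem isMultiplier_shiftF_sub_one (hL : 0 < L) (μ : Fin d) :
    IsMultiplier L (spacingWeight d L * lam d L) (shiftF d μ - 1) := by
  refine IsMultiplier.of_symbol (g := fun n p => phase (p μ) - 1) ?_
    ⟨1, zero_le_one, fun n p => ?_⟩ ⟨2 * Real.pi / L, 1, by positivity, fun n p q => ?_⟩
  · intro n
    rw [Pi.sub_apply, hat_sub, shiftF, hat_freeShift, Pi.one_apply, hat_one, ← Matrix.diagonal_one,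
      Matrix.diagonal_sub]
  · rw [one_mul]
    exact norm_phase_sub_one_le_lam hL n p μ
  · have hl := zero_lt_one.trans_le (one_le_lam hL n p)
    rw [sub_sub_sub_cancel_right]
    refine (norm_phase_sub_le hL n p q μ).trans (le_of_eq ?_)
    simp only [Pi.mul_apply, spacingWeight]
    field_simp

theorem isMultiplier_star_shiftF_sub_one (hL : 0 < L) (μ : Fin d) :
    IsMultiplier L (spacingWeight d L * lam d L) (star (shiftF d μ) - 1) := by
  have h := (isMultiplier_shiftF_sub_one hL μ).conjTranspose
  have e : star (shiftF d μ) - 1 = star (shiftF d μ - 1) := by rw [star_sub, star_one]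
  rw [e]
  exact h

theorem tempered_spacing_mul_lam (hL : 0 < L) : Tempered (spacingWeight d L * lam d L) :=
  (tempered_spacingWeight hL).mul (tempered_lam hL)

theorem isMultiplier_shiftF_sub_star (hL : 0 < L) (μ : Fin d) :
    IsMultiplier L (spacingWeight d L * lam d L) (shiftF d μ - star (shiftF d μ)) := by
  have h := (isMultiplier_shiftF_sub_one hL μ).sub (isMultiplier_star_shiftF_sub_one hL μ) hL
    (tempered_spacing_mul_lam hL)
  rwa [sub_sub_sub_cancel_right] at h

theorem isMultiplier_famD (hL : 0 < L) (μ : Fin d) :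
    IsMultiplier L (lam d L) (famD L (shiftF d) μ) := by
  refine (isMultiplier_shiftF_sub_star hL μ).smul (c := fun n => 1 / (2 * (spacing L (n + 1) : ℂ)))
    (C := 1 / 2) hL (by norm_num) fun n p => le_of_eq ?_
  have ha := spacing_pos hL n
  rw [norm_div, norm_one, norm_mul, Complex.norm_ofNat, Complex.norm_real,
    Real.norm_of_nonneg ha.le]
  simp only [Pi.mul_apply, spacingWeight]
  field_simp

theorem isMultiplier_famE (hL : 0 < L) (μ : Fin d) : IsMultiplier L 1 (famE (shiftF d) μ) :=
  ((isMultiplier_shiftF hL μ).add (isMultiplier_star_shiftF hL μ) hL Tempered.one).const_smul hL _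

theorem neg_opW_eq {N : ℕ} [NeZero N] (T : Fin d → Op d N) :
    opW T = ∑ μ, (T μ + (T μ)ᴴ - (2 : ℂ) • 1) := by
  rw [opW, ← Finset.sum_neg_distrib]
  refine Finset.sum_congr rfl fun μ _ => ?_
  abel

/-- `T + Tᴴ - 2 = -(T - 1) (Tᴴ - 1)` has order `(a lam) ^ 2`, and the prefactor removes one power of
`a`. -/
theorem isMultiplier_famW (hL : 0 < L) (r : ℝ) :
    IsMultiplier L (spacingWeight d L * lam d L ^ 2) (famW L r (shiftF d)) := by
  have ht := (tempered_spacing_mul_lam (d := d) hL)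
  have h1 : ∀ μ, IsMultiplier L ((spacingWeight d L * lam d L) * (spacingWeight d L * lam d L))
      (shiftF d μ + star (shiftF d μ) - 2 • 1) := by
    intro μ
    have h2 := ((isMultiplier_shiftF_sub_one hL μ).mul (isMultiplier_star_shiftF_sub_one hL μ)
      hL ht ht).neg hL
    have e : -((shiftF d μ - 1) * (star (shiftF d μ) - 1)) =
        shiftF d μ + star (shiftF d μ) - 2 • 1 := by
      have : -((shiftF d μ - 1) * (star (shiftF d μ) - 1)) =
          shiftF d μ + star (shiftF d μ) - 1 - shiftF d μ * star (shiftF d μ) := by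
        noncomm_ring
      rw [this, shiftF_mul_star]
      noncomm_ring
    rwa [e] at h2
  have h2 := IsMultiplier.sum Finset.univ hL (ht.mul ht) fun μ _ => h1 μ
  have h3 := h2.smul (c := fun n => (r : ℂ) / (2 * (spacing L (n + 1) : ℂ)))
    (v := spacingWeight d L * lam d L ^ 2) (C := |r| / 2) hL (by positivity) fun n p => le_of_eq ?_
  · convert h3 using 1
    funext n
    rw [famW, neg_opW_eq, Finset.sum_apply]
    congr 1
    refine Finset.sum_congr rfl fun μ _ => ?_
    simp only [Pi.add_apply, Pi.sub_apply, Pi.star_apply, Matrix.star_eq_conjTranspose, Pi.smul_apply,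
      Pi.one_apply]
    congr 1
    module
  · have ha := spacing_pos hL n
    rw [norm_div, norm_mul, Complex.norm_ofNat, Complex.norm_real, Complex.norm_real,
      Real.norm_of_nonneg ha.le, Real.norm_eq_abs]
    simp only [Pi.mul_apply, Pi.pow_apply, spacingWeight]
    field_simp

theorem dominated_spacing_lam_sq_ell :
    Dominated (spacingWeight d L * lam d L ^ 2) (ell d L) :=
  ⟨1, zero_le_one, fun n p => by simp [ell]⟩

theorem dominated_one_ell (hL : 0 < L) : Dominated (1 : Weight d) (ell d L) :=
  ⟨1, zero_le_one, fun n p => by rw [one_mul]; exact one_le_ell hL n p⟩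

theorem famL_eq (M r : ℝ) (T : Fin d → Fam d) :
    famL L M r T = (fun _ => (M : ℂ) • (1 : Op d _)) - famW L r T := rfl

theorem isMultiplier_famL (hL : 0 < L) (M r : ℝ) :
    IsMultiplier L (ell d L) (famL L M r (shiftF d)) := by
  rw [famL_eq]
  refine IsMultiplier.sub ?_ ((isMultiplier_famW hL r).mono hL (dominated_spacing_lam_sq_ell)) hL
    (tempered_ell hL)
  exact (IsMultiplier.one.const_smul hL (M : ℂ)).mono hL (dominated_one_ell hL)

/-! ### Symbols of the free operators and their lower bounds. -/

/-- The function `∑ μ, |exp (i a p μ) - 1| ^ 2`. -/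
def chordSq {N : ℕ} [NeZero N] (p : Site d N) : ℝ := ∑ μ, ‖phase (p μ) - 1‖ ^ 2

/-- The symbol of the free operator `L`. -/
def symbL (L M r : ℝ) (n : ℕ) (p : Site d (n + 1)) : ℝ :=
  M + r / (2 * spacing L (n + 1)) * chordSq p

/-- The symbol of the free operator `C`. -/
def symbC (L M r : ℝ) (n : ℕ) (p : Site d (n + 1)) : ℝ :=
  symbL L M r n p + (∑ μ, ((phase (p μ)).im / spacing L (n + 1)) ^ 2) / symbL L M r n p

theorem hat_sum {N : ℕ} [NeZero N] {ι : Type*} (s : Finset ι) (K : ι → Op d N) :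
    hat (∑ i ∈ s, K i) = ∑ i ∈ s, hat (K i) := by
  simp only [hat, Matrix.mul_sum, Matrix.sum_mul]

theorem phase_add_conj {N : ℕ} [NeZero N] (k : ZMod N) :
    phase k + star (phase k) - 2 = -((‖phase k - 1‖ ^ 2 : ℝ) : ℂ) := by
  have h1 : phase k * star (phase k) = 1 := by
    rw [Complex.star_def, Complex.mul_conj, Complex.normSq_eq_norm_sq, norm_phase]
    simp
  rw [← Complex.normSq_eq_norm_sq, ← Complex.mul_conj, map_sub, map_one, ← Complex.star_def]
  linear_combination h1

theorem hat_famL (M r : ℝ) (n : ℕ) :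
    hat (famL L M r (shiftF d) n) = Matrix.diagonal fun p => (symbL L M r n p : ℂ) := by
  rw [famL, opL, hat_sub, hat_smul, hat_smul, hat_one, neg_opW_eq, hat_sum]
  simp only [hat_sub, hat_add, hat_smul, hat_one, hat_conjTranspose, shiftF, hat_freeShift,
    Matrix.diagonal_conjTranspose]
  ext p q
  by_cases h : p = q
  · subst h
    have h2 : ∀ μ, phase (p μ) + star (phase (p μ)) - 2 = -((‖phase (p μ) - 1‖ ^ 2 : ℝ) : ℂ) :=
      fun μ => phase_add_conj (p μ)
    simp only [Matrix.sub_apply, Matrix.smul_apply, Matrix.sum_apply, Matrix.add_apply,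
      Matrix.diagonal_apply_eq, Matrix.one_apply_eq, Pi.star_apply, smul_eq_mul, mul_one, h2, symbL,
      chordSq, Finset.sum_neg_distrib]
    push_cast
    ring
  · simp only [Matrix.sub_apply, Matrix.smul_apply, Matrix.sum_apply, Matrix.add_apply,
      Matrix.diagonal_apply_ne _ h, Matrix.one_apply_ne h, smul_zero, add_zero, sub_zero,
      Finset.sum_const_zero]

theorem hat_famD (n : ℕ) (μ : Fin d) :
    hat (famD L (shiftF d) μ n) =
      Matrix.diagonal fun p => Complex.I * (((phase (p μ)).im / spacing L (n + 1) : ℝ) : ℂ) := by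
  rw [famD, opD, hat_smul, hat_sub, hat_conjTranspose, shiftF, hat_freeShift,
    Matrix.diagonal_conjTranspose]
  ext p q
  by_cases h : p = q
  · subst h
    have h2 : phase (p μ) - star (phase (p μ)) = 2 * Complex.I * ((phase (p μ)).im : ℂ) := by
      rw [Complex.star_def, Complex.sub_conj]
      push_cast
      ring
    simp only [Matrix.smul_apply, Matrix.sub_apply, Matrix.diagonal_apply_eq, Pi.star_apply, h2,
      smul_eq_mul]
    push_cast
    ring
  · simp [Matrix.diagonal_apply_ne _ h]

theorem chordSq_nonneg {N : ℕ} [NeZero N] (p : Site d N) : 0 ≤ chordSq p :=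
  Finset.sum_nonneg fun _ _ => by positivity

theorem symbL_pos (hL : 0 < L) {M r : ℝ} (hM : 0 < M) (hr : 0 < r) (n : ℕ) (p : Site d (n + 1)) :
    0 < symbL L M r n p := by
  have ha := spacing_pos hL n
  have hc := chordSq_nonneg p
  unfold symbL
  positivity

theorem hat_famC (hL : 0 < L) {M r : ℝ} (hM : 0 < M) (hr : 0 < r) (n : ℕ) :
    hat (famC L M r (shiftF d) n) = Matrix.diagonal fun p => (symbC L M r n p : ℂ) := by
  have e : famC L M r (shiftF d) n = famL L M r (shiftF d) n -
      ∑ μ, famD L (shiftF d) μ n * (famL L M r (shiftF d) n)⁻¹ * famD L (shiftF d) μ n := rfl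
  have hinv : hat (famL L M r (shiftF d) n)⁻¹ =
      Matrix.diagonal fun p => (symbL L M r n p : ℂ)⁻¹ := by
    rw [hat_inv]
    refine Matrix.inv_eq_left_inv ?_
    rw [hat_famL, Matrix.diagonal_mul_diagonal]
    refine (congrArg Matrix.diagonal (funext fun p => ?_)).trans Matrix.diagonal_one
    exact inv_mul_cancel₀ (by exact_mod_cast (symbL_pos hL hM hr n p).ne')
  rw [e, hat_sub, hat_sum]
  simp only [hat_mul, hinv, hat_famD, hat_famL, Matrix.diagonal_mul_diagonal]
  ext p q
  by_cases h : p = q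
  · subst h
    have h2 : ∀ μ, Complex.I * (((phase (p μ)).im / spacing L (n + 1) : ℝ) : ℂ) *
        (symbL L M r n p : ℂ)⁻¹ * (Complex.I * (((phase (p μ)).im / spacing L (n + 1) : ℝ) : ℂ)) =
        -(((((phase (p μ)).im / spacing L (n + 1)) ^ 2 : ℝ) : ℂ) * (symbL L M r n p : ℂ)⁻¹) := by
      intro μ
      push_cast
      linear_combination ((phase (p μ)).im / spacing L (n + 1) : ℂ) ^ 2 *
        (symbL L M r n p : ℂ)⁻¹ * Complex.I_mul_I
    simp only [Matrix.sub_apply, Matrix.sum_apply, Matrix.diagonal_apply_eq, h2,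
      Finset.sum_neg_distrib, symbC, ← Finset.sum_mul]
    push_cast
    rw [sub_neg_eq_add, div_eq_mul_inv]
  · simp [Matrix.sum_apply, Matrix.diagonal_apply_ne _ h]

/-- Cauchy–Schwarz for `d + 1` summands; `Option` adds the constant term `1` to the `d` directions.
-/
theorem lam_sq_le (n : ℕ) (p : Site d (n + 1)) :
    lam d L n p ^ 2 ≤ (d + 1) * (1 + chordSq p / spacing L (n + 1) ^ 2) := by
  have h := sq_sum_le_card_mul_sum_sq (s := (Finset.univ : Finset (Option (Fin d))))
    (f := fun o => o.elim 1 fun μ => ‖phase (p μ) - 1‖ / spacing L (n + 1))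
  rw [Fintype.sum_option, Fintype.sum_option, Finset.card_univ, Fintype.card_option,
    Fintype.card_fin] at h
  simp only [Option.elim, one_pow, div_pow] at h
  push_cast at h
  rw [chordSq, Finset.sum_div]
  exact h

theorem le_symbL (hL : 0 < L) {M r : ℝ} (hM : 0 < M) (hr : 0 < r) :
    ∃ c, 0 < c ∧ ∀ n (p : Site d (n + 1)), c * ell d L n p ≤ symbL L M r n p := by
  -- The first summand, multiplied by the mass, covers the bounded part of `ell`; the second,
  -- multiplied by the Wilson term, covers the part growing with momentum.
  set B : ℝ := (1 + (d + 1) * L) / M + (d + 1) * (2 / r) with hB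
  have hBpos : 0 < B := by positivity
  refine ⟨B⁻¹, by positivity, fun n p => ?_⟩
  have ha := spacing_pos hL n
  have hc := chordSq_nonneg p
  rw [inv_mul_le_iff₀ hBpos]
  have h1 := mul_le_mul_of_nonneg_left (lam_sq_le (L := L) n p) ha.le
  have h2 := spacing_le hL n
  have e1 : spacing L (n + 1) * ((d + 1) * (1 + chordSq p / spacing L (n + 1) ^ 2)) =
      (d + 1) * spacing L (n + 1) + (d + 1) * (chordSq p / spacing L (n + 1)) := by
    field_simp
  have h3 : ((d : ℝ) + 1) * spacing L (n + 1) ≤ (d + 1) * L :=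
    mul_le_mul_of_nonneg_left h2 (by positivity)
  have hcd : 0 ≤ chordSq p / spacing L (n + 1) := by positivity
  have e2 : symbL L M r n p = M + r / 2 * (chordSq p / spacing L (n + 1)) := by
    rw [symbL]
    ring
  have e3 : ell d L n p = 1 + spacing L (n + 1) * lam d L n p ^ 2 := rfl
  have e4 : B * (M + r / 2 * (chordSq p / spacing L (n + 1))) =
      (1 + (d + 1) * L) + (d + 1) * (chordSq p / spacing L (n + 1)) +
      ((1 + (d + 1) * L) / M * (r / 2 * (chordSq p / spacing L (n + 1))) +
        (d + 1) * (2 / r) * M) := by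
    rw [hB]
    field_simp
    ring
  have h4 : 0 ≤ (1 + (d + 1) * L) / M * (r / 2 * (chordSq p / spacing L (n + 1))) +
        (d + 1) * (2 / r) * M := by positivity
  rw [e2, e3, e4]
  linarith

theorem symbL_le (hL : 0 < L) {M r : ℝ} (hM : 0 < M) (hr : 0 < r) :
    ∃ C, 0 < C ∧ ∀ n (p : Site d (n + 1)), symbL L M r n p ≤ C * ell d L n p := by
  obtain ⟨C, hC, b⟩ := (isMultiplier_famL (d := d) hL M r).bound
  refine ⟨C + 1, by positivity, fun n p => ?_⟩
  have h1 := b n p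
  rw [multiplierSymbol_eq (hat_famL M r), Complex.norm_real,
    Real.norm_of_nonneg (symbL_pos hL hM hr n p).le] at h1
  have h2 := one_le_ell hL n p
  linarith

/-- This is `sin² θ = y - y² / 4` with `y = 4 sin² (θ / 2)`. The deficit `y² / 4` is responsible for
the zeros of `sin θ` away from small momenta, the fermion doublers. -/
theorem im_phase_sq {N : ℕ} [NeZero N] (k : ZMod N) :
    (phase k).im ^ 2 = ‖phase k - 1‖ ^ 2 - (‖phase k - 1‖ ^ 2) ^ 2 / 4 := by
  have h1 := Complex.normSq_eq_norm_sq (phase k)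
  rw [norm_phase, Complex.normSq_apply] at h1
  have h2 := Complex.normSq_eq_norm_sq (phase k - 1)
  rw [Complex.normSq_apply, Complex.sub_re, Complex.sub_im, Complex.one_re, Complex.one_im] at h2
  rw [← h2]
  have h3 : (phase k).re * (phase k).re = 1 - (phase k).im * (phase k).im := by linarith
  have h4 : ((phase k).re - 1) * ((phase k).re - 1) + ((phase k).im - 0) * ((phase k).im - 0) =
      2 - 2 * (phase k).re := by linear_combination h3
  rw [h4]
  linear_combination h3

/-- After multiplication by the symbol `s` of L, what has to be bounded below is `s² + ∑ sin² / a²`.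
At the doublers the sines are small, but there the square of the Wilson term, `r² chordSq² / (4
a²)`, compensates the deficit from `im_phase_sq`. -/
theorem le_symbC (hL : 0 < L) {M r : ℝ} (hM : 0 < M) (hr : 0 < r) :
    ∃ c, 0 < c ∧ ∀ n (p : Site d (n + 1)),
      c * (lam d L ^ 2 * (ell d L)⁻¹) n p ≤ symbC L M r n p := by
  obtain ⟨C, hC, hCl⟩ := symbL_le (d := d) hL hM hr
  -- With `κ ≤ r² / 2` the deficit in `κ` times the sine term uses at most half of the squared
  -- Wilson term; `κ' ≤ M² / 2` lets the mass cover the constant part.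
  obtain ⟨κ, hκ0, hκ1, hκ2⟩ : ∃ κ : ℝ, 0 < κ ∧ κ ≤ 1 ∧ κ ≤ r ^ 2 / 2 :=
    ⟨min 1 (r ^ 2 / 2), by positivity, min_le_left _ _, min_le_right _ _⟩
  obtain ⟨κ', hκ'0, hκ'1, hκ'2⟩ : ∃ κ' : ℝ, 0 < κ' ∧ κ' ≤ M ^ 2 / 2 ∧ κ' ≤ κ :=
    ⟨min (M ^ 2 / 2) κ, by positivity, min_le_left _ _, min_le_right _ _⟩
  refine ⟨κ' / (d + 1) / C, by positivity, fun n p => ?_⟩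
  have ha := spacing_pos hL n
  have hs := symbL_pos hL hM hr n p
  have hell := zero_lt_one.trans_le (one_le_ell hL n p)
  have hc := chordSq_nonneg p
  set a := spacing L (n + 1) with hadef
  set s := symbL L M r n p with hsdef
  have hy : ∀ μ, 0 ≤ ‖phase (p μ) - 1‖ ^ 2 := fun μ => by positivity
  have e1 : ∑ μ, ((phase (p μ)).im / a) ^ 2 =
      (chordSq p - (∑ μ, (‖phase (p μ) - 1‖ ^ 2) ^ 2) / 4) / a ^ 2 := by
    simp only [div_pow, im_phase_sq, ← Finset.sum_div, Finset.sum_sub_distrib, chordSq]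
  have e1' : 0 ≤ ∑ μ, ((phase (p μ)).im / a) ^ 2 := Finset.sum_nonneg fun _ _ => by positivity
  have e2 : ∑ μ, (‖phase (p μ) - 1‖ ^ 2) ^ 2 ≤ chordSq p ^ 2 :=
    Finset.sum_sq_le_sq_sum_of_nonneg fun μ _ => hy μ
  have e3 : s ^ 2 = M ^ 2 + M * r / a * chordSq p + r ^ 2 / 4 * (chordSq p ^ 2 / a ^ 2) := by
    rw [hsdef, symbL, ← hadef]
    field_simp
    ring
  have e4 : (∑ μ, (‖phase (p μ) - 1‖ ^ 2) ^ 2) / a ^ 2 ≤ chordSq p ^ 2 / a ^ 2 := by gcongr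
  have hS2 : 0 ≤ (∑ μ, (‖phase (p μ) - 1‖ ^ 2) ^ 2) / a ^ 2 :=
    div_nonneg (Finset.sum_nonneg fun _ _ => by positivity) (by positivity)
  have key : κ' * (1 + chordSq p / a ^ 2) ≤ s ^ 2 + ∑ μ, ((phase (p μ)).im / a) ^ 2 := by
    have h1 : κ * ∑ μ, ((phase (p μ)).im / a) ^ 2 ≤ ∑ μ, ((phase (p μ)).im / a) ^ 2 :=
      mul_le_of_le_one_left e1' hκ1
    have h2 : κ * ∑ μ, ((phase (p μ)).im / a) ^ 2 = κ * (chordSq p / a ^ 2) -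
        κ / 4 * ((∑ μ, (‖phase (p μ) - 1‖ ^ 2) ^ 2) / a ^ 2) := by
      rw [e1]
      ring
    have h3 : κ / 4 * ((∑ μ, (‖phase (p μ) - 1‖ ^ 2) ^ 2) / a ^ 2) ≤
        r ^ 2 / 8 * (chordSq p ^ 2 / a ^ 2) := by
      refine mul_le_mul (by linarith) e4 hS2 (by positivity)
    have h4 : 0 ≤ M * r / a * chordSq p := by positivity
    have h5 : 0 ≤ chordSq p ^ 2 / a ^ 2 := by positivity
    have h6 : κ' * (chordSq p / a ^ 2) ≤ κ * (chordSq p / a ^ 2) :=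
      mul_le_mul_of_nonneg_right hκ'2 (by positivity)
    nlinarith [mul_nonneg (sq_nonneg r) h5, sq_nonneg M]
  have e5 : symbC L M r n p = (s ^ 2 + ∑ μ, ((phase (p μ)).im / a) ^ 2) / s := by
    rw [symbC, ← hsdef, ← hadef]
    field_simp
  rw [e5, le_div_iff₀ hs]
  have h7 := lam_sq_le (L := L) n p
  simp only [Pi.mul_apply, Pi.pow_apply, Pi.inv_apply]
  calc κ' / (d + 1) / C * (lam d L n p ^ 2 * (ell d L n p)⁻¹) * s
      ≤ κ' / (d + 1) / C * (((d + 1) * (1 + chordSq p / a ^ 2)) * (ell d L n p)⁻¹) *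
        (C * ell d L n p) := by
        gcongr
        exact hCl n p
    _ = κ' * (1 + chordSq p / a ^ 2) := by field_simp
    _ ≤ _ := key

end WilsonFermion

/-! ### Curvature and commutators of covariant translations. -/

namespace WilsonFermion

open scoped ComplexOrder

variable {d : ℕ} {L : ℝ} {w w₁ w₂ w₃ v : Weight d} {K K₁ K₂ : Fam d}

theorem hasFDerivAt_const_mul_ofReal {c : ℂ} {φ : (Fin d → ℝ) → ℝ} (h : ContDiff ℝ ∞ φ)
    (x v : Fin d → ℝ) :
    fderiv ℝ (fun y => c * (φ y : ℂ)) x v = c * (fderiv ℝ φ x v : ℂ) := by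
  have h1 : HasFDerivAt φ (fderiv ℝ φ x) x :=
    (h.differentiable (by simp)).differentiableAt.hasFDerivAt
  have h2 := (Complex.ofRealCLM.hasFDerivAt.comp x h1).const_mul c
  have h3 : fderiv ℝ (fun y => c * (φ y : ℂ)) x = c • Complex.ofRealCLM.comp (fderiv ℝ φ x) :=
    h2.fderiv
  rw [h3]
  simp

/-- The curvature `- i Q F μ ν`. -/
def curv (Q : ℝ) (A : Fin d → (Fin d → ℝ) → ℝ) (μ ν : Fin d) : ℝ × (Fin d → ℝ) → ℂ :=
  fun z => -(Complex.I * Q) * (fieldStrength A μ ν z.2 : ℂ)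

theorem good_curv (Q : ℝ) {A : Fin d → (Fin d → ℝ) → ℝ} (hA : ∀ μ, ContDiff ℝ ∞ (A μ))
    (hp : ∀ μ, IsPeriodic L (A μ)) (μ ν : Fin d) : Good L (curv Q A μ ν) :=
  (Good.const _).mul (good_ofReal (contDiff_fieldStrength hA μ ν) (isPeriodic_fieldStrength hp μ ν))

theorem curv_swap (Q : ℝ) (A : Fin d → (Fin d → ℝ) → ℝ) (μ ν : Fin d) :
    curv Q A ν μ = -curv Q A μ ν := by
  funext z
  simp only [curv, fieldStrength, Pi.neg_apply]
  push_cast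
  ring

theorem star_curv (Q : ℝ) (A : Fin d → (Fin d → ℝ) → ℝ) (μ ν : Fin d) :
    (fun z => star (curv Q A ν μ z)) = curv Q A μ ν := by
  rw [curv_swap]
  funext z
  simp [curv]

/-- The curvature of the link variables. -/
theorem exists_plaquette_expansion (Q : ℝ) {A : Fin d → (Fin d → ℝ) → ℝ}
    (hA : ∀ μ, ContDiff ℝ ∞ (A μ)) (hp : ∀ μ, IsPeriodic L (A μ)) (μ ν : Fin d) :
    ∃ g, Good L g ∧ ∀ a x,
      (linkFun Q A μ * shiftFun μ (linkFun Q A ν) - linkFun Q A ν * shiftFun ν (linkFun Q A μ))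
        (a, x) = (a : ℂ) * ((a : ℂ) * (curv Q A μ ν (a, x) + (a : ℂ) * g (a, x))) := by
  obtain ⟨u, hu, hul, hu0⟩ := exists_link_expansion Q hA hp μ
  obtain ⟨v, hv, hvl, hv0⟩ := exists_link_expansion Q hA hp ν
  obtain ⟨δv, hδv, hv1, hv2⟩ := hv.exists_diff μ
  obtain ⟨δu, hδu, hu1, hu2⟩ := hu.exists_diff ν
  -- With links `1 + a u` and `1 + a v`, the terms of order `a` and the product `u v` cancel. At
  -- order `a²` there remains the difference of the two difference quotients, which at `a = 0` is
  -- the curvature.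
  obtain ⟨k, hk, hk'⟩ := ((hδv.sub hδu).sub (good_curv Q hA hp μ ν)).hadamard (fun x => by
    simp only [Pi.sub_apply, hv2, hu2, hv0, hu0, hasFDerivAt_const_mul_ofReal (hA _), curv,
      fieldStrength]
    push_cast
    ring)
  refine ⟨k + (u * δv - v * δu), hk.add ((hu.mul hδv).sub (hv.mul hδu)), fun a x => ?_⟩
  have e1 : shiftFun μ (linkFun Q A ν) (a, x) = 1 + (a : ℂ) * shiftFun μ v (a, x) := hvl _ _
  have e2 : shiftFun ν (linkFun Q A μ) (a, x) = 1 + (a : ℂ) * shiftFun ν u (a, x) := hul _ _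
  have e3 := hk' a x
  simp only [Pi.sub_apply, Pi.mul_apply, Pi.add_apply, e1, e2, hul, hvl, hv1, hu1] at e3 ⊢
  linear_combination (a : ℂ) * a * e3

theorem mulF_eq_spacingMul {f k : ℝ × (Fin d → ℝ) → ℂ} (h : ∀ a x, f (a, x) = (a : ℂ) * k (a, x)) :
    mulF L f = spacingMul L (mulF L k) := by
  funext n
  ext x y
  by_cases hxy : x = y <;> simp [mulF, mulOp, spacingMul, hxy, h]

theorem spacingMul_mul : spacingMul L K₁ * K₂ = spacingMul L (K₁ * K₂) := by
  funext n
  simp [spacingMul]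

theorem mul_spacingMul : K₁ * spacingMul L K₂ = spacingMul L (K₁ * K₂) := by
  funext n
  simp [spacingMul]

theorem spacingMul_add : spacingMul L (K₁ + K₂) = spacingMul L K₁ + spacingMul L K₂ := by
  funext n
  simp [spacingMul]

theorem spacingMul_neg : spacingMul L (-K) = -spacingMul L K := by
  funext n
  simp [spacingMul]

theorem star_spacingMul : star (spacingMul L K) = spacingMul L (star K) := by
  funext n
  simp [spacingMul, Matrix.star_eq_conjTranspose]

theorem star_mulF (f : ℝ × (Fin d → ℝ) → ℂ) : star (mulF L f) = mulF L fun z => star (f z) := by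
  rw [mulF_conj]
  rfl

theorem mulF_neg (f : ℝ × (Fin d → ℝ) → ℂ) : mulF L (-f) = -mulF L f := by
  funext n
  ext x y
  by_cases hxy : x = y <;> simp [mulF, mulOp, hxy]

theorem mulF_sub (f g : ℝ × (Fin d → ℝ) → ℂ) : mulF L (f - g) = mulF L f - mulF L g := by
  rw [sub_eq_add_neg, mulF_add, mulF_neg, ← sub_eq_add_neg]

theorem mulF_one : mulF L (fun _ : ℝ × (Fin d → ℝ) => (1 : ℂ)) = 1 := by
  funext n
  simp [mulF, mulOp]

/-- Equality of bounded families up to terms of the size of the lattice spacing. -/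
structure Approx (L : ℝ) (K K' : Fam d) : Prop where
  left : IsOfOrder 1 K
  right : IsOfOrder 1 K'
  sub : IsOfOrder (spacingWeight d L) (K - K')

namespace Approx

variable {K' K₁' K₂' K'' : Fam d}

theorem refl (hL : 0 < L) (h : IsOfOrder 1 K) : Approx L K K :=
  ⟨h, h, by
    rw [sub_self]
    exact IsOfOrder.zero fun n p => ((tempered_spacingWeight hL).pos n p).le⟩

theorem symm (h : Approx L K K') : Approx L K' K :=
  ⟨h.right, h.left, by
    rw [← neg_sub]
    exact h.sub.neg⟩

theorem trans (h : Approx L K K') (h' : Approx L K' K'') : Approx L K K'' :=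
  ⟨h.left, h'.right, by
    have := h.sub.add h'.sub
    rwa [sub_add_sub_cancel] at this⟩

theorem add (h₁ : Approx L K₁ K₁') (h₂ : Approx L K₂ K₂') : Approx L (K₁ + K₂) (K₁' + K₂') :=
  ⟨h₁.left.add h₂.left, h₁.right.add h₂.right, by
    rw [add_sub_add_comm]
    exact h₁.sub.add h₂.sub⟩

theorem const_smul (h : Approx L K K') (c : ℂ) :
    Approx L (fun n => c • K n) (fun n => c • K' n) :=
  ⟨h.left.const_smul c, h.right.const_smul c, by
    have e : ((fun n => c • K n) - fun n => c • K' n : Fam d) = fun n => c • (K - K') n := by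
      funext n
      simp [smul_sub]
    rw [e]
    exact h.sub.const_smul c⟩

theorem neg (h : Approx L K K') : Approx L (-K) (-K') :=
  ⟨h.left.neg, h.right.neg, by
    rw [← neg_sub']
    exact h.sub.neg⟩

theorem mul (hL : 0 < L) (h₁ : Approx L K₁ K₁') (h₂ : Approx L K₂ K₂') :
    Approx L (K₁ * K₂) (K₁' * K₂') := by
  have ha := tempered_spacingWeight (d := d) hL
  refine ⟨?_, ?_, ?_⟩
  · exact (h₁.left.mul h₂.left (fun _ _ => zero_le_one) Tempered.one).congr_mul (one_mul 1)
  · exact (h₁.right.mul h₂.right (fun _ _ => zero_le_one) Tempered.one).congr_mul (one_mul 1)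
  · have e : K₁ * K₂ - K₁' * K₂' = (K₁ - K₁') * K₂ + K₁' * (K₂ - K₂') := by noncomm_ring
    rw [e]
    exact ((h₁.sub.mul h₂.left (fun n p => (ha.pos n p).le) Tempered.one).congr_mul
      (mul_one _)).add ((h₁.right.mul h₂.sub (fun _ _ => zero_le_one) ha).congr_mul (one_mul _))

theorem star (hL : 0 < L) (h : Approx L K K') : Approx L (star K) (star K') :=
  ⟨star_isOfOrder h.left Tempered.one, star_isOfOrder h.right Tempered.one, by
    rw [← star_sub]
    exact star_isOfOrder h.sub (tempered_spacingWeight hL)⟩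

end Approx

variable {Q : ℝ} {A : Fin d → (Fin d → ℝ) → ℝ}

theorem isOfOrder_one_mul (h₁ : IsOfOrder 1 K₁) (h₂ : IsOfOrder 1 K₂) : IsOfOrder 1 (K₁ * K₂) :=
  (h₁.mul h₂ (fun _ _ => zero_le_one) Tempered.one).congr_mul (one_mul 1)

theorem isOfOrder_shiftF (hL : 0 < L) (μ : Fin d) : IsOfOrder 1 (shiftF d μ) :=
  (isMultiplier_shiftF hL μ).isOfOrder

theorem isOfOrder_star_shiftF (hL : 0 < L) (μ : Fin d) : IsOfOrder 1 (star (shiftF d μ)) :=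
  (isMultiplier_star_shiftF hL μ).isOfOrder

theorem approx_shiftF_mul_mulF (hL : 0 < L) {f : ℝ × (Fin d → ℝ) → ℂ} (hf : Good L f) (μ : Fin d) :
    Approx L (shiftF d μ * mulF L f) (mulF L f * shiftF d μ) := by
  have h1 := isOfOrder_shiftF hL μ
  have h2 := isOfOrder_mulF hL hf
  refine ⟨isOfOrder_one_mul h1 h2, isOfOrder_one_mul h2 h1, ?_⟩
  obtain ⟨g, hg, hfg, -⟩ := hf.exists_diff μ
  have e : shiftF d μ * mulF L f - mulF L f * shiftF d μ = spacingMul L (mulF L g * shiftF d μ) := by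
    rw [shiftF_mul_mulF hf, mulF_spacing hfg, add_mul, add_sub_cancel_left]
    exact spacingMul_mul
  rw [e]
  exact (isOfOrder_one_mul (isOfOrder_mulF hL hg) h1).spacingMul hL

theorem approx_star_shiftF_mul_mulF (hL : 0 < L) {f : ℝ × (Fin d → ℝ) → ℂ} (hf : Good L f)
    (μ : Fin d) :
    Approx L (star (shiftF d μ) * mulF L f) (mulF L f * star (shiftF d μ)) := by
  have h := (approx_shiftF_mul_mulF hL hf.conj μ).star hL
  rw [star_mul, star_mul, star_mulF] at h
  simp only [star_star] at h
  exact h.symm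

theorem covF_eq (μ : Fin d) : covF L Q A μ = mulF L (linkFun Q A μ) * shiftF d μ := rfl

theorem good_linkFun (hA : ∀ μ, ContDiff ℝ ∞ (A μ)) (hp : ∀ μ, IsPeriodic L (A μ)) (μ : Fin d) :
    Good L (linkFun Q A μ) := by
  obtain ⟨u, hu, hul, -⟩ := exists_link_expansion Q hA hp μ
  have e : linkFun Q A μ = (fun _ => 1) + (fun z => ((z.1 : ℝ) : ℂ)) * u := by
    funext z
    exact hul z.1 z.2
  have h1 : Good (d := d) L (fun z => ((z.1 : ℝ) : ℂ)) :=
    ⟨(Complex.ofRealCLM.contDiff (n := ∞)).comp contDiff_fst, fun _ _ _ => rfl⟩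
  rw [e]
  exact (Good.const 1).add (h1.mul hu)

theorem star_linkFun_mul (μ : Fin d) :
    (fun z => star (linkFun Q A μ z)) * linkFun Q A μ = fun _ => 1 := by
  funext z
  simp only [Pi.mul_apply, linkFun, link]
  rw [Complex.star_def, ← Complex.exp_conj, ← Complex.exp_add]
  simp

theorem star_covF_mul (μ : Fin d) : star (covF L Q A μ) * covF L Q A μ = 1 := by
  rw [covF_eq, star_mul, star_mulF, mul_assoc, ← mul_assoc (mulF L _), ← mulF_mul,
    star_linkFun_mul, mulF_one, one_mul, star_shiftF_mul]

theorem covF_mul_star (μ : Fin d) : covF L Q A μ * star (covF L Q A μ) = 1 :=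
  funext fun n => mul_eq_one_comm.1 (congrFun (star_covF_mul μ) n)

theorem covShift_conjTranspose_mul (n : ℕ) (μ : Fin d) :
    (covF L Q A μ n)ᴴ * covF L Q A μ n = 1 := congrFun (star_covF_mul μ) n

/-- The deviation of the covariant translations from the free ones. -/
theorem exists_covF_expansion (hL : 0 < L) (hA : ∀ μ, ContDiff ℝ ∞ (A μ))
    (hp : ∀ μ, IsPeriodic L (A μ)) (μ : Fin d) :
    ∃ V : Fam d, IsOfOrder 1 V ∧ covF L Q A μ = shiftF d μ + spacingMul L V ∧
      IsOfOrder (spacingWeight d L * lam d L) (V + star V) := by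
  obtain ⟨u, hu, hul, hu0⟩ := exists_link_expansion Q hA hp μ
  obtain ⟨v, hv, hv'⟩ := (hu.sub hu.atZero).hadamard (fun x => by simp)
  have hs := isOfOrder_shiftF hL μ
  have hs' := isOfOrder_star_shiftF hL μ
  refine ⟨mulF L u * shiftF d μ, isOfOrder_one_mul (isOfOrder_mulF hL hu) hs, ?_, ?_⟩
  · rw [covF_eq, mulF_spacing (g := fun _ => 1) hul, mulF_one, add_mul, one_mul]
    congr 1
    exact spacingMul_mul
  -- At `a = 0` the coefficient `u` is purely imaginary, so the leading part of `V + star V` is `u₀`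
  -- times a difference of a translation and its adjoint, of order `a lam`. The commutator and the
  -- correction to `u₀` are of order `a`.
  · set u₀ : ℝ × (Fin d → ℝ) → ℂ := fun z => u (0, z.2) with hu₀
    have hg₀ : Good L u₀ := hu.atZero
    have e1 : mulF L u = mulF L u₀ + spacingMul L (mulF L v) :=
      mulF_spacing fun a x => by
        have := hv' a x
        simp only [Pi.sub_apply] at this
        simp only [hu₀]
        linear_combination this
    have e2 : star (mulF L u₀) = -mulF L u₀ := by
      rw [star_mulF, ← mulF_neg]
      congr 1
      funext z
      simp [hu₀, hu0]
    have e3 : mulF L u * shiftF d μ + star (mulF L u * shiftF d μ) =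
        mulF L u₀ * (shiftF d μ - star (shiftF d μ)) +
        (-(star (shiftF d μ) * mulF L u₀ - mulF L u₀ * star (shiftF d μ)) +
        spacingMul L (mulF L v * shiftF d μ + star (shiftF d μ) * star (mulF L v))) := by
      rw [star_mul, e1, star_add, e2, star_spacingMul, spacingMul_add, ← spacingMul_mul,
        ← mul_spacingMul]
      noncomm_ring
    have hdom : Dominated (spacingWeight d L) (spacingWeight d L * lam d L) :=
      ⟨1, zero_le_one, fun n p => by
        rw [one_mul]
        exact le_mul_of_one_le_right (spacing_pos hL n).le (one_le_lam hL n p)⟩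
    rw [e3]
    refine IsOfOrder.add ?_ (IsOfOrder.mono (IsOfOrder.add ?_ ?_) hdom)
    · exact ((isOfOrder_mulF hL hg₀).mul (isMultiplier_shiftF_sub_star hL μ).isOfOrder
        (fun _ _ => zero_le_one) (tempered_spacing_mul_lam hL)).congr_mul (one_mul _)
    · exact (approx_star_shiftF_mul_mulF hL hg₀ μ).sub.neg
    · refine IsOfOrder.spacingMul hL ((isOfOrder_one_mul (isOfOrder_mulF hL hv) hs).add
        (isOfOrder_one_mul hs' ?_))
      exact star_isOfOrder (isOfOrder_mulF hL hv) Tempered.one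

theorem approx_covF (hL : 0 < L) (hA : ∀ μ, ContDiff ℝ ∞ (A μ)) (hp : ∀ μ, IsPeriodic L (A μ))
    (μ : Fin d) : Approx L (covF L Q A μ) (shiftF d μ) := by
  obtain ⟨V, hV, e, -⟩ := exists_covF_expansion (Q := Q) hL hA hp μ
  have h := hV.spacingMul hL
  refine ⟨?_, isOfOrder_shiftF hL μ, ?_⟩
  · rw [e]
    exact (isOfOrder_shiftF hL μ).add (h.mono (spacing_dominated_one hL))
  · rwa [e, add_sub_cancel_left]

theorem shiftF_commute (hL : 0 < L) (μ ν : Fin d) : Commute (shiftF d μ) (shiftF d ν) :=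
  (isMultiplier_shiftF hL μ).commute (isMultiplier_shiftF hL ν)

theorem shiftF_commute_star (hL : 0 < L) (μ ν : Fin d) : Commute (shiftF d μ) (star (shiftF d ν)) :=
  (isMultiplier_shiftF hL μ).commute (isMultiplier_star_shiftF hL ν)

theorem exists_commutator (hL : 0 < L) (hA : ∀ μ, ContDiff ℝ ∞ (A μ))
    (hp : ∀ μ, IsPeriodic L (A μ)) (μ ν : Fin d) :
    ∃ Z, covF L Q A μ * covF L Q A ν - covF L Q A ν * covF L Q A μ =
        spacingMul L (spacingMul L Z) ∧
      Approx L Z (mulF L (curv Q A μ ν) * (shiftF d μ * shiftF d ν)) := by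
  obtain ⟨g, hg, hpl⟩ := exists_plaquette_expansion Q hA hp μ ν
  have hss := isOfOrder_one_mul (isOfOrder_shiftF hL μ) (isOfOrder_shiftF hL ν)
  have hc := isOfOrder_one_mul (isOfOrder_mulF hL (good_curv Q hA hp μ ν)) hss
  have hgs := (isOfOrder_one_mul (isOfOrder_mulF hL hg) hss).spacingMul hL
  refine ⟨mulF L (curv Q A μ ν) * (shiftF d μ * shiftF d ν) +
    spacingMul L (mulF L g * (shiftF d μ * shiftF d ν)), ?_, ⟨?_, hc, ?_⟩⟩
  · have e1 : covF L Q A μ * covF L Q A ν - covF L Q A ν * covF L Q A μ =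
        mulF L (linkFun Q A μ * shiftFun μ (linkFun Q A ν) -
          linkFun Q A ν * shiftFun ν (linkFun Q A μ)) * (shiftF d μ * shiftF d ν) := by
      have h : ∀ μ ν, covF L Q A μ * covF L Q A ν =
          mulF L (linkFun Q A μ * shiftFun μ (linkFun Q A ν)) * (shiftF d μ * shiftF d ν) := by
        intro μ ν
        rw [covF_eq, covF_eq, mul_assoc, ← mul_assoc (shiftF d μ),
          shiftF_mul_mulF (good_linkFun hA hp ν), mulF_mul]
        simp only [mul_assoc]
      rw [h μ ν, h ν μ, (shiftF_commute hL ν μ).eq, ← sub_mul, ← mulF_sub]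
    rw [e1, mulF_eq_spacingMul (k := fun z => (z.1 : ℂ) * (curv Q A μ ν z + (z.1 : ℂ) * g z)) hpl,
      mulF_eq_spacingMul (f := fun z => (z.1 : ℂ) * (curv Q A μ ν z + (z.1 : ℂ) * g z))
        (k := fun z => curv Q A μ ν z + (z.1 : ℂ) * g z) (fun _ _ => rfl),
      mulF_spacing (f := fun z => curv Q A μ ν z + (z.1 : ℂ) * g z) (g := curv Q A μ ν) (k := g)
        (fun _ _ => rfl), spacingMul_mul, spacingMul_mul, add_mul]
    congr 3
    exact spacingMul_mul
  · exact hc.add (hgs.mono (spacing_dominated_one hL))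
  · rwa [add_sub_cancel_left]

/-- By unitarity `[T_μ, T_ν*] = -T_ν* [T_μ, T_ν] T_ν*`. To leading order the conjugating
translations can be made free and moved past the curvature. -/
theorem exists_commutator_star (hL : 0 < L) (hA : ∀ μ, ContDiff ℝ ∞ (A μ))
    (hp : ∀ μ, IsPeriodic L (A μ)) (μ ν : Fin d) :
    ∃ Z, covF L Q A μ * star (covF L Q A ν) - star (covF L Q A ν) * covF L Q A μ =
        spacingMul L (spacingMul L Z) ∧
      Approx L Z (-(mulF L (curv Q A μ ν) * (shiftF d μ * star (shiftF d ν)))) := by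
  obtain ⟨Z, hZ, hZ'⟩ := exists_commutator (Q := Q) hL hA hp μ ν
  refine ⟨-(star (covF L Q A ν) * Z * star (covF L Q A ν)), ?_, ?_⟩
  · have e : covF L Q A μ * star (covF L Q A ν) - star (covF L Q A ν) * covF L Q A μ =
        -(star (covF L Q A ν) * (covF L Q A μ * covF L Q A ν - covF L Q A ν * covF L Q A μ) *
          star (covF L Q A ν)) := by
      have : -(star (covF L Q A ν) * (covF L Q A μ * covF L Q A ν - covF L Q A ν * covF L Q A μ) *
          star (covF L Q A ν)) =
          star (covF L Q A ν) * covF L Q A ν * covF L Q A μ * star (covF L Q A ν) -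
          star (covF L Q A ν) * covF L Q A μ * (covF L Q A ν * star (covF L Q A ν)) := by
        noncomm_ring
      rw [this, star_covF_mul, covF_mul_star, one_mul, mul_one]
    rw [e, hZ, mul_spacingMul, mul_spacingMul, spacingMul_mul, spacingMul_mul, spacingMul_neg,
      spacingMul_neg]
  · have hs := (approx_covF (Q := Q) hL hA hp ν).star hL
    have hs' := Approx.refl hL (isOfOrder_star_shiftF hL ν)
    have hss := Approx.refl hL (isOfOrder_one_mul (isOfOrder_shiftF hL μ) (isOfOrder_shiftF hL ν))
    refine Approx.neg (((hs.mul hL hZ').mul hL hs).trans ?_)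
    have h1 := ((approx_star_shiftF_mul_mulF hL (good_curv Q hA hp μ ν) ν).mul hL hss).mul hL hs'
    have e1 : star (shiftF d ν) * mulF L (curv Q A μ ν) * (shiftF d μ * shiftF d ν) *
        star (shiftF d ν) = star (shiftF d ν) * (mulF L (curv Q A μ ν) *
          (shiftF d μ * shiftF d ν)) * star (shiftF d ν) := by noncomm_ring
    have e2 : mulF L (curv Q A μ ν) * star (shiftF d ν) * (shiftF d μ * shiftF d ν) *
        star (shiftF d ν) = mulF L (curv Q A μ ν) * (shiftF d μ * star (shiftF d ν)) := by
      have : mulF L (curv Q A μ ν) * star (shiftF d ν) * (shiftF d μ * shiftF d ν) *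
          star (shiftF d ν) = mulF L (curv Q A μ ν) * (star (shiftF d ν) * shiftF d μ) *
          (shiftF d ν * star (shiftF d ν)) := by noncomm_ring
      rw [this, shiftF_mul_star, mul_one, (shiftF_commute_star hL μ ν).eq]
    rwa [e1, e2] at h1

theorem exists_star_commutator (hL : 0 < L) (hA : ∀ μ, ContDiff ℝ ∞ (A μ))
    (hp : ∀ μ, IsPeriodic L (A μ)) (μ ν : Fin d) :
    ∃ Z, star (covF L Q A μ) * covF L Q A ν - covF L Q A ν * star (covF L Q A μ) =
        spacingMul L (spacingMul L Z) ∧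
      Approx L Z (-(mulF L (curv Q A μ ν) * (star (shiftF d μ) * shiftF d ν))) := by
  obtain ⟨Z, hZ, hZ'⟩ := exists_commutator_star (Q := Q) hL hA hp ν μ
  refine ⟨-Z, ?_, ?_⟩
  · rw [spacingMul_neg, spacingMul_neg, ← hZ, neg_sub]
  · have h := hZ'.neg
    rwa [curv_swap, mulF_neg, neg_mul, neg_neg, (shiftF_commute_star hL ν μ).eq] at h

theorem exists_star_commutator_star (hL : 0 < L) (hA : ∀ μ, ContDiff ℝ ∞ (A μ))
    (hp : ∀ μ, IsPeriodic L (A μ)) (μ ν : Fin d) :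
    ∃ Z, star (covF L Q A μ) * star (covF L Q A ν) - star (covF L Q A ν) * star (covF L Q A μ) =
        spacingMul L (spacingMul L Z) ∧
      Approx L Z (mulF L (curv Q A μ ν) * (star (shiftF d μ) * star (shiftF d ν))) := by
  obtain ⟨Z, hZ, hZ'⟩ := exists_commutator (Q := Q) hL hA hp ν μ
  refine ⟨star Z, ?_, ?_⟩
  · rw [← star_spacingMul, ← star_spacingMul, ← hZ, star_sub, star_mul, star_mul]
  · have h := hZ'.star hL
    rw [star_mul, star_mul, star_mulF, star_curv] at h
    refine h.trans ?_
    have hg := good_curv Q hA hp μ ν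
    have h1 := (Approx.refl hL (isOfOrder_star_shiftF hL μ)).mul hL
      (approx_star_shiftF_mul_mulF hL hg ν)
    have h2 := (approx_star_shiftF_mul_mulF hL hg μ).mul hL
      (Approx.refl hL (isOfOrder_star_shiftF hL ν))
    rw [← mul_assoc, ← mul_assoc] at h1
    rw [mul_assoc (mulF L _)] at h2
    exact h1.trans h2

end WilsonFermion

/-! ### Covariant operators and their leading symbols. -/

namespace WilsonFermion

open scoped ComplexOrder

variable {d : ℕ} {L M r Q : ℝ} {A : Fin d → (Fin d → ℝ) → ℝ}

section weights

theorem dominated_spacing_inv_lam (hL : 0 < L) : Dominated (spacingWeight d L) (1 / lam d L) :=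
  ⟨L + 2 * d, by positivity, fun n p => by
    have hl := zero_lt_one.trans_le (one_le_lam hL n p)
    simp only [Pi.div_apply, Pi.one_apply]
    rw [mul_one_div, le_div_iff₀ hl]
    exact spacing_mul_lam_le hL n p⟩

theorem dominated_spacing_lam_ell_div (hL : 0 < L) :
    Dominated (spacingWeight d L * lam d L) (ell d L / lam d L) :=
  ⟨1, zero_le_one, fun n p => by
    have hl := zero_lt_one.trans_le (one_le_lam hL n p)
    simp only [Pi.div_apply, Pi.mul_apply, one_mul, ell, Pi.add_apply, Pi.one_apply, Pi.pow_apply]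
    rw [le_div_iff₀ hl]
    nlinarith⟩

theorem dominated_ell_lam (hL : 0 < L) : Dominated (ell d L) (lam d L) :=
  ⟨1 + L + 2 * d, by positivity, fun n p => ell_le_lam hL n p⟩

theorem tempered_lam_sq_mul_inv_ell (hL : 0 < L) : Tempered (lam d L ^ 2 * (ell d L)⁻¹) :=
  ((tempered_lam hL).pow 2).mul (tempered_ell hL).inv

theorem dominated_ell_lam_sq_mul_inv_ell (hL : 0 < L) :
    Dominated (ell d L) (lam d L ^ 2 * (ell d L)⁻¹) :=
  ⟨(1 + L + 2 * d) ^ 2, by positivity, fun n p => by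
    have he := zero_lt_one.trans_le (one_le_ell hL n p)
    have h := pow_le_pow_left₀ he.le (ell_le_lam hL n p) 2
    simp only [Pi.mul_apply, Pi.pow_apply, Pi.inv_apply]
    rw [← mul_assoc, ← div_eq_mul_inv, le_div_iff₀ he, ← mul_pow, ← sq]
    exact h⟩

theorem dominated_lam_inv_ell_inv (hL : 0 < L) :
    Dominated ((lam d L)⁻¹ ^ 2) ((ell d L)⁻¹ / lam d L) := by
  have h := ((dominated_ell_lam (d := d) hL).inv (tempered_ell hL).pos (tempered_lam hL).pos).mul_right
    fun n p => ((tempered_lam hL).inv.pos n p).le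
  rwa [← sq, ← div_eq_mul_inv] at h

end weights

/-- With `T = T₀ + a V`, the deviation from the free operator is `(V - star V) / 2`, of order `1`,
one power of `lam` below `D`. -/
theorem quantizes_famD (hL : 0 < L) (hA : ∀ μ, ContDiff ℝ ∞ (A μ)) (hp : ∀ μ, IsPeriodic L (A μ))
    (μ : Fin d) : Quantizes L (lam d L) (famD L (covF L Q A) μ) (freeF (famD L (shiftF d) μ)) := by
  refine (Quantizes.of_isMultiplier (isMultiplier_famD hL μ) hL (tempered_lam hL)).perturb ?_
  obtain ⟨V, hV, e, -⟩ := exists_covF_expansion (Q := Q) hL hA hp μ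
  have e1 : famD L (covF L Q A) μ - famD L (shiftF d) μ = fun n => (1 / 2 : ℂ) • (V - star V) n := by
    funext n
    have ha : (spacing L (n + 1) : ℂ) ≠ 0 := by exact_mod_cast (spacing_pos hL n).ne'
    have h1 : covF L Q A μ n = shiftF d μ n + (spacing L (n + 1) : ℂ) • V n := congrFun e n
    have h2 : (covF L Q A μ n)ᴴ = (shiftF d μ n)ᴴ + (spacing L (n + 1) : ℂ) • (V n)ᴴ := by
      rw [h1, Matrix.conjTranspose_add, Matrix.conjTranspose_smul]
      simp
    simp only [Pi.sub_apply, famD, opD, Pi.star_apply, Matrix.star_eq_conjTranspose]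
    rw [h2, h1]
    simp only [← smul_sub]
    rw [show shiftF d μ n + (spacing L (n + 1) : ℂ) • V n -
      ((shiftF d μ n)ᴴ + (spacing L (n + 1) : ℂ) • (V n)ᴴ) - (shiftF d μ n - (shiftF d μ n)ᴴ) =
      (spacing L (n + 1) : ℂ) • (V n - (V n)ᴴ) by module, smul_smul]
    congr 1
    field_simp
  have e2 : lam d L / lam d L = 1 := by
    funext n p
    simp only [Pi.div_apply, Pi.one_apply]
    exact div_self ((tempered_lam hL).pos n p).ne'
  rw [e1, e2]
  exact (hV.sub (star_isOfOrder hV Tempered.one)).const_smul _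

/-- The prefactor `1 / a` uses up the spacing in `T = T₀ + a V`. The deviation is still of order `a
lam` rather than `1`, because only the hermitian combination `V + star V` enters. -/
theorem isOfOrder_famW_sub (hL : 0 < L) (hA : ∀ μ, ContDiff ℝ ∞ (A μ))
    (hp : ∀ μ, IsPeriodic L (A μ)) :
    IsOfOrder (spacingWeight d L * lam d L) (famW L r (covF L Q A) - famW L r (shiftF d)) := by
  choose V hV e hV' using fun μ => exists_covF_expansion (Q := Q) hL hA hp μ
  have e1 : famW L r (covF L Q A) - famW L r (shiftF d) =
      fun n => (r / 2 : ℂ) • (∑ μ, (V μ + star (V μ))) n := by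
    funext n
    have ha : (spacing L (n + 1) : ℂ) ≠ 0 := by exact_mod_cast (spacing_pos hL n).ne'
    have h1 : ∀ μ, covF L Q A μ n = shiftF d μ n + (spacing L (n + 1) : ℂ) • V μ n :=
      fun μ => congrFun (e μ) n
    have h2 : ∀ μ, (covF L Q A μ n)ᴴ = (shiftF d μ n)ᴴ + (spacing L (n + 1) : ℂ) • (V μ n)ᴴ := by
      intro μ
      rw [h1, Matrix.conjTranspose_add, Matrix.conjTranspose_smul]
      simp
    simp only [Pi.sub_apply, famW, neg_opW_eq, h2, Finset.sum_apply, Pi.add_apply, Pi.star_apply,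
      Matrix.star_eq_conjTranspose]
    simp only [h1]
    rw [← smul_sub, ← Finset.sum_sub_distrib]
    have h3 : ∀ μ, shiftF d μ n + (spacing L (n + 1) : ℂ) • V μ n +
        ((shiftF d μ n)ᴴ + (spacing L (n + 1) : ℂ) • (V μ n)ᴴ) - (2 : ℂ) • 1 -
        (shiftF d μ n + (shiftF d μ n)ᴴ - (2 : ℂ) • 1) =
        (spacing L (n + 1) : ℂ) • (V μ n + (V μ n)ᴴ) := fun μ => by module
    rw [Finset.sum_congr rfl fun μ _ => h3 μ, ← Finset.smul_sum, smul_smul]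
    congr 1
    field_simp
  rw [e1]
  exact (IsOfOrder.sum _ (fun n p => ((tempered_spacing_mul_lam hL).pos n p).le)
    fun μ _ => hV' μ).const_smul _

theorem quantizes_famW (hL : 0 < L) (hA : ∀ μ, ContDiff ℝ ∞ (A μ)) (hp : ∀ μ, IsPeriodic L (A μ)) :
    Quantizes L (spacingWeight d L * lam d L ^ 2) (famW L r (covF L Q A))
      (freeF (famW L r (shiftF d))) := by
  refine (Quantizes.of_isMultiplier (isMultiplier_famW hL r) hL
    ((tempered_spacingWeight hL).mul ((tempered_lam hL).pow 2))).perturb ?_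
  have e : spacingWeight d L * lam d L ^ 2 / lam d L = spacingWeight d L * lam d L := by
    funext n p
    have := ((tempered_lam (d := d) hL).pos n p).ne'
    simp only [Pi.div_apply, Pi.mul_apply, Pi.pow_apply]
    field_simp
  rw [e]
  exact isOfOrder_famW_sub hL hA hp

theorem isOfOrder_famL_sub (hL : 0 < L) (hA : ∀ μ, ContDiff ℝ ∞ (A μ))
    (hp : ∀ μ, IsPeriodic L (A μ)) :
    IsOfOrder (ell d L / lam d L) (famL L M r (covF L Q A) - famL L M r (shiftF d)) := by
  have e : famL L M r (covF L Q A) - famL L M r (shiftF d) =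
      -(famW L r (covF L Q A) - famW L r (shiftF d)) := by
    rw [famL_eq, famL_eq]
    abel
  rw [e]
  exact (isOfOrder_famW_sub hL hA hp).neg.mono (dominated_spacing_lam_ell_div hL)

theorem quantizes_famL (hL : 0 < L) (hA : ∀ μ, ContDiff ℝ ∞ (A μ)) (hp : ∀ μ, IsPeriodic L (A μ)) :
    Quantizes L (ell d L) (famL L M r (covF L Q A)) (freeF (famL L M r (shiftF d))) :=
  (Quantizes.of_isMultiplier (isMultiplier_famL hL M r) hL (tempered_ell hL)).perturb
    (isOfOrder_famL_sub hL hA hp)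

theorem exists_le_multiplierSymbol_famL (hL : 0 < L) (hM : 0 < M) (hr : 0 < r) :
    ∃ c, 0 < c ∧ ∀ n (p : Site d (n + 1)),
      c * ell d L n p ≤ ‖multiplierSymbol (famL L M r (shiftF d)) n p‖ := by
  obtain ⟨c, hc, h⟩ := le_symbL (d := d) hL hM hr
  refine ⟨c, hc, fun n p => (h n p).trans ?_⟩
  rw [multiplierSymbol_eq (hat_famL M r), Complex.norm_real]
  exact le_abs_self _

theorem isMultiplier_famL_inv (hL : 0 < L) (hM : 0 < M) (hr : 0 < r) :
    IsMultiplier L (ell d L)⁻¹ (famL L M r (shiftF d))⁻¹ := by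
  obtain ⟨c, hc, h⟩ := exists_le_multiplierSymbol_famL (d := d) hL hM hr
  exact (isMultiplier_famL hL M r).inv hL (tempered_ell hL) hc h

theorem posSemidef_famL_sub (hL : 0 < L) (hr : 0 < r) (n : ℕ) :
    (famL L M r (covF L Q A) n - (M : ℂ) • 1).PosSemidef :=
  posSemidef_opL_sub hr (spacing_pos hL n) fun μ => covShift_conjTranspose_mul n μ

theorem posSemidef_famC_sub (hL : 0 < L) (hM : 0 < M) (hr : 0 < r) (n : ℕ) :
    (famC L M r (covF L Q A) n - (M : ℂ) • 1).PosSemidef :=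
  posSemidef_opC_sub hM hr (spacing_pos hL n) fun μ => covShift_conjTranspose_mul n μ

theorem quantizes_famL_inv (hL : 0 < L) (hM : 0 < M) (hr : 0 < r) (hA : ∀ μ, ContDiff ℝ ∞ (A μ))
    (hp : ∀ μ, IsPeriodic L (A μ)) :
    Quantizes L (ell d L)⁻¹ (famL L M r (covF L Q A))⁻¹ (freeF (famL L M r (shiftF d))⁻¹) := by
  obtain ⟨c, hc, h⟩ := exists_le_multiplierSymbol_famL (d := d) hL hM hr
  refine (Quantizes.of_isMultiplier (isMultiplier_famL_inv hL hM hr) hL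
    (tempered_ell hL).inv).perturb ?_
  exact isOfOrder_inv_sub_inv hL hM (tempered_ell hL) (isMultiplier_famL hL M r) hc h
    (posSemidef_famL_sub hL hr) (isOfOrder_famL_sub hL hA hp) (dominated_lam_inv_ell_inv hL)

theorem famC_eq (T : Fin d → Fam d) :
    famC L M r T = famL L M r T - ∑ μ, famD L T μ * (famL L M r T)⁻¹ * famD L T μ := by
  funext n
  rw [Pi.sub_apply, Finset.sum_apply]
  rfl

theorem lam_mul_inv_ell_mul_lam : lam d L * (ell d L)⁻¹ * lam d L = lam d L ^ 2 * (ell d L)⁻¹ := by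
  ring

theorem isMultiplier_famC (hL : 0 < L) (hM : 0 < M) (hr : 0 < r) :
    IsMultiplier L (lam d L ^ 2 * (ell d L)⁻¹) (famC L M r (shiftF d)) := by
  have hl := tempered_lam (d := d) hL
  have hi := (tempered_ell (d := d) hL).inv
  rw [famC_eq]
  refine ((isMultiplier_famL hL M r).mono hL (dominated_ell_lam_sq_mul_inv_ell hL)).sub
    (IsMultiplier.sum _ hL (tempered_lam_sq_mul_inv_ell hL) fun μ _ => ?_) hL
    (tempered_lam_sq_mul_inv_ell hL)
  rw [← lam_mul_inv_ell_mul_lam]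
  exact ((isMultiplier_famD hL μ).mul (isMultiplier_famL_inv hL hM hr) hL hl hi).mul
    (isMultiplier_famD hL μ) hL (hl.mul hi) hl

theorem quantizes_famC (hL : 0 < L) (hM : 0 < M) (hr : 0 < r) (hA : ∀ μ, ContDiff ℝ ∞ (A μ))
    (hp : ∀ μ, IsPeriodic L (A μ)) :
    Quantizes L (lam d L ^ 2 * (ell d L)⁻¹) (famC L M r (covF L Q A))
      (freeF (famC L M r (shiftF d))) := by
  have h1 := (quantizes_famL (M := M) (r := r) (Q := Q) hL hA hp).mono hL
    (tempered_lam_sq_mul_inv_ell hL) (dominated_ell_lam_sq_mul_inv_ell hL)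
  have h2 : ∀ μ ∈ Finset.univ, Quantizes L (lam d L ^ 2 * (ell d L)⁻¹)
      (famD L (covF L Q A) μ * (famL L M r (covF L Q A))⁻¹ * famD L (covF L Q A) μ)
      (freeF (famD L (shiftF d) μ) * freeF (famL L M r (shiftF d))⁻¹ *
        freeF (famD L (shiftF d) μ)) := by
    intro μ _
    rw [← lam_mul_inv_ell_mul_lam]
    exact ((quantizes_famD hL hA hp μ).mul (quantizes_famL_inv hL hM hr hA hp) hL).mul
      (quantizes_famD hL hA hp μ) hL
  have h3 := h1.sub (Quantizes.sum Finset.univ hL (tempered_lam_sq_mul_inv_ell hL) h2) hL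
  rw [← famC_eq] at h3
  convert h3 using 1
  rw [famC_eq]
  funext n x
  simp only [freeF, symbFree, Pi.sub_apply, Finset.sum_apply, Pi.mul_apply]

theorem quant_freeF (K : Fam d) : quant (freeF K) = K := rfl

theorem exists_le_multiplierSymbol_famC (hL : 0 < L) (hM : 0 < M) (hr : 0 < r) :
    ∃ c, 0 < c ∧ ∀ n (p : Site d (n + 1)), c * (lam d L ^ 2 * (ell d L)⁻¹) n p ≤
      ‖multiplierSymbol (famC L M r (shiftF d)) n p‖ := by
  obtain ⟨c, hc, h⟩ := le_symbC (d := d) hL hM hr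
  refine ⟨c, hc, fun n p => (h n p).trans ?_⟩
  rw [multiplierSymbol_eq (hat_famC hL hM hr), Complex.norm_real]
  exact le_abs_self _

theorem isMultiplier_famC_inv (hL : 0 < L) (hM : 0 < M) (hr : 0 < r) :
    IsMultiplier L (lam d L ^ 2 * (ell d L)⁻¹)⁻¹ (famC L M r (shiftF d))⁻¹ := by
  obtain ⟨c, hc, h⟩ := exists_le_multiplierSymbol_famC (d := d) hL hM hr
  exact (isMultiplier_famC hL hM hr).inv hL (tempered_lam_sq_mul_inv_ell hL) hc h

theorem quantizes_famC_inv (hL : 0 < L) (hM : 0 < M) (hr : 0 < r) (hA : ∀ μ, ContDiff ℝ ∞ (A μ))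
    (hp : ∀ μ, IsPeriodic L (A μ)) :
    Quantizes L (lam d L ^ 2 * (ell d L)⁻¹)⁻¹ (famC L M r (covF L Q A))⁻¹
      (freeF (famC L M r (shiftF d))⁻¹) := by
  obtain ⟨c, hc, h⟩ := exists_le_multiplierSymbol_famC (d := d) hL hM hr
  refine (Quantizes.of_isMultiplier (isMultiplier_famC_inv hL hM hr) hL
    (tempered_lam_sq_mul_inv_ell hL).inv).perturb ?_
  have hsub := (quantizes_famC (Q := Q) hL hM hr hA hp).remainder
  rw [quant_freeF] at hsub
  refine isOfOrder_inv_sub_inv (s := 3) hL hM (tempered_lam_sq_mul_inv_ell hL)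
    (isMultiplier_famC hL hM hr) hc h (posSemidef_famC_sub hL hM hr) hsub
    ⟨1, zero_le_one, fun n p => ?_⟩
  have he := one_le_ell hL n p
  have hl := zero_lt_one.trans_le (one_le_lam hL n p)
  simp only [Pi.pow_apply, Pi.inv_apply, Pi.div_apply, Pi.mul_apply, one_mul, mul_inv, inv_inv,
    inv_pow]
  have e : ((lam d L n p ^ 2)⁻¹ * ell d L n p) / lam d L n p =
      ell d L n p * (lam d L n p ^ 3)⁻¹ := by
    field_simp
  rw [e]
  exact le_mul_of_one_le_left (by positivity) he

/-- `[D_μ, D_ν]` is a signed sum of the four commutators of translations and adjoints, over `4 a²`.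
Each of the mixed ones has a curvature of opposite sign, so all signs become positive and the
translations combine into `E_μ E_ν`. -/
theorem approx_famD_famD (hL : 0 < L) (hA : ∀ μ, ContDiff ℝ ∞ (A μ))
    (hp : ∀ μ, IsPeriodic L (A μ)) (μ ν : Fin d) :
    Approx L (famD L (covF L Q A) μ * famD L (covF L Q A) ν -
        famD L (covF L Q A) ν * famD L (covF L Q A) μ)
      (mulF L (curv Q A μ ν) * (famE (shiftF d) μ * famE (shiftF d) ν)) := by
  obtain ⟨Z₁, e₁, h₁⟩ := exists_commutator (Q := Q) hL hA hp μ ν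
  obtain ⟨Z₂, e₂, h₂⟩ := exists_commutator_star (Q := Q) hL hA hp μ ν
  obtain ⟨Z₃, e₃, h₃⟩ := exists_star_commutator (Q := Q) hL hA hp μ ν
  obtain ⟨Z₄, e₄, h₄⟩ := exists_star_commutator_star (Q := Q) hL hA hp μ ν
  have h := ((h₁.add h₂.neg).add (h₃.neg.add h₄)).const_smul (1 / 4 : ℂ)
  convert h using 1
  · funext n
    have ha : (spacing L (n + 1) : ℂ) ≠ 0 := by exact_mod_cast (spacing_pos hL n).ne'
    have solve : ∀ {X Z : Op d (n + 1)},
        X = (spacing L (n + 1) : ℂ) • (spacing L (n + 1) : ℂ) • Z →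
        Z = ((spacing L (n + 1) : ℂ)⁻¹ * (spacing L (n + 1) : ℂ)⁻¹) • X := by
      intro X Z hX
      rw [hX, smul_smul, smul_smul]
      rw [show (spacing L (n + 1) : ℂ)⁻¹ * (spacing L (n + 1) : ℂ)⁻¹ * spacing L (n + 1) *
        spacing L (n + 1) = 1 by field_simp, one_smul]
    have i₁ := solve (congrFun e₁ n)
    have i₂ := solve (congrFun e₂ n)
    have i₃ := solve (congrFun e₃ n)
    have i₄ := solve (congrFun e₄ n)
    simp only [Pi.add_apply, Pi.neg_apply, Pi.sub_apply, Pi.mul_apply, i₁, i₂, i₃, i₄, famD, opD,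
      Pi.star_apply, Matrix.star_eq_conjTranspose, smul_mul_assoc, mul_smul_comm, Matrix.sub_mul,
      Matrix.mul_sub]
    module
  · funext n
    simp only [Pi.add_apply, Pi.neg_apply, Pi.mul_apply, famE, opE,
      Pi.star_apply, Matrix.star_eq_conjTranspose, smul_mul_assoc, mul_smul_comm, Matrix.add_mul,
      Matrix.mul_add]
    module

/-- As for `[D_μ, D_ν]`, but now the signs leave `T_ν - T_ν*` in the second factor, which is `2 a
D_ν`. -/
theorem approx_famD_famE (hL : 0 < L) (hA : ∀ μ, ContDiff ℝ ∞ (A μ))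
    (hp : ∀ μ, IsPeriodic L (A μ)) (μ ν : Fin d) :
    Approx L (fun n => ((r : ℂ) / spacing L (n + 1)) •
        (famD L (covF L Q A) μ * famE (covF L Q A) ν - famE (covF L Q A) ν * famD L (covF L Q A) μ) n)
      (mulF L (curv Q A μ ν) * (famE (shiftF d) μ *
        fun n => ((r : ℂ) * spacing L (n + 1)) • famD L (shiftF d) ν n)) := by
  obtain ⟨Z₁, e₁, h₁⟩ := exists_commutator (Q := Q) hL hA hp μ ν
  obtain ⟨Z₂, e₂, h₂⟩ := exists_commutator_star (Q := Q) hL hA hp μ ν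
  obtain ⟨Z₃, e₃, h₃⟩ := exists_star_commutator (Q := Q) hL hA hp μ ν
  obtain ⟨Z₄, e₄, h₄⟩ := exists_star_commutator_star (Q := Q) hL hA hp μ ν
  have h := ((h₁.add h₂).add (h₃.neg.add h₄.neg)).const_smul (r / 4 : ℂ)
  convert h using 1
  · funext n
    have ha : (spacing L (n + 1) : ℂ) ≠ 0 := by exact_mod_cast (spacing_pos hL n).ne'
    have solve : ∀ {X Z : Op d (n + 1)},
        X = (spacing L (n + 1) : ℂ) • (spacing L (n + 1) : ℂ) • Z →
        Z = ((spacing L (n + 1) : ℂ)⁻¹ * (spacing L (n + 1) : ℂ)⁻¹) • X := by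
      intro X Z hX
      rw [hX, smul_smul, smul_smul]
      rw [show (spacing L (n + 1) : ℂ)⁻¹ * (spacing L (n + 1) : ℂ)⁻¹ * spacing L (n + 1) *
        spacing L (n + 1) = 1 by field_simp, one_smul]
    have i₁ := solve (congrFun e₁ n)
    have i₂ := solve (congrFun e₂ n)
    have i₃ := solve (congrFun e₃ n)
    have i₄ := solve (congrFun e₄ n)
    simp only [Pi.add_apply, Pi.neg_apply, Pi.sub_apply, Pi.mul_apply, i₁, i₂, i₃, i₄, famD, opD,
      famE, opE, Pi.star_apply, Matrix.star_eq_conjTranspose, smul_mul_assoc, mul_smul_comm,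
      Matrix.sub_mul, Matrix.mul_sub, Matrix.add_mul, Matrix.mul_add]
    module
  · funext n
    have ha : (spacing L (n + 1) : ℂ) ≠ 0 := by exact_mod_cast (spacing_pos hL n).ne'
    have hD : ((r : ℂ) * spacing L (n + 1)) • famD L (shiftF d) ν n =
        (r / 2 : ℂ) • (shiftF d ν n - (shiftF d ν n)ᴴ) := by
      rw [famD, opD, smul_smul]
      congr 1
      field_simp
    simp only [Pi.add_apply, Pi.neg_apply, Pi.mul_apply, famE, opE, hD,
      Pi.star_apply, Matrix.star_eq_conjTranspose, smul_mul_assoc, mul_smul_comm, Matrix.add_mul,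
      Matrix.mul_sub, Matrix.mul_add]
    module

end WilsonFermion

/-! ### The operators X and the trace of the remainder. -/

namespace WilsonFermion

open scoped ComplexOrder

variable {d : ℕ} {L M r Q : ℝ} {A : Fin d → (Fin d → ℝ) → ℝ} {w : Weight d}

theorem Approx.quantizes {K K₀ : Fam d} {f : ℝ × (Fin d → ℝ) → ℂ}
    (h : Approx L K (mulF L f * K₀)) (hL : 0 < L) (hf : Good L f) (hK : IsMultiplier L w K₀)
    (hw : Tempered w) (hdom : Dominated (spacingWeight d L) (w / lam d L)) :
    Quantizes L w K (symbF L f * freeF K₀) :=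
  (Quantizes.mulF_mul hf hK hL hw).perturb (h.sub.mono hdom)

/-- The free operator `r a D`. -/
def famRD (L r : ℝ) (ρ : Fin d) : Fam d :=
  fun n => ((r : ℂ) * spacing L (n + 1)) • famD L (shiftF d) ρ n

theorem isMultiplier_famRD (hL : 0 < L) (ρ : Fin d) :
    IsMultiplier L (spacingWeight d L * lam d L) (famRD L r ρ) :=
  (isMultiplier_famD hL ρ).smul (C := |r|) hL (abs_nonneg r) fun n p => le_of_eq <| by
    rw [norm_mul, Complex.norm_real, Complex.norm_real, Real.norm_of_nonneg (spacing_pos hL n).le,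
      Real.norm_eq_abs]
    simp only [Pi.mul_apply, spacingWeight]
    ring

theorem quantizes_commutator_famD (hL : 0 < L) (hA : ∀ μ, ContDiff ℝ ∞ (A μ))
    (hp : ∀ μ, IsPeriodic L (A μ)) (μ ν : Fin d) :
    Quantizes L 1 (famD L (covF L Q A) μ * famD L (covF L Q A) ν -
        famD L (covF L Q A) ν * famD L (covF L Q A) μ)
      (symbF L (curv Q A μ ν) * freeF (famE (shiftF d) μ * famE (shiftF d) ν)) := by
  refine (approx_famD_famD hL hA hp μ ν).quantizes hL (good_curv Q hA hp μ ν) ?_ Tempered.one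
    (dominated_spacing_inv_lam hL)
  have h := (isMultiplier_famE hL μ).mul (isMultiplier_famE hL ν) hL Tempered.one Tempered.one
  rwa [one_mul] at h

/-- The expression of the commutator of `L` and `D μ`. -/
def symbV (L r Q : ℝ) (A : Fin d → (Fin d → ℝ) → ℝ) (μ : Fin d) : SymbFam d :=
  ∑ ρ, symbF L (curv Q A μ ρ) * freeF (famE (shiftF d) μ * famRD L r ρ)

theorem quantizes_commutator_famL (hL : 0 < L) (hA : ∀ μ, ContDiff ℝ ∞ (A μ))
    (hp : ∀ μ, IsPeriodic L (A μ)) (μ : Fin d) :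
    Quantizes L (spacingWeight d L * lam d L)
      (famL L M r (covF L Q A) * famD L (covF L Q A) μ -
        famD L (covF L Q A) μ * famL L M r (covF L Q A)) (symbV L r Q A μ) := by
  have ht := tempered_spacing_mul_lam (d := d) hL
  have hdom : Dominated (spacingWeight d L) (spacingWeight d L * lam d L / lam d L) := by
    have e : spacingWeight d L * lam d L / lam d L = spacingWeight d L := by
      funext n p
      exact mul_div_cancel_right₀ _ ((tempered_lam hL).pos n p).ne'
    rw [e]
    exact Dominated.refl _
  have hm : ∀ ρ, IsMultiplier L (spacingWeight d L * lam d L)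
      (famE (shiftF d) μ * famRD L r ρ) := by
    intro ρ
    have h := (isMultiplier_famE hL μ).mul (isMultiplier_famRD (r := r) hL ρ) hL Tempered.one ht
    rwa [one_mul] at h
  have h := Quantizes.sum Finset.univ hL ht fun ρ _ =>
    (approx_famD_famE (r := r) hL hA hp μ ρ).quantizes hL (good_curv Q hA hp μ ρ) (hm ρ) ht hdom
  convert h using 1
  swap
  · rfl
  funext n
  have hE : ∀ ρ, covF L Q A ρ n + (covF L Q A ρ n)ᴴ - (2 : ℂ) • 1 =
      (2 : ℂ) • (famE (covF L Q A) ρ n - 1) := by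
    intro ρ
    rw [famE, opE]
    module
  have ha : (spacing L (n + 1) : ℂ) ≠ 0 := by exact_mod_cast (spacing_pos hL n).ne'
  -- Up to a multiple of the identity, L is `-(r / a) ∑ ρ, E_ρ`; its commutator with `D μ` is
  -- therefore `∑ ρ, (r / a) [D_μ, E_ρ]`.
  have hLn : famL L M r (covF L Q A) n = (M : ℂ) • 1 -
      ∑ ρ, ((r : ℂ) / spacing L (n + 1)) • (famE (covF L Q A) ρ n - 1) := by
    rw [famL_eq, Pi.sub_apply, famW, neg_opW_eq]
    simp only [hE]
    rw [← Finset.smul_sum, ← Finset.smul_sum, smul_smul]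
    congr 2
    field_simp
  rw [Pi.sub_apply, Pi.mul_apply, Pi.mul_apply, hLn, Finset.sum_apply, Matrix.sub_mul,
    Matrix.mul_sub, Matrix.sum_mul, Matrix.mul_sum, smul_mul_assoc, mul_smul_comm, Matrix.one_mul,
    Matrix.mul_one, sub_sub_sub_cancel_left, ← Finset.sum_sub_distrib]
  refine Finset.sum_congr rfl fun ρ _ => ?_
  simp only [Pi.sub_apply, Pi.mul_apply, smul_mul_assoc, mul_smul_comm, Matrix.sub_mul,
    Matrix.mul_sub, Matrix.one_mul, Matrix.mul_one, smul_sub]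
  abel

/-- The expression of `X μ ν`. -/
def symbX (L M r Q : ℝ) (A : Fin d → (Fin d → ℝ) → ℝ) (μ ν : Fin d) : SymbFam d :=
  freeF (famL L M r (shiftF d))⁻¹ *
      (symbF L (curv Q A μ ν) * freeF (famE (shiftF d) μ * famE (shiftF d) ν)) +
    (freeF (famL L M r (shiftF d))⁻¹ * symbV L r Q A μ * freeF (famL L M r (shiftF d))⁻¹ *
      freeF (famD L (shiftF d) ν) -
    freeF (famL L M r (shiftF d))⁻¹ * symbV L r Q A ν * freeF (famL L M r (shiftF d))⁻¹ *
      freeF (famD L (shiftF d) μ))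

theorem isUnit_det_famL (hL : 0 < L) (hM : 0 < M) (hr : 0 < r) (n : ℕ) :
    IsUnit (famL L M r (covF L Q A) n).det :=
  isUnit_det_of_posSemidef_sub hM (posSemidef_famL_sub hL hr n)

/-- Moving `L⁻¹` to the left leaves only commutators, each of which carries a curvature. The two
terms of X have order `lam ^ 2 / ell` separately; in this form all terms have order at most `1 /
ell`. -/
theorem famX_eq (hL : 0 < L) (hM : 0 < M) (hr : 0 < r) (μ ν : Fin d) :
    famX L M r (covF L Q A) μ ν =
      (famL L M r (covF L Q A))⁻¹ * (famD L (covF L Q A) μ * famD L (covF L Q A) ν -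
        famD L (covF L Q A) ν * famD L (covF L Q A) μ) +
      ((famL L M r (covF L Q A))⁻¹ * (famL L M r (covF L Q A) * famD L (covF L Q A) μ -
        famD L (covF L Q A) μ * famL L M r (covF L Q A)) * (famL L M r (covF L Q A))⁻¹ *
        famD L (covF L Q A) ν -
      (famL L M r (covF L Q A))⁻¹ * (famL L M r (covF L Q A) * famD L (covF L Q A) ν -
        famD L (covF L Q A) ν * famL L M r (covF L Q A)) * (famL L M r (covF L Q A))⁻¹ *
        famD L (covF L Q A) μ) := by
  set K := famL L M r (covF L Q A) with hK
  set D := famD L (covF L Q A) with hD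
  have h1 : K⁻¹ * K = 1 := funext fun n => Matrix.nonsing_inv_mul _ (isUnit_det_famL hL hM hr n)
  have h2 : K * K⁻¹ = 1 := funext fun n => Matrix.mul_nonsing_inv _ (isUnit_det_famL hL hM hr n)
  have e : ∀ μ ν, K⁻¹ * (K * D μ - D μ * K) * K⁻¹ * D ν = D μ * K⁻¹ * D ν - K⁻¹ * (D μ * D ν) := by
    intro μ ν
    have : K⁻¹ * (K * D μ - D μ * K) * K⁻¹ * D ν =
        (K⁻¹ * K) * D μ * K⁻¹ * D ν - K⁻¹ * D μ * (K * K⁻¹) * D ν := by noncomm_ring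
    rw [this, h1, h2]
    noncomm_ring
  have e' : famX L M r (covF L Q A) μ ν = D μ * K⁻¹ * D ν - D ν * K⁻¹ * D μ := rfl
  rw [e, e, e']
  noncomm_ring

theorem quantizes_famX (hL : 0 < L) (hM : 0 < M) (hr : 0 < r) (hA : ∀ μ, ContDiff ℝ ∞ (A μ))
    (hp : ∀ μ, IsPeriodic L (A μ)) (μ ν : Fin d) :
    Quantizes L (ell d L)⁻¹ (famX L M r (covF L Q A) μ ν) (symbX L M r Q A μ ν) := by
  have he := (tempered_ell (d := d) hL).inv
  have hLi := quantizes_famL_inv (Q := Q) hL hM hr hA hp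
  have h : ∀ μ ν, Quantizes L (ell d L)⁻¹ ((famL L M r (covF L Q A))⁻¹ *
      (famL L M r (covF L Q A) * famD L (covF L Q A) μ -
        famD L (covF L Q A) μ * famL L M r (covF L Q A)) * (famL L M r (covF L Q A))⁻¹ *
        famD L (covF L Q A) ν)
      (freeF (famL L M r (shiftF d))⁻¹ * symbV L r Q A μ * freeF (famL L M r (shiftF d))⁻¹ *
        freeF (famD L (shiftF d) ν)) := by
    intro μ ν
    refine (((hLi.mul (quantizes_commutator_famL hL hA hp μ) hL).mul hLi hL).mul
      (quantizes_famD hL hA hp ν) hL).mono hL he ⟨1, zero_le_one, fun n p => ?_⟩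
    have h1 := one_le_ell hL n p
    have h2 : 0 < (ell d L n p)⁻¹ := he.pos n p
    -- The term with `[L, D_μ]` has weight `a lam² / ell²`, and `a lam² ≤ ell` by the definition of
    -- `ell`.
    have h3 : spacingWeight d L n p * lam d L n p ^ 2 * (ell d L n p)⁻¹ ≤ 1 := by
      rw [← div_eq_mul_inv, div_le_one (zero_lt_one.trans_le h1)]
      simp [ell]
    simp only [Pi.mul_apply, Pi.inv_apply, one_mul]
    calc _ = (ell d L n p)⁻¹ * (spacingWeight d L n p * lam d L n p ^ 2 * (ell d L n p)⁻¹) := by ring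
      _ ≤ _ := mul_le_of_le_one_right h2.le h3
  rw [famX_eq hL hM hr]
  have h0 := hLi.mul (quantizes_commutator_famD (Q := Q) hL hA hp μ ν) hL
  rw [mul_one] at h0
  exact h0.add ((h μ ν).sub (h ν μ) hL)

/-- Both orders of `ξ` and W have the same normal product, so the leading symbol is twice `ξ W₀`.
This turns the factor `r / (2 a)` into `r / a`. -/
theorem quantizes_wilson (hL : 0 < L) (hA : ∀ μ, ContDiff ℝ ∞ (A μ))
    (hp : ∀ μ, IsPeriodic L (A μ)) {f : ℝ × (Fin d → ℝ) → ℂ} (hf : Good L f) :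
    Quantizes L (spacingWeight d L * lam d L ^ 2)
      (mulF L f * famW L r (covF L Q A) + famW L r (covF L Q A) * mulF L f)
      (symbF L f * freeF (famW L r (shiftF d)) + symbF L f * freeF (famW L r (shiftF d))) := by
  have hq := Quantizes.mulF_mul hf IsMultiplier.one hL Tempered.one
  have h1 : freeF (1 : Fam d) = 1 := rfl
  rw [mul_one, h1, mul_one] at hq
  have hW := quantizes_famW (r := r) (Q := Q) hL hA hp
  have h2 := hq.mul hW hL
  have h3 := hW.mul hq hL
  rw [one_mul] at h2
  rw [mul_one, ← (symbF_commute f (freeF (famW L r (shiftF d)))).eq] at h3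
  exact h2.add h3

/-- The product of operators that occurs in the trace. -/
def famProd {m : ℕ} (L M r Q : ℝ) (A : Fin d → (Fin d → ℝ) → ℝ) (f : ℝ × (Fin d → ℝ) → ℂ)
    (μ ν : Fin m → Fin d) : Fam d :=
  (mulF L f * famW L r (covF L Q A) + famW L r (covF L Q A) * mulF L f) *
    (famC L M r (covF L Q A))⁻¹ *
    (List.ofFn fun j => famX L M r (covF L Q A) (μ j) (ν j) * (famC L M r (covF L Q A))⁻¹).prod

/-- The expression of the product of operators that occurs in the trace. -/
def symbProd {m : ℕ} (L M r Q : ℝ) (A : Fin d → (Fin d → ℝ) → ℝ) (f : ℝ × (Fin d → ℝ) → ℂ)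
    (μ ν : Fin m → Fin d) : SymbFam d :=
  (symbF L f * freeF (famW L r (shiftF d)) + symbF L f * freeF (famW L r (shiftF d))) *
    freeF (famC L M r (shiftF d))⁻¹ *
    (List.ofFn fun j => symbX L M r Q A (μ j) (ν j) * freeF (famC L M r (shiftF d))⁻¹).prod

/-- Power counting: `a lam²` from W, `ell / lam²` from `C⁻¹`, `1 / lam²` from each `X C⁻¹`, and one
further `1 / lam` for a remainder. The excess `ell / lam` is bounded. -/
theorem isOfOrder_famProd_sub {m : ℕ} (hL : 0 < L) (hM : 0 < M) (hr : 0 < r)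
    (hA : ∀ μ, ContDiff ℝ ∞ (A μ)) (hp : ∀ μ, IsPeriodic L (A μ))
    {f : ℝ × (Fin d → ℝ) → ℂ} (hf : Good L f) (μ ν : Fin m → Fin d) :
    IsOfOrder (spacingWeight d L * (lam d L)⁻¹ ^ (2 * m))
      (famProd L M r Q A f μ ν - quant (symbProd L M r Q A f μ ν)) := by
  have hC := quantizes_famC_inv (Q := Q) hL hM hr hA hp
  have h := ((quantizes_wilson (r := r) (Q := Q) hL hA hp hf).mul hC hL).mul
    (Quantizes.list_prod hL fun j =>
      (quantizes_famX (Q := Q) hL hM hr hA hp (μ j) (ν j)).mul hC hL) hL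
  refine h.remainder.mono ⟨1 + L + 2 * d, by positivity, fun n p => ?_⟩
  have h1 := one_le_ell hL n p
  have h2 := one_le_lam hL n p
  have h3 := ell_le_lam hL n p
  have h4 := spacing_pos hL n
  have e0 : 0 < ell d L n p := zero_lt_one.trans_le h1
  have l0 : 0 < lam d L n p := zero_lt_one.trans_le h2
  simp only [Pi.mul_apply, Pi.inv_apply, Pi.div_apply, Pi.pow_apply, mul_inv, inv_inv]
  have e : spacingWeight d L n p * lam d L n p ^ 2 * ((lam d L n p ^ 2)⁻¹ * ell d L n p) *
      ((ell d L n p)⁻¹ * ((lam d L n p ^ 2)⁻¹ * ell d L n p)) ^ m / lam d L n p =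
      (ell d L n p / lam d L n p) * (spacingWeight d L n p * (lam d L n p)⁻¹ ^ (2 * m)) := by
    have : (ell d L n p)⁻¹ * ((lam d L n p ^ 2)⁻¹ * ell d L n p) = (lam d L n p)⁻¹ ^ 2 := by
      field_simp
    rw [this, ← pow_mul]
    field_simp
  rw [e]
  refine mul_le_mul_of_nonneg_right ?_ (by simp only [spacingWeight]; positivity)
  rw [div_le_iff₀ l0]
  exact h3

/-- `1 + log (n + 1)` is the logarithm of `e (n + 1)`. -/
theorem tendsto_one_add_log_pow_div (k : ℕ) :
    Tendsto (fun n : ℕ => (1 + Real.log (n + 1)) ^ k / ((n : ℝ) + 1)) atTop (𝓝 0) := by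
  have h1 : Tendsto (fun x : ℝ => Real.log x ^ k / x) atTop (𝓝 0) :=
    (Real.isLittleO_pow_log_id_atTop (n := k)).tendsto_div_nhds_zero
  have h2 : Tendsto (fun n : ℕ => Real.exp 1 * ((n : ℝ) + 1)) atTop atTop :=
    (tendsto_natCast_atTop_atTop.atTop_add tendsto_const_nhds).const_mul_atTop (Real.exp_pos 1)
  have h3 := (h1.comp h2).const_mul (Real.exp 1)
  rw [mul_zero] at h3
  refine h3.congr fun n => ?_
  have hn : (n : ℝ) + 1 ≠ 0 := by positivity
  simp only [Function.comp_apply]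
  rw [Real.log_mul (Real.exp_pos 1).ne' hn, Real.log_exp, ← mul_div_assoc,
    mul_div_mul_left _ _ (Real.exp_pos 1).ne']

/-- `lam ^ (-d)` is at most a constant times `1 / bracket`, so the sum over momenta grows only like
a power of `log N`, while `a = L / N`. -/
theorem IsOfOrder.tendsto_trace {K : Fam d} (hL : 0 < L)
    (h : IsOfOrder (spacingWeight d L * (lam d L)⁻¹ ^ d) K) :
    Tendsto (fun n => (K n).trace) atTop (𝓝 0) := by
  obtain ⟨C, hC, b⟩ := h.norm_trace_le
  set c : ℝ := L / 4 + Real.pi / 4 + 1 with hc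
  have hc0 : 0 < c := by have := Real.pi_pos; positivity
  refine squeeze_zero_norm (a := fun n : ℕ => C * (L * c ^ d * 2 ^ d) *
    ((1 + Real.log (n + 1)) ^ d / ((n : ℝ) + 1))) (fun n => (b n).trans ?_) ?_
  · rw [mul_assoc]
    refine mul_le_mul_of_nonneg_left ?_ hC
    have h1 : ∀ p : Site d (n + 1), (spacingWeight d L * (lam d L)⁻¹ ^ d) n p ≤
        spacing L (n + 1) * c ^ d * (bracket p)⁻¹ := by
      intro p
      have hl := zero_lt_one.trans_le (one_le_lam hL n p)
      have hb := bracket_le_lam_pow hL n p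
      have hb0 : 0 < bracket p := Finset.prod_pos fun μ _ => by positivity
      simp only [Pi.mul_apply, Pi.pow_apply, Pi.inv_apply, spacingWeight]
      rw [mul_assoc]
      refine mul_le_mul_of_nonneg_left ?_ (spacing_pos hL n).le
      rw [← div_eq_mul_inv, le_div_iff₀ hb0, inv_pow, inv_mul_le_iff₀ (pow_pos hl d), ← mul_pow,
        mul_comm]
      exact hb
    refine (Finset.sum_le_sum fun p _ => h1 p).trans ?_
    rw [← Finset.mul_sum]
    refine (mul_le_mul_of_nonneg_left (sum_bracket_inv_le d n) ?_).trans (le_of_eq ?_)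
    · have := spacing_pos hL n
      positivity
    · rw [spacing, mul_pow]
      push_cast
      ring
  · have h2 := (tendsto_one_add_log_pow_div d).const_mul (C * (L * c ^ d * 2 ^ d))
    rwa [mul_zero] at h2

end WilsonFermion

/-! ### The symbol of X as an antisymmetrization. -/

namespace WilsonFermion

open scoped ComplexOrder

variable {d : ℕ} {L M r Q : ℝ} {A : Fin d → (Fin d → ℝ) → ℝ} {w : Weight d}

theorem freeF_apply (K : Fam d) (n : ℕ) (x : Site d (n + 1)) : freeF K n x = K n := rfl

theorem symbF_mul_apply (f : ℝ × (Fin d → ℝ) → ℂ) (S : SymbFam d) (n : ℕ) (x : Site d (n + 1)) :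
    (symbF L f * S) n x = f (spacing L (n + 1), position L x) • S n x := by
  simp only [Pi.mul_apply, symbF, symbMul, smul_mul_assoc, Matrix.one_mul]

theorem symbV_apply (μ : Fin d) (n : ℕ) (x : Site d (n + 1)) :
    symbV L r Q A μ n x = ∑ ρ, (-(Complex.I * (Q : ℂ)) * (fieldStrength A μ ρ (position L x) : ℂ)) •
      (famE (shiftF d) μ n * (((r : ℂ) * spacing L (n + 1)) • famD L (shiftF d) ρ n)) := by
  simp only [symbV, Finset.sum_apply, symbF_mul_apply, freeF_apply]
  rfl

theorem symbX_apply (μ ν : Fin d) (n : ℕ) (x : Site d (n + 1)) :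
    symbX L M r Q A μ ν n x = (famL L M r (shiftF d) n)⁻¹ *
        ((-(Complex.I * (Q : ℂ)) * (fieldStrength A μ ν (position L x) : ℂ)) •
          (famE (shiftF d) μ n * famE (shiftF d) ν n)) +
      ((famL L M r (shiftF d) n)⁻¹ * symbV L r Q A μ n x * (famL L M r (shiftF d) n)⁻¹ *
          famD L (shiftF d) ν n -
        (famL L M r (shiftF d) n)⁻¹ * symbV L r Q A ν n x * (famL L M r (shiftF d) n)⁻¹ *
          famD L (shiftF d) μ n) := by
  have h := symbF_mul_apply (L := L) (curv Q A μ ν)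
    (freeF (famE (shiftF d) μ * famE (shiftF d) ν)) n x
  rw [freeF_apply] at h
  rw [symbX, Pi.add_apply, Pi.add_apply, Pi.mul_apply, Pi.mul_apply, h]
  rfl

theorem Xbar_apply (μ ν : Fin d) (n : ℕ) (x : Site d (n + 1)) :
    Xbar L M r Q A (n + 1) μ ν x = (-(Complex.I * (Q : ℂ))) •
      ((fieldStrength A μ ν (position L x) : ℂ) •
        (famE (shiftF d) μ n * famE (shiftF d) ν n * (famL L M r (shiftF d) n)⁻¹) +
      (2 * (spacing L (n + 1) : ℂ) * (r : ℂ)) •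
        ∑ ρ, (fieldStrength A ρ ν (position L x) : ℂ) • ((famL L M r (shiftF d) n)⁻¹ ^ 2 *
          famD L (shiftF d) ρ n * famD L (shiftF d) μ n * famE (shiftF d) ν n)) := by
  simp only [Xbar, Pi.smul_apply, Pi.add_apply, Pi.mul_apply, Finset.sum_apply, symbMul, symbFree,
    smul_mul_assoc, Matrix.one_mul]
  rfl

/-- The term with `E_μ E_ν` is already antisymmetric. The term from `[L, D_μ]` is, after `F_{μρ} =
-F_{ρμ}` and reordering of commuting factors, minus half the second term of `Xbar` with indices
exchanged; the factor 2 in `Xbar` cancels this half. -/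
theorem antisymmetrization_identity {R ι : Type*} [Ring R] [Algebra ℂ R] [Fintype ι] (I : R)
    (E D : ι → R) (F : ι → ι → ℂ) (q r a : ℂ) (hF : ∀ μ ν, F μ ν = -F ν μ)
    (cE : ∀ μ ν, E μ * E ν = E ν * E μ) (cED : ∀ μ ν, D μ * E ν = E ν * D μ)
    (cIE : ∀ μ, E μ * I = I * E μ) (cID : ∀ μ, D μ * I = I * D μ) (μ ν : ι) :
    I * ((q * F μ ν) • (E μ * E ν)) +
      (I * (∑ ρ, (q * F μ ρ) • (E μ * ((r * a) • D ρ))) * I * D ν -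
        I * (∑ ρ, (q * F ν ρ) • (E ν * ((r * a) • D ρ))) * I * D μ) =
    (1 / 2 : ℂ) • (q • (F μ ν • (E μ * E ν * I) + (2 * a * r) •
        ∑ ρ, F ρ ν • (I ^ 2 * D ρ * D μ * E ν)) -
      q • (F ν μ • (E ν * E μ * I) + (2 * a * r) •
        ∑ ρ, F ρ μ • (I ^ 2 * D ρ * D ν * E μ))) := by
  have e4 : ∀ μ ν, I * (∑ ρ, (q * F μ ρ) • (E μ * ((r * a) • D ρ))) * I * D ν =
      (-(q * (a * r))) • ∑ ρ, F ρ μ • (I ^ 2 * D ρ * D ν * E μ) := by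
    intro μ ν
    rw [Finset.mul_sum, Finset.sum_mul, Finset.sum_mul, Finset.smul_sum]
    refine Finset.sum_congr rfl fun ρ _ => ?_
    have h : I * (E μ * D ρ) * I * D ν = I ^ 2 * D ρ * D ν * E μ := by
      calc I * (E μ * D ρ) * I * D ν = I * (E μ * (D ρ * I) * D ν) := by noncomm_ring
        _ = I * (E μ * I * D ρ * D ν) := by rw [cID]; noncomm_ring
        _ = I ^ 2 * (E μ * D ρ * D ν) := by rw [cIE]; noncomm_ring
        _ = I ^ 2 * (D ρ * (E μ * D ν)) := by rw [← cED]; noncomm_ring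
        _ = _ := by rw [← cED]; noncomm_ring
    simp only [mul_smul_comm, smul_mul_assoc, smul_smul]
    rw [h, hF μ ρ]
    congr 1
    ring
  have h1 : E μ * E ν * I = I * (E μ * E ν) := by rw [mul_assoc, cIE, ← mul_assoc, cIE, mul_assoc]
  rw [e4, e4, cE ν μ, h1, hF ν μ, mul_smul_comm]
  module

theorem symbX_eq (hL : 0 < L) (hM : 0 < M) (hr : 0 < r) (μ ν : Fin d) (n : ℕ) :
    symbX L M r Q A μ ν n =
      (1 / 2 : ℂ) • (Xbar L M r Q A (n + 1) μ ν - Xbar L M r Q A (n + 1) ν μ) := by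
  have mI := isMultiplier_famL_inv (d := d) hL hM hr
  funext x
  rw [Pi.smul_apply, Pi.sub_apply, Xbar_apply, Xbar_apply, symbX_apply, symbV_apply, symbV_apply]
  refine antisymmetrization_identity (famL L M r (shiftF d) n)⁻¹ (fun μ => famE (shiftF d) μ n)
    (fun μ => famD L (shiftF d) μ n) (fun α β => (fieldStrength A α β (position L x) : ℂ)) _ _ _
    ?_ ?_ ?_ ?_ ?_ μ ν
  · intro μ ν
    simp [fieldStrength]
  · exact fun μ ν => congrFun ((isMultiplier_famE hL μ).commute (isMultiplier_famE hL ν)) n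
  · exact fun μ ν => congrFun ((isMultiplier_famD hL μ).commute (isMultiplier_famE hL ν)) n
  · exact fun μ => congrFun ((isMultiplier_famE hL μ).commute mI) n
  · exact fun μ => congrFun ((isMultiplier_famD hL μ).commute mI) n

end WilsonFermion

/-! ### Ordered products and the algebra of Dirac matrices. -/

namespace WilsonFermion

section products

variable {R : Type*} [Ring R]

theorem list_prod_ofFn_sum [Algebra ℂ R] {ι : Type*} [Fintype ι] {m : ℕ} (g : Fin m → ι → R) :
    (List.ofFn fun j => ∑ b, g j b).prod = ∑ p : Fin m → ι, (List.ofFn fun j => g j (p j)).prod := by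
  classical
  have h := (MultilinearMap.mkPiAlgebraFin ℂ m R).map_sum (α := fun _ => ι) g
  simpa only [MultilinearMap.mkPiAlgebraFin_apply] using h

theorem list_prod_ofFn_smul [Algebra ℂ R] {m : ℕ} (c : Fin m → ℂ) (g : Fin m → R) :
    (List.ofFn fun j => c j • g j).prod = (∏ j, c j) • (List.ofFn g).prod := by
  have h := (MultilinearMap.mkPiAlgebraFin ℂ m R).map_smul_univ c g
  simpa only [MultilinearMap.mkPiAlgebraFin_apply] using h

theorem list_prod_ofFn_swap {n : ℕ} (h : Fin (n + 1) → R) (i : Fin n)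
    (hi : h i.castSucc * h i.succ = -(h i.succ * h i.castSucc)) :
    (List.ofFn fun k => h (Equiv.swap i.castSucc i.succ k)).prod = -(List.ofFn h).prod := by
  induction n with
  | zero => exact i.elim0
  | succ n ih =>
    cases i using Fin.cases with
    | zero =>
      simp only [List.ofFn_succ, List.prod_cons]
      have h1 : ∀ k : Fin n, Equiv.swap (Fin.castSucc 0) (Fin.succ 0) k.succ.succ = k.succ.succ :=
        fun k => Equiv.swap_apply_of_ne_of_ne (Fin.succ_ne_zero _)
          fun h => (Fin.succ_ne_zero k) (Fin.succ_injective _ h)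
      have h2 : Equiv.swap (Fin.castSucc (0 : Fin (n + 1))) (Fin.succ 0) 0 = Fin.succ 0 :=
        Equiv.swap_apply_left _ _
      have h3 : Equiv.swap (Fin.castSucc (0 : Fin (n + 1))) (Fin.succ 0) (Fin.succ 0) = 0 :=
        Equiv.swap_apply_right _ _
      simp only [h1, h2, h3]
      rw [← mul_assoc, ← mul_assoc, ← neg_mul]
      congr 1
      have h4 : h 0 * h (Fin.succ 0) = -(h (Fin.succ 0) * h 0) := hi
      rw [h4, neg_neg]
    | succ j =>
      rw [List.ofFn_succ, List.ofFn_succ (f := h), List.prod_cons, List.prod_cons]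
      have h1 : ∀ k : Fin (n + 1), Equiv.swap j.succ.castSucc j.succ.succ k.succ =
          (Equiv.swap j.castSucc j.succ k).succ := by
        intro k
        rw [← Fin.succ_castSucc]
        exact (Fin.succ_injective _).swap_apply _ _ _
      have h2 : Equiv.swap j.succ.castSucc j.succ.succ (0 : Fin (n + 1 + 1)) = 0 :=
        Equiv.swap_apply_of_ne_of_ne (by rw [← Fin.succ_castSucc]; exact (Fin.succ_ne_zero _).symm)
          (Fin.succ_ne_zero _).symm
      simp only [h1, h2]
      rw [ih (fun k => h k.succ) j (by rw [← Fin.succ_castSucc] at hi; exact hi), mul_neg]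

end products

section gamma

variable {d n : ℕ} {γ : Fin d → Matrix (Fin n) (Fin n) ℂ}

theorem IsDirac.mul_self (hγ : IsDirac γ) (μ : Fin d) : γ μ * γ μ = -1 := by
  have h := hγ.2 μ μ
  rw [if_pos rfl, ← two_smul ℂ, ← smul_neg] at h
  exact smul_right_injective _ (two_ne_zero (α := ℂ)) h

theorem IsDirac.anticommute (hγ : IsDirac γ) {μ ν : Fin d} (h : μ ≠ ν) :
    γ μ * γ ν = -(γ ν * γ μ) := by
  have := hγ.2 μ ν
  rw [if_neg h] at this
  exact eq_neg_of_add_eq_zero_left this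

/-- Passing a factor with index other than `κ` costs a sign and passing `γ κ` none; `length + count`
has the parity of the number of sign changes. -/
theorem IsDirac.mul_list_prod (hγ : IsDirac γ) (κ : Fin d) (l : List (Fin d)) :
    γ κ * (l.map γ).prod = (-1 : ℂ) ^ (l.length + l.count κ) • ((l.map γ).prod * γ κ) := by
  induction l with
  | nil => simp
  | cons μ l ih =>
    rw [List.map_cons, List.prod_cons, List.length_cons]
    by_cases h : μ = κ
    · subst h
      rw [List.count_cons_self, mul_assoc, ih, mul_smul_comm]
      congr 1
      ring
    · rw [List.count_cons_of_ne h, ← mul_assoc, hγ.anticommute (Ne.symm h), Matrix.neg_mul, mul_assoc,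
        ih, mul_smul_comm, mul_assoc, ← neg_smul]
      congr 1
      ring

theorem IsDirac.list_prod_sq (hγ : IsDirac γ) {l : List (Fin d)} (hl : l.Nodup) :
    (l.map γ).prod * (l.map γ).prod = (-1 : ℂ) ^ (l.length * (l.length + 1) / 2) • 1 := by
  induction l with
  | nil => simp
  | cons μ l ih =>
    rw [List.nodup_cons] at hl
    have h := hγ.mul_list_prod μ l
    rw [List.count_eq_zero_of_not_mem hl.1, add_zero] at h
    have h' : (l.map γ).prod * γ μ = (-1 : ℂ) ^ l.length • (γ μ * (l.map γ).prod) := by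
      rw [h, smul_smul, ← mul_pow]
      simp
    rw [List.map_cons, List.prod_cons, List.length_cons, mul_assoc, ← mul_assoc (l.map γ).prod, h',
      smul_mul_assoc, mul_smul_comm, mul_assoc, ← mul_assoc (γ μ), hγ.mul_self, ih hl.2]
    have e : (l.length + 1) * (l.length + 1 + 1) / 2 = l.length * (l.length + 1) / 2 + l.length + 1 := by
      have : (l.length + 1) * (l.length + 1 + 1) = l.length * (l.length + 1) + (l.length + 1) * 2 := by
        ring
      rw [this, Nat.add_mul_div_right _ _ (by norm_num)]
      ring
    rw [e, neg_mul, one_mul, smul_neg, smul_smul, ← neg_smul]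
    congr 1
    ring

end gamma

theorem epsTensor_comp {d : ℕ} (f : Fin d → Fin d) (σ : Equiv.Perm (Fin d)) :
    epsTensor (f ∘ σ) = Equiv.Perm.sign σ * epsTensor f := by
  unfold epsTensor
  by_cases h : Function.Bijective f
  · have h' : Function.Bijective (f ∘ σ) := h.comp σ.bijective
    have e : Equiv.ofBijective (f ∘ σ) h' = Equiv.ofBijective f h * σ := by
      ext
      rfl
    rw [dif_pos h, dif_pos h', e, Equiv.Perm.sign_mul]
    push_cast
    ring
  · have h' : ¬Function.Bijective (f ∘ σ) := fun hb => h <| by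
      have := hb.comp σ.symm.bijective
      rwa [Function.comp_assoc, Equiv.self_comp_symm, Function.comp_id] at this
    rw [dif_neg h, dif_neg h', mul_zero]

section trace

variable {m n : ℕ} {γ : Fin (2 * m) → Matrix (Fin n) (Fin n) ℂ}

/-- Adjacent transpositions generate the permutations, and each one exchanges two anticommuting
factors. -/
theorem IsDirac.trace_perm {d : ℕ} {γ : Fin d → Matrix (Fin n) (Fin n) ℂ} (hγ : IsDirac γ)
    (G : Matrix (Fin n) (Fin n) ℂ) (σ : Equiv.Perm (Fin d)) :
    ((List.ofFn fun k => γ (σ k)).prod * G).trace =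
      ((Equiv.Perm.sign σ : ℤ) : ℂ) * ((List.ofFn γ).prod * G).trace := by
  cases d with
  | zero =>
    rw [Subsingleton.elim σ 1]
    simp
  | succ d =>
    have hσ : σ ∈ Submonoid.closure
        (Set.range fun i : Fin d => Equiv.swap i.castSucc i.succ) := by
      rw [Equiv.Perm.mclosure_swap_castSucc_succ]
      exact Submonoid.mem_top σ
    induction hσ using Submonoid.closure_induction_right with
    | one => simp
    | mul_right σ _ τ hτ ih =>
      obtain ⟨i, rfl⟩ := hτ
      have h := list_prod_ofFn_swap (fun k => γ (σ k)) i
        (hγ.anticommute fun h => (Fin.castSucc_lt_succ (i := i)).ne (σ.injective h))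
      simp only [Equiv.Perm.mul_apply]
      rw [h, Matrix.neg_mul, Matrix.trace_neg, ih, Equiv.Perm.sign_mul,
        Equiv.Perm.sign_swap (Fin.castSucc_lt_succ (i := i)).ne]
      push_cast
      ring

/-- If `f` is a permutation, the product reduces up to sign to the square of `γ_1 ⋯ γ_d`, which is
`(-1) ^ m`. Otherwise some `γ κ` is absent from the first product; it commutes with that even
product and anticommutes with `γ_1 ⋯ γ_d`, so cyclicity forces the trace to vanish. -/
theorem IsDirac.trace_mul_prod (hγ : IsDirac γ) (f : Fin (2 * m) → Fin (2 * m)) :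
    ((List.ofFn fun k => γ (f k)).prod * (List.ofFn γ).prod).trace =
      (-1) ^ m * n * (epsTensor f : ℂ) := by
  have hΓ : (List.ofFn γ).prod = ((List.finRange (2 * m)).map γ).prod := by rw [List.ofFn_eq_map]
  by_cases hf : Function.Bijective f
  · have h := hγ.trace_perm (List.ofFn γ).prod (Equiv.ofBijective f hf)
    simp only [Equiv.ofBijective_apply] at h
    rw [h, hΓ, hγ.list_prod_sq (List.nodup_finRange _), List.length_finRange, Matrix.trace_smul,
      Matrix.trace_one, Fintype.card_fin, epsTensor, dif_pos hf]
    have e : 2 * m * (2 * m + 1) / 2 = m + 2 * (m * m) := by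
      rw [mul_assoc, Nat.mul_div_cancel_left _ (by norm_num)]
      ring
    rw [e, pow_add, pow_mul, neg_one_sq, one_pow, smul_eq_mul]
    ring
  · have hs : ¬Function.Surjective f := fun h => hf (Finite.surjective_iff_bijective.1 h)
    obtain ⟨κ, hκ⟩ := not_forall.1 hs
    have h1 := hγ.mul_list_prod κ (List.finRange (2 * m))
    rw [List.length_finRange, List.count_eq_one_of_mem (List.nodup_finRange _)
      (List.mem_finRange κ), ← hΓ, pow_succ, pow_mul, neg_one_sq, one_pow, one_mul, neg_smul,
      one_smul] at h1
    have h2 := hγ.mul_list_prod κ (List.ofFn f)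
    rw [List.count_eq_zero_of_not_mem, List.length_ofFn, add_zero, pow_mul, neg_one_sq, one_pow,
      one_smul, List.map_ofFn] at h2
    swap
    · rw [List.mem_ofFn]
      exact hκ
    rw [epsTensor, dif_neg hf, Int.cast_zero, mul_zero]
    set P := (List.ofFn fun k => γ (f k)).prod with hP
    set Γ := (List.ofFn γ).prod
    have h2' : γ κ * P = P * γ κ := h2
    have h3 : (P * Γ).trace = -(P * Γ).trace := by
      calc (P * Γ).trace = -(P * Γ * (γ κ * γ κ)).trace := by rw [hγ.mul_self]; simp
        _ = -(γ κ * P * Γ * γ κ).trace := by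
          rw [← Matrix.mul_assoc, Matrix.trace_mul_comm]
          simp only [Matrix.mul_assoc]
        _ = -(P * (γ κ * Γ) * γ κ).trace := by rw [h2', Matrix.mul_assoc P]
        _ = (P * Γ * (γ κ * γ κ)).trace := by
          rw [h1, Matrix.mul_neg, Matrix.neg_mul, Matrix.trace_neg, neg_neg]
          simp only [Matrix.mul_assoc]
        _ = _ := by rw [hγ.mul_self]; simp
    linear_combination (1 / 2 : ℂ) * h3

theorem list_prod_ofFn_interleave {R : Type*} [Monoid R] {α : Type} (g : α → R) (μ ν : Fin m → α) :
    (List.ofFn fun k => g (interleave μ ν k)).prod =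
      (List.ofFn fun j => g (μ j) * g (ν j)).prod := by
  rw [List.ofFn_mul', List.prod_flatten, List.map_ofFn]
  congr 2
  funext j
  have h0 : interleave μ ν ⟨2 * (j : ℕ) + ((0 : Fin 2) : ℕ), by have := j.2; simp⟩ = μ j := by
    unfold interleave
    rw [if_pos (by simp)]
    congr 1
    ext
    simp
  have h1 : interleave μ ν ⟨2 * (j : ℕ) + ((1 : Fin 2) : ℕ), by have := j.2; simp; omega⟩ = ν j := by
    unfold interleave
    rw [if_neg (by simp)]
    congr 1
    ext
    simp
    omega
  simp only [Function.comp_apply, List.ofFn_succ, List.ofFn_zero, List.prod_cons, List.prod_nil,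
    mul_one]
  exact congrArg₂ (fun a b => g a * g b) h0 h1

end trace

end WilsonFermion

/-! ### Contraction with the antisymmetric tensor and the spin trace. -/

namespace WilsonFermion

section antisymmetrization

variable {m : ℕ}

/-- Exchange of `μ j` and `ν j` for the `j` with `b j`. -/
def exchange {α : Type} (b : Fin m → Bool) (q : (Fin m → α) × (Fin m → α)) :
    (Fin m → α) × (Fin m → α) :=
  (fun j => if b j then q.2 j else q.1 j, fun j => if b j then q.1 j else q.2 j)

theorem exchange_involutive {α : Type} (b : Fin m → Bool) :
    Function.Involutive (exchange (α := α) b) := by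
  intro q
  ext j <;> by_cases h : b j = true <;> simp [exchange, h]

/-- The positions of an interleaved sequence. -/
def pairEquiv (m : ℕ) : Fin m × Fin 2 ≃ Fin (2 * m) :=
  finProdFinEquiv.trans (finCongr (mul_comm m 2))

theorem interleave_pairEquiv {α : Type} (μ ν : Fin m → α) (j : Fin m) (i : Fin 2) :
    interleave μ ν (pairEquiv m (j, i)) = if i = 0 then μ j else ν j := by
  have hv : ((pairEquiv m (j, i) : Fin (2 * m)) : ℕ) = i + 2 * j := rfl
  have hd : ((pairEquiv m (j, i) : Fin (2 * m)) : ℕ) / 2 = j := by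
    rw [hv]
    omega
  unfold interleave
  simp only [hd]
  have hm : ((pairEquiv m (j, i) : Fin (2 * m)) : ℕ) % 2 = i := by
    rw [hv]
    omega
  simp only [hm]
  fin_cases i <;> simp

/-- The sign of a choice of exchanges. -/
def exchangeSign (b : Bool) : ℤ := if b then -1 else 1

/-- The exchanges act on the interleaved sequence as a product of disjoint transpositions, one for
each `j` with `b j`. -/
theorem epsTensor_exchange (b : Fin m → Bool)
    (q : (Fin m → Fin (2 * m)) × (Fin m → Fin (2 * m))) :
    epsTensor (interleave (exchange b q).1 (exchange b q).2) =
      (∏ j, exchangeSign (b j)) * epsTensor (interleave q.1 q.2) := by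
  set τ : Fin m → Equiv.Perm (Fin 2) := fun j => if b j then Equiv.swap 0 1 else 1 with hτ
  set σ : Equiv.Perm (Fin (2 * m)) :=
    ((pairEquiv m).symm.trans (Equiv.prodCongrRight τ)).trans (pairEquiv m) with hσ
  have h1 : interleave (exchange b q).1 (exchange b q).2 = interleave q.1 q.2 ∘ σ := by
    funext k
    obtain ⟨⟨j, i⟩, rfl⟩ := (pairEquiv m).surjective k
    rw [Function.comp_apply, hσ, Equiv.trans_apply, Equiv.trans_apply, Equiv.symm_apply_apply,
      Equiv.prodCongrRight_apply, interleave_pairEquiv, interleave_pairEquiv]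
    by_cases h : b j = true <;> fin_cases i <;> simp [exchange, hτ, h]
  have h2 : (Equiv.Perm.sign σ : ℤ) = ∏ j, exchangeSign (b j) := by
    have h3 : Equiv.Perm.sign σ = Equiv.Perm.sign (Equiv.prodCongrRight τ) :=
      Equiv.Perm.sign_symm_trans_trans _ _
    rw [h3, Equiv.Perm.sign_prodCongrRight, Units.coe_prod]
    refine Finset.prod_congr rfl fun j _ => ?_
    by_cases h : b j = true <;> simp [hτ, exchangeSign, h]
  rw [h1, epsTensor_comp, h2]

/-- Expanding the product gives one term for each choice of exchanges, with its sign. The sign is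
that of ε under the same exchanges, so reindexing makes all `2 ^ m` terms equal, and the factors `1
/ 2` average them. -/
theorem sum_epsTensor_antisymmetrize {R : Type*} [Ring R] [Algebra ℂ R]
    (Y : Fin (2 * m) → Fin (2 * m) → R) (c : R) :
    ∑ q : (Fin m → Fin (2 * m)) × (Fin m → Fin (2 * m)), (epsTensor (interleave q.1 q.2) : ℂ) •
        (List.ofFn fun j => ((1 / 2 : ℂ) • (Y (q.1 j) (q.2 j) - Y (q.2 j) (q.1 j))) * c).prod =
      ∑ q : (Fin m → Fin (2 * m)) × (Fin m → Fin (2 * m)), (epsTensor (interleave q.1 q.2) : ℂ) •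
        (List.ofFn fun j => Y (q.1 j) (q.2 j) * c).prod := by
  set G : (Fin m → Fin (2 * m)) × (Fin m → Fin (2 * m)) → R := fun q =>
    (epsTensor (interleave q.1 q.2) : ℂ) • (List.ofFn fun j => Y (q.1 j) (q.2 j) * c).prod with hG
  have h1 : ∀ q : (Fin m → Fin (2 * m)) × (Fin m → Fin (2 * m)),
      (epsTensor (interleave q.1 q.2) : ℂ) •
        (List.ofFn fun j => ((1 / 2 : ℂ) • (Y (q.1 j) (q.2 j) - Y (q.2 j) (q.1 j))) * c).prod =
      ∑ b : Fin m → Bool, ((1 / 2 : ℂ) ^ m) • G (exchange b q) := by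
    intro q
    have h2 : ∀ j, ((1 / 2 : ℂ) • (Y (q.1 j) (q.2 j) - Y (q.2 j) (q.1 j))) * c =
        ∑ t : Bool, ((1 / 2 : ℂ) * (exchangeSign t : ℂ)) •
          (Y (if t then q.2 j else q.1 j) (if t then q.1 j else q.2 j) * c) := by
      intro j
      rw [Fintype.sum_bool]
      simp only [exchangeSign, if_true, Bool.false_eq_true, if_false]
      rw [smul_mul_assoc, sub_mul]
      push_cast
      module
    simp only [h2]
    rw [list_prod_ofFn_sum, Finset.smul_sum]
    refine Finset.sum_congr rfl fun b _ => ?_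
    rw [list_prod_ofFn_smul, Finset.prod_mul_distrib, Finset.prod_const, Finset.card_univ,
      Fintype.card_fin, hG]
    simp only [epsTensor_exchange]
    rw [smul_smul, smul_smul]
    congr 1
    push_cast
    ring
  simp only [h1]
  rw [Finset.sum_comm]
  have h3 : ∀ b : Fin m → Bool, ∑ q, ((1 / 2 : ℂ) ^ m) • G (exchange b q) =
      ((1 / 2 : ℂ) ^ m) • ∑ q, G q := by
    intro b
    rw [← Finset.smul_sum]
    congr 1
    exact Equiv.sum_comp (exchange_involutive b).toPerm G
  simp only [h3]
  rw [Finset.sum_const, Finset.card_univ, Fintype.card_fun, Fintype.card_bool, Fintype.card_fin,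
    ← Nat.cast_smul_eq_nsmul ℂ, smul_smul]
  push_cast
  rw [← mul_pow]
  norm_num

end antisymmetrization

section expansion

/-- The trace factorizes over the tensor product. Its spinor part is ε times `(-1) ^ m`, and this
sign cancels the one from the power of `-B C⁻¹`. -/
theorem trace_spin_expansion {m n : ℕ} {γ : Fin (2 * m) → Matrix (Fin n) (Fin n) ℂ}
    (hγ : IsDirac γ) {ι : Type*} [Fintype ι] [DecidableEq ι]
    (X : Fin (2 * m) → Fin (2 * m) → Matrix ι ι ℂ) (C P : Matrix ι ι ℂ) :
    Matrix.trace (((1 : Matrix (Fin n) (Fin n) ℂ) ⊗ₖ P) * (1 ⊗ₖ C) *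
      (-(((1 / 2 : ℂ) • ∑ μ, ∑ ν, (γ μ * γ ν) ⊗ₖ X μ ν) * ((1 : Matrix (Fin n) (Fin n) ℂ) ⊗ₖ C))) ^ m *
      (chirality γ ⊗ₖ (1 : Matrix ι ι ℂ))) =
    Complex.I ^ m * (1 / 2) ^ m * n *
      ∑ q : (Fin m → Fin (2 * m)) × (Fin m → Fin (2 * m)), (epsTensor (interleave q.1 q.2) : ℂ) *
        (P * C * (List.ofFn fun j => X (q.1 j) (q.2 j) * C).prod).trace := by
  have h1 : -(((1 / 2 : ℂ) • ∑ μ, ∑ ν, (γ μ * γ ν) ⊗ₖ X μ ν) *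
      ((1 : Matrix (Fin n) (Fin n) ℂ) ⊗ₖ C)) =
      ∑ p : Fin (2 * m) × Fin (2 * m), (-(1 / 2 : ℂ)) •
        ((γ p.1 * γ p.2) ⊗ₖ (X p.1 p.2 * C)) := by
    rw [Fintype.sum_prod_type, smul_mul_assoc, ← neg_smul]
    simp only [← Finset.smul_sum, Matrix.sum_mul, ← Matrix.mul_kronecker_mul, Matrix.mul_one]
  have hk : ∀ (k : ℕ) (a : Fin k → Matrix (Fin n) (Fin n) ℂ) (b : Fin k → Matrix ι ι ℂ),
      (List.ofFn fun j => a j ⊗ₖ b j).prod = (List.ofFn a).prod ⊗ₖ (List.ofFn b).prod := by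
    intro k
    induction k with
    | zero =>
      intro a b
      simp
    | succ k ih =>
      intro a b
      simp only [List.ofFn_succ, List.prod_cons]
      rw [ih, ← Matrix.mul_kronecker_mul]
  have hpow : ∀ S : Matrix (Fin n × ι) (Fin n × ι) ℂ, S ^ m = (List.ofFn fun _ : Fin m => S).prod := by
    intro S
    rw [List.ofFn_const, List.prod_replicate]
  rw [h1, hpow, list_prod_ofFn_sum]
  simp only [list_prod_ofFn_smul, hk]
  rw [Finset.prod_const, Finset.card_univ, Fintype.card_fin, Matrix.mul_sum, Matrix.sum_mul,
    Matrix.trace_sum, ← Equiv.sum_comp (Equiv.arrowProdEquivProdArrow (Fin m) (fun _ => Fin (2 * m))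
      (fun _ => Fin (2 * m))).symm, Finset.mul_sum]
  refine Finset.sum_congr rfl fun q _ => ?_
  rw [mul_smul_comm, smul_mul_assoc, Matrix.trace_smul, ← Matrix.mul_kronecker_mul,
    ← Matrix.mul_kronecker_mul, ← Matrix.mul_kronecker_mul, Matrix.trace_kronecker, Matrix.one_mul,
    Matrix.one_mul, Matrix.mul_one, chirality, mul_smul_comm, Matrix.trace_smul]
  have h2 := hγ.trace_mul_prod (interleave q.1 q.2)
  rw [list_prod_ofFn_interleave] at h2
  simp only [Equiv.arrowProdEquivProdArrow_symm_apply]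
  rw [h2, smul_eq_mul, smul_eq_mul]
  have h3 : (-(1 / 2 : ℂ)) ^ m * (-1) ^ m = (1 / 2) ^ m := by
    rw [← mul_pow]
    norm_num
  linear_combination (Complex.I ^ m * n * (epsTensor (interleave q.1 q.2) : ℂ) *
    (P * C * (List.ofFn fun j => X (q.1 j) (q.2 j) * C).prod).trace) * h3

end expansion

/-! ### Both sides as sums over index sequences. -/

section terms

variable {m : ℕ} {L M r Q : ℝ} {A : Fin (2 * m) → (Fin (2 * m) → ℝ) → ℝ}
  {ξ : (Fin (2 * m) → ℝ) → ℝ}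

theorem zTerm_eq {γ : Fin (2 * m) → Matrix (Fin (2 ^ m)) (Fin (2 ^ m)) ℂ} (hγ : IsDirac γ) (n : ℕ) :
    zTerm γ L M r Q A ξ (n + 1) m = -(Complex.I ^ (m + 1)) *
      ∑ q : (Fin m → Fin (2 * m)) × (Fin m → Fin (2 * m)), (epsTensor (interleave q.1 q.2) : ℂ) *
        (famProd L M r Q A (fun z => (ξ z.2 : ℂ)) q.1 q.2 n).trace := by
  have hprod : ∀ q : (Fin m → Fin (2 * m)) × (Fin m → Fin (2 * m)),
      famProd L M r Q A (fun z => (ξ z.2 : ℂ)) q.1 q.2 n =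
      (((r : ℂ) / (2 * (spacing L (n + 1) : ℂ))) • (mulOp L (fun x => (ξ x : ℂ)) *
          opW (covShift (N := n + 1) L Q A) +
        opW (covShift (N := n + 1) L Q A) * mulOp L fun x => (ξ x : ℂ))) *
        (opC M r (spacing L (n + 1)) (covShift (N := n + 1) L Q A))⁻¹ *
        (List.ofFn fun j => opX M r (spacing L (n + 1)) (covShift (N := n + 1) L Q A) (q.1 j) (q.2 j) *
          (opC M r (spacing L (n + 1)) (covShift (N := n + 1) L Q A))⁻¹).prod := by
    intro q
    have hev := map_list_prod (Pi.evalRingHom (fun n => Op (2 * m) (n + 1)) n)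
      (List.ofFn fun j => famX L M r (covF L Q A) (q.1 j) (q.2 j) * (famC L M r (covF L Q A))⁻¹)
    rw [List.map_ofFn] at hev
    rw [famProd, Pi.mul_apply]
    refine congrArg₂ (· * ·) (congrArg (fun S : Op (2 * m) (n + 1) => S *
      (opC M r (spacing L (n + 1)) (covShift (N := n + 1) L Q A))⁻¹) ?_) hev
    rw [smul_add, ← mul_smul_comm, ← smul_mul_assoc]
    rfl
  have h := trace_spin_expansion hγ (opX M r (spacing L (n + 1)) (covShift (N := n + 1) L Q A))
    (opC M r (spacing L (n + 1)) (covShift (N := n + 1) L Q A))⁻¹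
    (((r : ℂ) / (2 * (spacing L (n + 1) : ℂ))) • (mulOp L (fun x => (ξ x : ℂ)) *
      opW (covShift (N := n + 1) L Q A) +
        opW (covShift (N := n + 1) L Q A) * mulOp L fun x => (ξ x : ℂ)))
  rw [Matrix.kronecker_smul] at h
  simp only [hprod]
  unfold zTerm opB
  simp only
  rw [h]
  -- The `m` factors `1 / 2` of `B` cancel the dimension `2 ^ m` of the spinor space.
  have h2 : (1 / 2 : ℂ) ^ m * ((2 ^ m : ℕ) : ℂ) = 1 := by
    push_cast
    rw [← mul_pow]
    norm_num
  generalize (∑ q : (Fin m → Fin (2 * m)) × (Fin m → Fin (2 * m)), _ : ℂ) = S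
  linear_combination (-(Complex.I ^ (m + 1)) * S) * h2

theorem zFree_eq (hL : 0 < L) (hM : 0 < M) (hr : 0 < r) (n : ℕ) :
    zFree L M r Q A ξ (n + 1) = -(Complex.I ^ (m + 1)) *
      ∑ q : (Fin m → Fin (2 * m)) × (Fin m → Fin (2 * m)), (epsTensor (interleave q.1 q.2) : ℂ) *
        (quant (symbProd L M r Q A (fun z => (ξ z.2 : ℂ)) q.1 q.2) n).trace := by
  set W0 : Symb (2 * m) (n + 1) := symbFree (opW freeShift) with hW0
  set C0 : Symb (2 * m) (n + 1) := symbFree (opC M r (spacing L (n + 1)) freeShift)⁻¹ with hC0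
  -- Everything outside the ordered product of the `Xbar` is packed into a linear functional, so
  -- that the identity in the algebra of formal expressions can be applied under the trace.
  set φ : Symb (2 * m) (n + 1) →ₗ[ℂ] ℂ :=
    { toFun := fun S => (normalProduct (((r : ℂ) / (spacing L (n + 1) : ℂ)) •
        (symbMul L (fun x => (ξ x : ℂ)) * W0 * C0 * S))).trace
      map_add' := fun S S' => by
        rw [mul_add, smul_add, ← Matrix.trace_add]
        rfl
      map_smul' := fun c S => by
        rw [mul_smul_comm, smul_comm, RingHom.id_apply, ← Matrix.trace_smul]
        rfl } with hφ
  have hprod : ∀ q : (Fin m → Fin (2 * m)) × (Fin m → Fin (2 * m)),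
      (quant (symbProd L M r Q A (fun z => (ξ z.2 : ℂ)) q.1 q.2) n).trace =
      φ (List.ofFn fun j => ((1 / 2 : ℂ) • (Xbar L M r Q A (n + 1) (q.1 j) (q.2 j) -
        Xbar L M r Q A (n + 1) (q.2 j) (q.1 j))) * C0).prod := by
    intro q
    have hev := map_list_prod (Pi.evalRingHom (fun n => Symb (2 * m) (n + 1)) n)
      (List.ofFn fun j => symbX L M r Q A (q.1 j) (q.2 j) * freeF (famC L M r (shiftF (2 * m)))⁻¹)
    rw [List.map_ofFn] at hev
    simp only [← symbX_eq hL hM hr]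
    refine congrArg (fun S => (normalProduct S).trace) ?_
    rw [symbProd, Pi.mul_apply, ← smul_mul_assoc]
    refine congrArg₂ (· * ·) ?_ hev
    rw [← smul_mul_assoc]
    refine congrArg (· * C0) ?_
    have hW : freeF (famW L r (shiftF (2 * m))) n =
        ((r : ℂ) / (2 * (spacing L (n + 1) : ℂ))) • W0 := rfl
    rw [Pi.add_apply, Pi.mul_apply, hW, mul_smul_comm, ← add_smul]
    congr 1
    ring
  simp only [hprod]
  have h := congrArg φ (sum_epsTensor_antisymmetrize (Xbar L M r Q A (n + 1)) C0)
  simp only [map_sum, map_smul, smul_eq_mul] at h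
  rw [h, Fintype.sum_prod_type]
  rfl

end terms

end WilsonFermion

end

/-! ### Conclusion: a fixed finite sum of vanishing traces. -/

theorem proposition6p3 (m : ℕ) (hm : 1 ≤ m) (L M r Q : ℝ) (hL : 0 < L) (hM : 0 < M) (hr : 0 < r)
    (γ : Fin (2 * m) → Matrix (Fin (2 ^ m)) (Fin (2 ^ m)) ℂ) (hγ : IsDirac γ)
    (A : Fin (2 * m) → (Fin (2 * m) → ℝ) → ℝ)
    (hA : ∀ μ, ContDiff ℝ ∞ (A μ)) (hAper : ∀ μ, IsPeriodic L (A μ))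
    (ξ : (Fin (2 * m) → ℝ) → ℝ) (hξ : ContDiff ℝ ∞ ξ) (hξper : IsPeriodic L ξ) :
    Tendsto (fun n : ℕ => zTerm γ L M r Q A ξ (n + 1) m - zFree L M r Q A ξ (n + 1))
      atTop (𝓝 0) := by
  have hf : Good L fun z : ℝ × (Fin (2 * m) → ℝ) => (ξ z.2 : ℂ) := good_ofReal hξ hξper
  have h : Tendsto (fun n : ℕ => -(Complex.I ^ (m + 1)) *
      ∑ q : (Fin m → Fin (2 * m)) × (Fin m → Fin (2 * m)), (epsTensor (interleave q.1 q.2) : ℂ) *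
        ((famProd L M r Q A (fun z => (ξ z.2 : ℂ)) q.1 q.2 -
          quant (symbProd L M r Q A (fun z => (ξ z.2 : ℂ)) q.1 q.2)) n).trace) atTop
      (𝓝 (-(Complex.I ^ (m + 1)) *
        ∑ q : (Fin m → Fin (2 * m)) × (Fin m → Fin (2 * m)),
          (epsTensor (interleave q.1 q.2) : ℂ) * 0)) :=
    (tendsto_finsetSum _ fun q _ => ((isOfOrder_famProd_sub hL hM hr hA hAper hf q.1
      q.2).tendsto_trace hL).const_mul _).const_mul _
  simp only [mul_zero, Finset.sum_const_zero] at h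
  refine h.congr fun n => ?_
  rw [zTerm_eq hγ, zFree_eq hL hM hr, ← mul_sub, ← Finset.sum_sub_distrib]
  simp only [← mul_sub, Pi.sub_apply, Matrix.trace_sub]
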